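/- **Setting.** Let $\mathbb K$ be a totally real number field of degree $d$ with ring of integers $\mathcal O$, different $\partial$ and real embeddings $\psi_1,\dots,\psi_d$. Let $k,n\ge 1$ and $m=2k$. Let $\mathcal A_1,\dots,\mathcal A_m$ and $\mathcal I_1,\dots,\mathcal I_n$ be nonzero fractional ideals, let $x_1,\dots,x_m$ be a basis of a $\mathbb K$-vector space, and let $L=\mathcal A_1x_1\oplus\cdots\oplus\mathcal A_mx_m$ be equipped with a totally positive quadratic form $\mathfrak q(x)=B_{\mathfrak q}(x,x)$, where $B_{\mathfrak q}$ is a symmetric $\mathbb K$-bilinear form. Put $Q=(B_{\mathfrak q}(x_i,x_j))_{i,j}$ and $Q[U]={}^tUQU$. Let $\mathrm{norm}\,L$ be the fractional ideal generated by $\{\mathfrak q(x):x\in L\}$, let $L^{\#}=\{v\in\mathbb KL: B_{\mathfrak q}(v,L)\subseteq\mathcal O\}$, and put $\mathfrak N=\tfrac12\mathrm{norm}\,L$ and $\mathcal N=4(\mathrm{norm}\,L\cdot\mathrm{norm}\,L^{\#})^{-1}$, an integral ideal. Let $$\mathcal L'=\{U\in\mathbb K^{m,n}: U_{ij}\in\mathcal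 A_i\mathcal I_j \text{ for all } i,j\},$$ and for $M\in\mathbb K^{n,n}$ let $e\{M\}=\exp\big(\pi i\,\mathrm{Tr}_{\mathbb K/\mathbb Q}(\sigma(M))\big)$, where $\sigma$ is the matrix trace. **The group.** $\Gamma_0(\mathcal N;\mathcal I_1,\dots,\mathcal I_n;\mathfrak N)$ is the set of $\gamma=\begin{pmatrix}A&B\\ C&D\end{pmatrix}\in Sp_n(\mathbb K)$ with $n\times n$ blocks such that, for all $i,j$, $$A_{ij}\in\mathcal I_i^{-1}\mathcal I_j,\quad B_{ij}\in(\mathfrak N\partial\,\mathcal I_i\mathcal I_j)^{-1},\quad C_{ij}\in\mathcal N\mathfrak N\partial\,\mathcal I_i\mathcal I_j,\quad D_{ij}\in\mathcal I_i\mathcal I_j^{-1}.$$ **The character.** For a prime ideal $\mathfrak P$ choose $\eta'\in\mathfrak N^{-1}$ and $\alpha_i\in\mathcal A_i$ generating $\mathfrak N^{-1}$ and $\mathcal A_i$ locally at $\mathfrak P$. For $\mathfrak P\nmid 2$ and $y\in\mathcal O\smallsetminus\mathfrak P$ let $\left(\frac{y}{\mathfrak P}\right)$ be $1$ if $y$ is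 a square modulo $\mathfrak P$ and $-1$ otherwise. For $\mathfrak P\mid 2$ let $\left(\frac{\cdot}{\mathfrak P}\right)$ be any homomorphism from the unit group $\mathcal O_{\mathfrak P}^\times$ of the completion $\mathcal O_{\mathfrak P}$ to $\{\pm1\}$ that is $-1$ on the units of quadratic defect $4\mathcal O_{\mathfrak P}$ (the quadratic defect of $\xi\in\mathbb K_{\mathfrak P}$ is the intersection of the ideals $\alpha\mathcal O_{\mathfrak P}$ over all expressions $\xi=\eta^2+\alpha$ with $\eta,\alpha\in\mathbb K_{\mathfrak P}$). For $\mathfrak P\nmid\mathcal N$ set $$\chi_L^*(\mathfrak P)=\left(\frac{(-1)^k(\eta')^m(\alpha_1\cdots\alpha_m)^2\det Q}{\mathfrak P}\right),$$ extend $\chi_L^*$ completely multiplicatively to the fractional ideals relatively prime to $\mathcal N$, and for nonzero $y\in\mathcal O$ with $y\mathcal O$ relatively prime to $\mathcal N$ set $\chi_L(y)=\Big(\prod_{i=1}^d\mathrm{sgn}\,\psi_i(y)\Big)^k\chi_L^*(y\mathcal O)$. **Proposition.** Let $\begin{pmatrix}A&B\\ C&D\end{pmatrix}\in\Gamma_0(\mathcal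 N;\mathcal I_1,\dots,\mathcal I_n;\mathfrak N)$ with $\det D\neq0$. Then $\mathcal L'\,{}^tD$ is a sublattice of finite index in $\mathcal L'$, $\det D$ lies in $\mathcal O$ and $(\det D)\mathcal O$ is relatively prime to $\mathcal N$, and for all choices made above $$\sum_{U\in\mathcal L'/\mathcal L'\,{}^tD} e\{Q[U]BD^{-1}\}=N(\det D)^k\,\chi_L(\det D),$$ where $N=N_{\mathbb K/\mathbb Q}$ is the (signed) field norm and the sum does not depend on the choice of representatives of $\mathcal L'/\mathcal L'\,{}^tD$. -/

import Mathlib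

open scoped nonZeroDivisors NumberField

noncomputable section

namespace HilbertSiegel

open IsDedekindDomain NumberField

variable {K : Type*} [Field K] [NumberField K]

/-- The lattice `⟨I_1, …, I_a⟩ 𝒪^{a,b} ⟨J_1, …, J_b⟩`: all matrices over `K` whose `(i, j)` entry lies
in the fractional ideal `I_i J_j`. -/
def idealMatrix {a b : ℕ} (I : Fin a → FractionalIdeal (𝓞 K)⁰ K)
    (J : Fin b → FractionalIdeal (𝓞 K)⁰ K) : Submodule (𝓞 K) (Matrix (Fin a) (Fin b) K) where
  carrier := {U | ∀ i j, U i j ∈ I i * J j}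
  add_mem' hU hV i j := (I i * J j).1.add_mem (hU i j) (hV i j)
  zero_mem' i j := (I i * J j).1.zero_mem
  smul_mem' c _ hU i j := (I i * J j).1.smul_mem c (hU i j)

theorem isFractional_span {K : Type*} [Field K] {S : Set K} (d : 𝓞 K) (hd : d ≠ 0)
    (h : ∀ s ∈ S, IsLocalization.IsInteger (𝓞 K) (d • s)) :
    IsFractional (𝓞 K)⁰ (Submodule.span (𝓞 K) S) := by
  refine ⟨d, mem_nonZeroDivisors_of_ne_zero hd, fun b hb => ?_⟩
  induction hb using Submodule.span_induction with
  | mem x hx => exact h x hx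
  | zero => rw [smul_zero]; exact IsLocalization.isInteger_zero
  | add x y _ _ hx hy => rw [smul_add]; exact IsLocalization.isInteger_add hx hy
  | smul c x _ hx => rw [smul_comm]; exact IsLocalization.isInteger_smul hx

/-- A lattice `L = 𝒜_1 x_1 ⊕ ⋯ ⊕ 𝒜_m x_m` of rank `m = 2k` over the ring of integers `𝓞 K`, with a
totally positive quadratic form `𝔮(v) = B(v, v)`. A vector is given by its coordinates with respect
to `x_1, …, x_m`, and `Q = (B(x_i, x_j))`. -/
structure QuadLattice (K : Type*) [Field K] [NumberField K] (k : ℕ) where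
  A : Fin (2 * k) → FractionalIdeal (𝓞 K)⁰ K
  A_ne_zero : ∀ i, A i ≠ 0
  Q : Matrix (Fin (2 * k)) (Fin (2 * k)) K
  symm : Q.IsSymm
  totally_positive : ∀ v : Fin (2 * k) → K, v ≠ 0 → ∀ ψ : K →+* ℝ, 0 < ψ (v ⬝ᵥ Q.mulVec v)

namespace QuadLattice

variable {k : ℕ} (L : QuadLattice K k)

/-- The bilinear form `B`, in coordinates. -/
def bil (v w : Fin (2 * k) → K) : K := v ⬝ᵥ L.Q.mulVec w

/-- The lattice `L` itself, in coordinates. -/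
def lattice : Submodule (𝓞 K) (Fin (2 * k) → K) where
  carrier := {v | ∀ i, v i ∈ L.A i}
  add_mem' hv hw i := (L.A i).1.add_mem (hv i) (hw i)
  zero_mem' i := (L.A i).1.zero_mem
  smul_mem' c _ hv i := (L.A i).1.smul_mem c (hv i)

/-- The dual lattice `L^# = {v ∈ K L : B(v, L) ⊆ 𝓞 K}`. -/
def dual : Submodule (𝓞 K) (Fin (2 * k) → K) where
  carrier := {v | ∀ w ∈ L.lattice, L.bil v w ∈ (1 : FractionalIdeal (𝓞 K)⁰ K)}
  add_mem' {v v'} hv hv' w hw := by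
    have : L.bil (v + v') w = L.bil v w + L.bil v' w := add_dotProduct _ _ _
    rw [this]
    exact (1 : FractionalIdeal (𝓞 K)⁰ K).1.add_mem (hv w hw) (hv' w hw)
  zero_mem' w _ := by
    have : L.bil 0 w = 0 := zero_dotProduct _
    rw [this]
    exact (1 : FractionalIdeal (𝓞 K)⁰ K).1.zero_mem
  smul_mem' c v hv w hw := by
    have : L.bil (c • v) w = c • L.bil v w := smul_dotProduct _ _ _
    rw [this]
    exact (1 : FractionalIdeal (𝓞 K)⁰ K).1.smul_mem c (hv w hw)

/-- The values `𝔮(v) = B(v, v)` on vectors with bounded denominators have bounded denominators. -/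
theorem isFractional_values (M : Submodule (𝓞 K) (Fin (2 * k) → K)) (d : 𝓞 K) (hd : d ≠ 0)
    (h : ∀ v ∈ M, ∀ i, IsLocalization.IsInteger (𝓞 K) (d • v i)) :
    IsFractional (𝓞 K)⁰ (Submodule.span (𝓞 K) ((fun v => L.bil v v) '' (M : Set _))) := by
  obtain ⟨c, hc⟩ := IsLocalization.exist_integer_multiples (𝓞 K)⁰ Finset.univ
    (fun p : Fin (2 * k) × Fin (2 * k) => L.Q p.1 p.2)
  refine isFractional_span (d * d * c) (mul_ne_zero (mul_ne_zero hd hd)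
    (nonZeroDivisors.ne_zero c.2)) ?_
  rintro _ ⟨v, hv, rfl⟩
  have : (d * d * (c : 𝓞 K)) • L.bil v v =
      ∑ i, ∑ j, (d • v i) * (((c : 𝓞 K) • L.Q i j) * (d • v j)) := by
    simp only [bil, dotProduct, Matrix.mulVec, Finset.mul_sum, Algebra.smul_def,
      map_mul]
    refine Finset.sum_congr rfl fun i _ => Finset.sum_congr rfl fun j _ => by ring
  rw [this]
  exact Subsemiring.sum_mem (algebraMap (𝓞 K) K).rangeS fun i _ => Subsemiring.sum_mem _ fun j _ =>
    IsLocalization.isInteger_mul (h v hv i)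
      (IsLocalization.isInteger_mul (hc (i, j) (Finset.mem_univ _)) (h v hv j))

theorem det_ne_zero [IsTotallyReal K] : L.Q.det ≠ 0 := by
  intro h
  obtain ⟨v, hv, h0⟩ := Matrix.exists_mulVec_eq_zero_iff.mpr h
  obtain ⟨w⟩ := (inferInstance : Nonempty (InfinitePlace K))
  have := L.totally_positive v hv (w.embedding_of_isReal (IsTotallyReal.isReal w))
  rw [h0, dotProduct_zero, map_zero] at this
  exact lt_irrefl _ this

theorem exists_denom_lattice :
    ∃ d : 𝓞 K, d ≠ 0 ∧ ∀ v ∈ L.lattice, ∀ i, IsLocalization.IsInteger (𝓞 K) (d • v i) := by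
  choose a ha h using fun i => (L.A i).2
  refine ⟨∏ i, a i, Finset.prod_ne_zero_iff.mpr fun i _ => nonZeroDivisors.ne_zero (ha i),
    fun v hv i => ?_⟩
  rw [← Finset.prod_erase_mul _ _ (Finset.mem_univ i), mul_smul]
  exact IsLocalization.isInteger_smul (h i _ (hv i))

theorem exists_denom_dual [IsTotallyReal K] :
    ∃ d : 𝓞 K, d ≠ 0 ∧ ∀ v ∈ L.dual, ∀ i, IsLocalization.IsInteger (𝓞 K) (d • v i) := by
  have hA : ∀ i, ∃ x ∈ L.A i, x ≠ 0 := fun i => by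
    by_contra! hcon
    exact L.A_ne_zero i (FractionalIdeal.eq_zero_iff.mpr hcon)
  choose a ha ha0 using hA
  obtain ⟨c, hc⟩ := IsLocalization.exist_integer_multiples (𝓞 K)⁰ Finset.univ
    (fun p : Fin (2 * k) × Fin (2 * k) => (a p.1)⁻¹ * L.Q⁻¹ p.1 p.2)
  refine ⟨c, nonZeroDivisors.ne_zero c.2, fun v hv j => ?_⟩
  have h1 : ∀ i, IsLocalization.IsInteger (𝓞 K) (Matrix.vecMul v L.Q i * a i) := fun i => by
    have hw : Pi.single i (a i) ∈ L.lattice := fun l => by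
      by_cases hl : l = i
      · subst hl; simpa using ha l
      · rw [Pi.single_eq_of_ne hl]; exact (L.A l).1.zero_mem
    have := hv _ hw
    rw [bil, Matrix.dotProduct_mulVec, dotProduct_single] at this
    obtain ⟨y, hy⟩ := (FractionalIdeal.mem_one_iff _).mp this
    exact ⟨y, hy⟩
  have h2 : v = Matrix.vecMul (Matrix.vecMul v L.Q) L.Q⁻¹ := by
    rw [Matrix.vecMul_vecMul, Matrix.mul_nonsing_inv _ (isUnit_iff_ne_zero.mpr L.det_ne_zero),
      Matrix.vecMul_one]
  have h3 : (c : 𝓞 K) • v j =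
      ∑ i, (Matrix.vecMul v L.Q i * a i) * ((c : 𝓞 K) • ((a i)⁻¹ * L.Q⁻¹ i j)) := by
    conv_lhs => rw [h2]
    rw [Matrix.vecMul, dotProduct, Finset.smul_sum]
    refine Finset.sum_congr rfl fun i _ => ?_
    rw [Algebra.smul_def, Algebra.smul_def]
    field_simp [ha0 i]
  rw [h3]
  exact Subsemiring.sum_mem (algebraMap (𝓞 K) K).rangeS fun i _ =>
    IsLocalization.isInteger_mul (h1 i) (hc (i, j) (Finset.mem_univ _))

/-- `norm L`, the fractional ideal generated by `{𝔮(v) : v ∈ L}`. -/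
def norm : FractionalIdeal (𝓞 K)⁰ K :=
  ⟨Submodule.span (𝓞 K) ((fun v => L.bil v v) '' (L.lattice : Set _)), by
    obtain ⟨d, hd, h⟩ := L.exists_denom_lattice
    exact L.isFractional_values _ d hd h⟩

/-- `norm L^#`, the fractional ideal generated by `{𝔮(v) : v ∈ L^#}`. -/
def normDual [IsTotallyReal K] : FractionalIdeal (𝓞 K)⁰ K :=
  ⟨Submodule.span (𝓞 K) ((fun v => L.bil v v) '' (L.dual : Set _)), by
    obtain ⟨d, hd, h⟩ := L.exists_denom_dual
    exact L.isFractional_values _ d hd h⟩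

/-- `𝔑 = ½ norm L`. -/
def halfNorm : FractionalIdeal (𝓞 K)⁰ K :=
  FractionalIdeal.spanSingleton (𝓞 K)⁰ (2⁻¹ : K) * L.norm

/-- The level `𝒩 = 4 (norm L · norm L^#)⁻¹` (an integral ideal). -/
def level [IsTotallyReal K] : FractionalIdeal (𝓞 K)⁰ K :=
  FractionalIdeal.spanSingleton (𝓞 K)⁰ (4 : K) * (L.norm * L.normDual)⁻¹

/-- The lattice `ℒ' = ⟨𝒜_1, …, 𝒜_m⟩ 𝒪^{m,n} ⟨ℐ_1, …, ℐ_n⟩`. -/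
def latticeMatrix {n : ℕ} (I : Fin n → FractionalIdeal (𝓞 K)⁰ K) :
    Submodule (𝓞 K) (Matrix (Fin (2 * k)) (Fin n) K) :=
  idealMatrix L.A I

/-- The sublattice `ℒ' ᵗD`. -/
def latticeMatrixMul {n : ℕ} (I : Fin n → FractionalIdeal (𝓞 K)⁰ K)
    (D : Matrix (Fin n) (Fin n) K) : Submodule (𝓞 K) (Matrix (Fin (2 * k)) (Fin n) K) :=
  (L.latticeMatrix I).map (mulRightLinearMap (Fin (2 * k)) (𝓞 K) D.transpose)

/-- `Γ₀(𝒩; ℐ_1, …, ℐ_n; 𝔑)`: the matrices in `Sp_n(K)` whose blocks satisfy, with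
`X = ⟨ℐ_1, …, ℐ_n⟩` and `∂` the different of `K`,
`A ∈ (𝔑∂X)⁻¹ 𝒪^{n,n} 𝔑∂X`, `B ∈ (𝔑∂X)⁻¹ 𝒪^{n,n} X⁻¹`,
`C ∈ X 𝒩 𝒪^{n,n} 𝔑∂X`, `D ∈ X 𝒪^{n,n} X⁻¹`. -/
def Gamma0 [IsTotallyReal K] {n : ℕ} (I : Fin n → FractionalIdeal (𝓞 K)⁰ K) :
    Set (Matrix (Fin n ⊕ Fin n) (Fin n ⊕ Fin n) K) :=
  let δ : FractionalIdeal (𝓞 K)⁰ K := L.halfNorm * (differentIdeal ℤ (𝓞 K) : Ideal (𝓞 K))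
  {γ | γ ∈ Matrix.symplecticGroup (Fin n) K ∧
    γ.toBlocks₁₁ ∈ idealMatrix (fun i => (δ * I i)⁻¹) (fun j => δ * I j) ∧
    γ.toBlocks₁₂ ∈ idealMatrix (fun i => (δ * I i)⁻¹) (fun j => (I j)⁻¹) ∧
    γ.toBlocks₂₁ ∈ idealMatrix (fun i => I i * L.level) (fun j => δ * I j) ∧
    γ.toBlocks₂₂ ∈ idealMatrix I (fun j => (I j)⁻¹)}

end QuadLattice

/-- `a ∈ I` and `a 𝒪_𝔓 = I 𝒪_𝔓`, for a nonzero fractional ideal `I`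
(in terms of orders: `a ∈ I` and `a ∉ 𝔓 I`). -/
def IsLocalGenerator (v : HeightOneSpectrum (𝓞 K)) (I : FractionalIdeal (𝓞 K)⁰ K) (a : K) : Prop :=
  a ∈ I ∧ a ∉ (v.asIdeal : FractionalIdeal (𝓞 K)⁰ K) * I

/-- The quadratic defect of `ξ` in the completion `K_𝔓`: the intersection of the ideals `α 𝒪_𝔓` over
all expressions `ξ = η² + α`. -/
def quadraticDefect (v : HeightOneSpectrum (𝓞 K)) (ξ : v.adicCompletion K) :
    Submodule (v.adicCompletionIntegers K) (v.adicCompletion K) :=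
  ⨅ η : v.adicCompletion K, Submodule.span (v.adicCompletionIntegers K) {ξ - η ^ 2}

/-- A choice of Kronecker-type symbol at a prime `𝔓 ∣ 2`: a homomorphism `φ` from `𝒰 = 𝒪_𝔓^×` to
`{±1}` (so `φ` factors through `𝒰 / 𝒰²`) with `φ = -1` on the units of quadratic defect `4 𝒪_𝔓`
(these units form one single coset of `𝒰²`). -/
structure KroneckerSymbol (v : HeightOneSpectrum (𝓞 K)) where
  toHom : (v.adicCompletionIntegers K)ˣ →* ℤˣ
  map_defect : ∀ u : (v.adicCompletionIntegers K)ˣ,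
    quadraticDefect v ((u : v.adicCompletionIntegers K) : v.adicCompletion K) =
      Submodule.span (v.adicCompletionIntegers K) {(4 : v.adicCompletion K)} → toHom u = -1

/-- The choices that enter the definition of the character of `L`: for every prime `𝔓`, elements
`η' ∈ 𝔑⁻¹` with `η' 𝒪_𝔓 = 𝔑⁻¹ 𝒪_𝔓` and `α_i ∈ 𝒜_i` with `α_i 𝒪_𝔓 = 𝒜_i 𝒪_𝔓`, and for every
`𝔓 ∣ 2` a Kronecker-type symbol. -/
structure CharacterChoice {k : ℕ} (L : QuadLattice K k) where
  eta : HeightOneSpectrum (𝓞 K) → K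
  eta_spec : ∀ v, IsLocalGenerator v L.halfNorm⁻¹ (eta v)
  alpha : HeightOneSpectrum (𝓞 K) → Fin (2 * k) → K
  alpha_spec : ∀ v i, IsLocalGenerator v (L.A i) (alpha v i)
  phi : ∀ v : HeightOneSpectrum (𝓞 K), (2 : 𝓞 K) ∈ v.asIdeal → KroneckerSymbol v

namespace CharacterChoice

variable {k : ℕ} {L : QuadLattice K k} (c : CharacterChoice L)

open Classical in
/-- The symbol `(y / 𝔓)`: for `𝔓 ∤ 2` and `y ∈ 𝒪 ∖ 𝔓` it is `1` if `y` is a square modulo `𝔓` and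
`-1` otherwise; for `𝔓 ∣ 2` and `y ∈ 𝒪_𝔓^×` it is `φ(y)`. -/
def symbol (v : HeightOneSpectrum (𝓞 K)) (y : K) : ℤˣ :=
  if h : (2 : 𝓞 K) ∈ v.asIdeal then
    if ∃ u : (v.adicCompletionIntegers K)ˣ,
      ((u : v.adicCompletionIntegers K) : v.adicCompletion K) =
        algebraMap K (v.adicCompletion K) y ∧
        (c.phi v h).toHom u = 1
    then 1 else -1
  else
    if ∃ z : 𝓞 K, y - (z : K) ^ 2 ∈ (v.asIdeal : FractionalIdeal (𝓞 K)⁰ K) then 1 else -1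

/-- `χ*(𝔓) = ((-1)^k (η')^m (α_1 ⋯ α_m)² det Q / 𝔓)`, for a prime `𝔓 ∤ 𝒩`. -/
def chiStarPrime (v : HeightOneSpectrum (𝓞 K)) : ℤˣ :=
  c.symbol v ((-1) ^ k * c.eta v ^ (2 * k) * (∏ i, c.alpha v i) ^ 2 * L.Q.det)

/-- The completely multiplicative extension of `χ*` to the fractional ideals prime to `𝒩`:
`χ*(J) = ∏_𝔓 χ*(𝔓)^{ord_𝔓 J}`. -/
def chiStar (J : FractionalIdeal (𝓞 K)⁰ K) : ℤˣ :=
  ∏ᶠ v : HeightOneSpectrum (𝓞 K), c.chiStarPrime v ^ FractionalIdeal.count K v J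

/-- `χ_L(y) = (N(sgn y))^k χ*(y𝒪)` where `N(sgn y) = ∏_ψ sgn ψ(y)` over the real embeddings `ψ`. -/
def chi (y : K) : ℤ :=
  (∏ ψ : K →+* ℝ, (SignType.sign (ψ y) : ℤ)) ^ k *
    (c.chiStar (FractionalIdeal.spanSingleton (𝓞 K)⁰ y) : ℤ)

end CharacterChoice

/-- `e{M} = exp(π i σ(Tr M))` for `M ∈ K^{n,n}`, with `σ` the matrix trace and `Tr` the trace from
`K` to `ℚ`. -/
def expTrace {n : ℕ} (M : Matrix (Fin n) (Fin n) K) : ℂ :=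
  Complex.exp (Real.pi * Complex.I * (Algebra.trace ℚ K M.trace : ℚ))

/-- `S` is a finite complete system of representatives for the quotient `M / M'`. -/
def IsRepresentativeSystem {V : Type*} [AddCommGroup V] [Module (𝓞 K) V]
    (M M' : Submodule (𝓞 K) V) (S : Finset V) : Prop :=
  (∀ U ∈ S, U ∈ M) ∧ ∀ U ∈ M, ∃! V ∈ S, U - V ∈ M'

end HilbertSiegel

end

/-!
The sum is a Gauss sum over a finite module. Let `S = B D⁻¹`, a symmetric matrix, and write the
Gram matrix as `Q = τ + ᵗτ` with `τ` upper triangular (`halfGram`), so that the exponent of the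
term at `U` is `2πi Tr (∑ τ_ij u_i S ᵗu_j)` with `u_i` the rows of `U`. Row by row, the classes of
`U` modulo `ℒ' ᵗD` are elements of the cokernel `Y` of `D`, and `S`, multiplied by an element of
`𝔑`, gives a symmetric form on `Y` with values in `K / 𝔡⁻¹`, where `𝔡` is the different
(`cokernelForm`). This form is perfect (`isPerfectForm_cokernelForm`): the relation
`D⁻¹ = ᵗA - ᵗC S` turns the integrality of `S u` into that of `D⁻¹ u`. The sum becomes
`∑ e(∑ T_ij B(y_i, y_j))` over families in `Y`, where `T` is an integral matrix and `T + ᵗT` is a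
local Gram matrix of `L`, scaled by a generator of `𝔑⁻¹`, at all primes dividing `det D`. These
primes do not divide the level, because `ᵗA D ≡ 1` modulo the level, and at such primes `T + ᵗT` is
unimodular.

To avoid completions of modules, the fractional ideals are not localized. Instead each of them and
its inverse are given elements whose product is `1` modulo a high power of `det D`
(`ApproxGenerator`); these serve as generators at all relevant primes at once.

The sum over a finite module `Y` with a perfect form is computed for all residue characteristics in
the same way. `Y` is the orthogonal sum of its primary parts (`quadSum_dedekind`); over a local ring
a form of unit determinant splits into binary forms (`quadSum_local`), for which totally isotropic
submodules can be divided out until `Y` is a vector space over the residue field (`planeSum_local`).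
There a hyperbolic plane gives `|Y|`, and an anisotropic plane gives `(-1)^f |Y|` if `|Y| = q^f`: its
sum `G` satisfies `G² = |Y|²` and is the same for all nonzero multiples of the form, and counting
isotropic vectors determines the sign modulo `q + 1` (`planeSum_of_anisotropic`). So the `𝔭`-part
contributes `ε^f |Y_𝔭|^k`, where `f` is the exponent of `𝔭` in `det D`, by the elementary divisor
theorem (`card_torsionBySet_of_presentation`), and `ε` is the product of the signs of the binary
blocks.

It remains to see that `ε` is the symbol of `(-1)^k det (T + ᵗT)`. The symbol is multiplicative, so
this comes down to binary forms, where it has to tell whether a form of unit discriminant is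
isotropic modulo `𝔭` (`isDiscriminantSign_symbol`). At odd primes this is the completion of the
square; at primes above `2` the discriminant is a square times `1 - 4s`, Hensel's lemma makes it a
square if `t² + t + s` has a root modulo `𝔭`, and otherwise its quadratic defect is `4 𝒪_𝔭`. Finally
`∏ |Y_𝔭| = |N (det D)|`, and the signs of the conjugates of `det D` account for the sign of the norm
(`norm_pow_mul_sign_norm_pow`).
-/

noncomputable section

/-! ### Quadratic sums attached to finite bilinear forms -/

namespace HilbertSiegel

section FiniteForms

variable {R Y W : Type*} [CommRing R] [AddCommGroup Y] [Module R Y] [AddCommGroup W] [Module R W]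

/-- A symmetric bilinear form `B` on `Y` with values in `W` that is nondegenerate, together with an
additive character `e` of `W` whose kernel contains no nonzero submodule. On a finite module `Y`,
`e (B x y)` then identifies `Y` with its character group. -/
structure IsPerfectForm (e : AddChar W ℂ) (B : Y →ₗ[R] Y →ₗ[R] W) : Prop where
  primitive : ∀ w, (∀ r : R, e (r • w) = 1) → w = 0
  symm : ∀ x y, B x y = B y x
  nondegenerate : ∀ x, (∀ y, B x y = 0) → x = 0

namespace IsPerfectForm

variable {e : AddChar W ℂ} {B : Y →ₗ[R] Y →ₗ[R] W}

/-- Orthogonality of characters. -/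
theorem sum_char_eq_zero {M : Type*} [AddCommGroup M] [Module R M] [Fintype M]
    (h : IsPerfectForm e B) {φ : M →ₗ[R] W} (hφ : φ ≠ 0) : ∑ x, e (φ x) = 0 := by
  have : e.compAddMonoidHom φ.toAddMonoidHom ≠ 1 := by
    intro h1
    apply hφ
    ext x
    refine h.primitive _ fun r => ?_
    have := DFunLike.congr_fun h1 (r • x)
    simpa using this
  simpa using AddChar.sum_eq_zero_of_ne_one this

theorem sum_char {M : Type*} [AddCommGroup M] [Module R M] [Fintype M]
    (h : IsPerfectForm e B) (φ : M →ₗ[R] W) [Decidable (φ = 0)] :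
    ∑ x, e (φ x) = if φ = 0 then (Nat.card M : ℂ) else 0 := by
  split_ifs with h0
  · simp [h0, Nat.card_eq_fintype_card]
  · exact h.sum_char_eq_zero h0

/-- The orthogonal complement of a submodule. -/
def orth (B : Y →ₗ[R] Y →ₗ[R] W) (I : Submodule R Y) : Submodule R Y where
  carrier := {y | ∀ x ∈ I, B y x = 0}
  add_mem' ha hb x hx := by rw [map_add, LinearMap.add_apply, ha x hx, hb x hx, add_zero]
  zero_mem' x _ := by simp
  smul_mem' c y hy x hx := by rw [map_smul, LinearMap.smul_apply, hy x hx, smul_zero]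

theorem mem_orth {I : Submodule R Y} {y : Y} : y ∈ orth B I ↔ ∀ x ∈ I, B y x = 0 := Iff.rfl

theorem card_mul_card_orth [Finite Y] (h : IsPerfectForm e B) (I : Submodule R Y) :
    Nat.card I * Nat.card (orth B I) = Nat.card Y := by
  classical
  have := Fintype.ofFinite Y
  have h1 : ∀ y : Y, ∑ x : I, e (B y x) = if y ∈ orth B I then (Nat.card I : ℂ) else 0 := by
    intro y
    have := h.sum_char ((B y).comp I.subtype)
    rw [show (∑ x : I, e (B y x)) = ∑ x, e ((B y ∘ₗ I.subtype) x) from rfl, this]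
    refine if_congr ?_ rfl rfl
    simp [LinearMap.ext_iff, mem_orth]
  have h2 : ∀ x : I, ∑ y : Y, e (B y x) = if x = 0 then (Nat.card Y : ℂ) else 0 := by
    intro x
    have := h.sum_char (B x)
    rw [show (∑ y : Y, e (B y x)) = ∑ y : Y, e (B x y) from
      Finset.sum_congr rfl fun y _ => by rw [h.symm], this]
    refine if_congr ?_ rfl rfl
    constructor
    · intro hx
      exact Subtype.ext (h.nondegenerate _ fun y => by rw [hx]; rfl)
    · rintro rfl; simp
  have h3 : ∑ y : Y, ∑ x : I, e (B y x) = ∑ x : I, ∑ y : Y, e (B y x) := Finset.sum_comm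
  simp_rw [h1, h2] at h3
  rw [Finset.sum_ite_eq' Finset.univ (0 : I), if_pos (Finset.mem_univ _), ← Finset.sum_filter,
    Finset.sum_const, nsmul_eq_mul] at h3
  have h4 : (Finset.univ.filter fun y => y ∈ orth B I).card = Nat.card (orth B I) := by
    rw [Nat.card_eq_fintype_card, Fintype.card_subtype]
  rw [h4] at h3
  rw [mul_comm]
  exact_mod_cast h3

theorem orth_orth [Finite Y] (h : IsPerfectForm e B) (I : Submodule R Y) :
    orth B (orth B I) = I := by
  have hle : I ≤ orth B (orth B I) := fun x hx y hy => by rw [h.symm]; exact hy x hx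
  have h1 := h.card_mul_card_orth I
  have h2 := h.card_mul_card_orth (orth B I)
  have hpos : 0 < Nat.card (orth B I) := Nat.card_pos
  have h3 : Nat.card I = Nat.card (orth B (orth B I)) := by
    apply Nat.eq_of_mul_eq_mul_left hpos
    rw [h2, mul_comm, h1]
  exact (SetLike.coe_injective (Set.eq_of_subset_of_ncard_le hle (by
    rw [← Nat.card_coe_set_eq, ← Nat.card_coe_set_eq]; exact h3.ge) (Set.toFinite _))).symm

end IsPerfectForm

/-- The exponential sum `∑ e(a B(x,x) + b B(x,y) + c B(y,y))` over all pairs `(x, y)`. -/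
def planeSum (e : AddChar W ℂ) (B : Y →ₗ[R] Y →ₗ[R] W) [Fintype Y] (a b c : R) : ℂ :=
  ∑ p : Y × Y, e (a • B p.1 p.1 + b • B p.1 p.2 + c • B p.2 p.2)

/-- The exponential sum `∑ e(∑ T_ij B(y_i, y_j))` over all families `y`. -/
def quadSum {ι : Type*} [Fintype ι] [DecidableEq ι] (e : AddChar W ℂ) (B : Y →ₗ[R] Y →ₗ[R] W)
    [Fintype Y] (T : Matrix ι ι R) : ℂ :=
  ∑ y : ι → Y, e (∑ i, ∑ j, T i j • B (y i) (y j))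

/-- Invertible linear substitution in a plane. -/
theorem planeSum_subst [Fintype Y] {e : AddChar W ℂ} {B : Y →ₗ[R] Y →ₗ[R] W}
    (h : IsPerfectForm e B) (a b c x y z w : R) (hdet : IsUnit (x * w - y * z)) :
    planeSum e B a b c = planeSum e B (a * x ^ 2 + b * x * y + c * y ^ 2)
      (2 * a * x * z + b * (x * w + y * z) + 2 * c * y * w) (a * z ^ 2 + b * z * w + c * w ^ 2) := by
  obtain ⟨d, hd⟩ := hdet.exists_right_inv
  let σ : Y × Y ≃ Y × Y :=
    { toFun := fun p => (x • p.1 + z • p.2, y • p.1 + w • p.2)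
      invFun := fun p => (d • (w • p.1 - z • p.2), d • (-y • p.1 + x • p.2))
      left_inv := fun p => by
        ext
        · calc _ = ((x * w - y * z) * d) • p.1 := by simp only; module
            _ = _ := by rw [hd, one_smul]
        · calc _ = ((x * w - y * z) * d) • p.2 := by simp only; module
            _ = _ := by rw [hd, one_smul]
      right_inv := fun p => by
        ext
        · calc _ = ((x * w - y * z) * d) • p.1 := by simp only; module
            _ = _ := by rw [hd, one_smul]
        · calc _ = ((x * w - y * z) * d) • p.2 := by simp only; module
            _ = _ := by rw [hd, one_smul] }
  unfold planeSum
  rw [← Equiv.sum_comp σ]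
  refine Finset.sum_congr rfl fun p _ => congrArg e ?_
  simp only [σ, Equiv.coe_fn_mk, map_add, map_smul, LinearMap.add_apply, LinearMap.smul_apply]
  rw [h.symm p.2 p.1]
  module

/-- A binary form of unit discriminant has a nondegenerate polar form. -/
theorem smul_add_smul_mem_iff {a b c : R} (hd : IsUnit (b ^ 2 - 4 * a * c)) {N : Submodule R Y}
    {x y : Y} : ((2 * a) • x + b • y ∈ N ∧ b • x + (2 * c) • y ∈ N) ↔ x ∈ N ∧ y ∈ N := by
  obtain ⟨d, hd⟩ := hd.exists_right_inv
  constructor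
  · rintro ⟨h1, h2⟩
    have hx : x = d • (b • (b • x + (2 * c) • y) - (2 * c) • ((2 * a) • x + b • y)) := by
      calc x = ((b ^ 2 - 4 * a * c) * d) • x := by rw [hd, one_smul]
        _ = _ := by module
    have hy : y = d • (b • ((2 * a) • x + b • y) - (2 * a) • (b • x + (2 * c) • y)) := by
      calc y = ((b ^ 2 - 4 * a * c) * d) • y := by rw [hd, one_smul]
        _ = _ := by module
    exact ⟨hx ▸ N.smul_mem _ (N.sub_mem (N.smul_mem _ h2) (N.smul_mem _ h1)),
      hy ▸ N.smul_mem _ (N.sub_mem (N.smul_mem _ h1) (N.smul_mem _ h2))⟩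
  · rintro ⟨h1, h2⟩
    exact ⟨N.add_mem (N.smul_mem _ h1) (N.smul_mem _ h2),
      N.add_mem (N.smul_mem _ h1) (N.smul_mem _ h2)⟩

/-- If the first coefficient vanishes, the exponent is linear in the first variable, and the summation
over it leaves only the terms with second variable `0`. -/
theorem planeSum_of_left_eq_zero [Fintype Y] {e : AddChar W ℂ} {B : Y →ₗ[R] Y →ₗ[R] W}
    (h : IsPerfectForm e B) {b : R} (hb : IsUnit b) (c : R) :
    planeSum e B 0 b c = Nat.card Y := by
  classical
  unfold planeSum
  rw [Fintype.sum_prod_type_right]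
  have : ∀ y : Y, ∑ x : Y, e ((0 : R) • B x x + b • B x y + c • B y y) =
      if y = 0 then (Nat.card Y : ℂ) else 0 := by
    intro y
    have h1 := h.sum_char (b • B y)
    have h2 : b • B y = 0 ↔ y = 0 := by
      refine ⟨fun h0 => h.nondegenerate _ fun x => ?_, by rintro rfl; simp⟩
      have := LinearMap.congr_fun h0 x
      exact (hb.smul_eq_zero).mp this
    rw [if_congr h2 rfl rfl] at h1
    simp_rw [zero_smul, zero_add, AddChar.map_add_eq_mul, ← Finset.sum_mul]
    simp_rw [fun x => h.symm x y]
    rw [show ∑ x, e (b • B y x) = ∑ x, e ((b • B y) x) from rfl, h1]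
    split_ifs with hy
    · simp [hy]
    · simp
  simp_rw [this]
  simp

/-- The absolute value of the sum over a plane, in a form that avoids complex conjugation. -/
theorem planeSum_mul_planeSum_neg [Fintype Y] {e : AddChar W ℂ} {B : Y →ₗ[R] Y →ₗ[R] W}
    (h : IsPerfectForm e B) {a b c : R} (hd : IsUnit (b ^ 2 - 4 * a * c)) :
    planeSum e B a b c * planeSum e B (-a) (-b) (-c) = (Nat.card Y : ℂ) ^ 2 := by
  classical
  unfold planeSum
  rw [Finset.sum_mul_sum, Finset.sum_comm]
  -- In the product of the sums over `r'` and `p`, put `r' = r + p`; the exponent is then linear in `p`.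
  have key : ∀ p : Y × Y, ∑ r : Y × Y, e (a • B r.1 r.1 + b • B r.1 r.2 + c • B r.2 r.2) *
      e (-a • B p.1 p.1 + -b • B p.1 p.2 + -c • B p.2 p.2) =
      ∑ r : Y × Y, e (a • B r.1 r.1 + b • B r.1 r.2 + c • B r.2 r.2) *
        (e (B ((2 * a) • r.1 + b • r.2) p.1) * e (B (b • r.1 + (2 * c) • r.2) p.2)) := by
    intro p
    rw [← Equiv.sum_comp (Equiv.addRight p)]
    refine Finset.sum_congr rfl fun r _ => ?_
    simp only [← AddChar.map_add_eq_mul]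
    congr 1
    simp only [Equiv.coe_addRight, Prod.fst_add, Prod.snd_add, map_add, map_smul,
      LinearMap.add_apply, LinearMap.smul_apply]
    rw [h.symm p.1 r.1, h.symm p.2 r.2, h.symm p.1 r.2]
    module
  rw [Finset.sum_congr rfl fun p _ => key p, Finset.sum_comm]
  have key2 : ∀ r : Y × Y, ∑ p : Y × Y, e (a • B r.1 r.1 + b • B r.1 r.2 + c • B r.2 r.2) *
        (e (B ((2 * a) • r.1 + b • r.2) p.1) * e (B (b • r.1 + (2 * c) • r.2) p.2)) =
      if r = 0 then (Nat.card Y : ℂ) ^ 2 else 0 := by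
    intro r
    rw [← Finset.mul_sum, Fintype.sum_prod_type]
    simp_rw [← Finset.mul_sum, ← Finset.sum_mul]
    rw [h.sum_char, h.sum_char]
    have hB : ∀ y, B y = 0 ↔ y = 0 := fun y =>
      ⟨fun h0 => h.nondegenerate y fun x => by rw [h0]; rfl, fun h0 => by simp [h0]⟩
    simp only [hB]
    have := smul_add_smul_mem_iff hd (N := (⊥ : Submodule R Y)) (x := r.1) (y := r.2)
    simp only [Submodule.mem_bot] at this
    by_cases hr : r = 0
    · simp [hr, sq]
    · rw [if_neg hr]
      have h' : ¬ ((2 * a) • r.1 + b • r.2 = 0 ∧ b • r.1 + (2 * c) • r.2 = 0) := fun h0 =>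
        hr (Prod.ext (this.mp h0).1 (this.mp h0).2)
      rcases not_and_or.mp h' with h0 | h0 <;> simp [h0]
  rw [Finset.sum_congr rfl fun r _ => key2 r]
  simp

end FiniteForms

section FiniteField

/-- A nondegenerate binary quadratic form over a finite field represents every element. -/
theorem exists_norm_form_eq {k : Type*} [Field k] [Finite k] {b d : k} (hd : b ^ 2 - 4 * d ≠ 0)
    (t : k) : ∃ u v : k, u ^ 2 + b * u * v + d * v ^ 2 = t := by
  have := Fintype.ofFinite k
  by_cases h2 : ringChar k = 2
  · have : CharP k 2 := ringChar.of_eq h2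
    obtain ⟨u, hu⟩ := (frobeniusEquiv k 2).surjective t
    exact ⟨u, 0, by rw [← hu]; simp [frobeniusEquiv_apply, frobenius_def]⟩
  · have h2' : (2 : k) ≠ 0 := Ring.two_ne_zero h2
    have hodd : Fintype.card k % 2 = 1 := FiniteField.odd_card_of_char_ne_two h2
    have h4 : d - b ^ 2 / 4 ≠ 0 := fun h0 => hd (by
      have h4 : (4 : k) ≠ 0 := by rw [show (4 : k) = 2 * 2 by norm_num]; exact mul_ne_zero h2' h2'
      field_simp at h0
      linear_combination -h0)
    obtain ⟨x, y, hxy⟩ := FiniteField.exists_root_sum_quadratic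
      (f := Polynomial.C 1 * Polynomial.X ^ 2 + Polynomial.C 0 * Polynomial.X + Polynomial.C (-t))
      (g := Polynomial.C (d - b ^ 2 / 4) * Polynomial.X ^ 2 + Polynomial.C 0 * Polynomial.X +
        Polynomial.C 0)
      (Polynomial.degree_quadratic one_ne_zero) (Polynomial.degree_quadratic h4) hodd
    refine ⟨x - b / 2 * y, y, ?_⟩
    simp only [Polynomial.eval_add, Polynomial.eval_mul, Polynomial.eval_C, Polynomial.eval_pow,
      Polynomial.eval_X] at hxy
    have : (4 : k) = 2 * 2 := by norm_num
    rw [this] at hxy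
    field_simp at hxy ⊢
    linear_combination hxy

variable {k Y W : Type*} [Field k] [AddCommGroup Y] [Module k Y] [AddCommGroup W] [Module k W]
  {e : AddChar W ℂ} {B : Y →ₗ[k] Y →ₗ[k] W}

/-- An isotropic vector, completed to a basis, makes the first coefficient vanish. -/
theorem planeSum_of_isotropic [Fintype Y] (h : IsPerfectForm e B) {a b c : k}
    (hd : b ^ 2 - 4 * a * c ≠ 0) {x y : k} (hxy : x ≠ 0 ∨ y ≠ 0)
    (h0 : a * x ^ 2 + b * x * y + c * y ^ 2 = 0) : planeSum e B a b c = Nat.card Y := by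
  obtain ⟨z, w, hzw⟩ : ∃ z w, x * w - y * z = 1 := by
    rcases hxy with hx | hy
    · exact ⟨0, x⁻¹, by field_simp; simp⟩
    · exact ⟨-y⁻¹, 0, by field_simp; simp⟩
  rw [planeSum_subst h a b c x y z w (by rw [hzw]; exact isUnit_one), h0]
  refine planeSum_of_left_eq_zero h (isUnit_iff_ne_zero.mpr fun hb => hd ?_) _
  calc b ^ 2 - 4 * a * c = (b ^ 2 - 4 * a * c) * (x * w - y * z) ^ 2 := by rw [hzw]; ring
    _ = (2 * a * x * z + b * (x * w + y * z) + 2 * c * y * w) ^ 2 -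
        4 * (a * x ^ 2 + b * x * y + c * y ^ 2) * (a * z ^ 2 + b * z * w + c * w ^ 2) := by ring
    _ = 0 := by rw [hb, h0]; ring

/-- The sum does not change if the form is multiplied by a nonzero scalar `t`: as `t` is a norm from
the quadratic algebra of the form, the multiple arises from the form by a linear substitution. -/
theorem planeSum_smul [Finite k] [Fintype Y] (h : IsPerfectForm e B) {a b c : k}
    (hd : b ^ 2 - 4 * a * c ≠ 0) {t : k} (ht : t ≠ 0) :
    planeSum e B (t * a) (t * b) (t * c) = planeSum e B a b c := by
  obtain ⟨u, v, huv⟩ := exists_norm_form_eq (b := b) (d := a * c) (by rwa [← mul_assoc]) t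
  have hdet : u * (u + b * v) - a * v * (-(c * v)) = t := by rw [← huv]; ring
  rw [planeSum_subst h a b c u (a * v) (-(c * v)) (u + b * v)
    (by rw [hdet]; exact isUnit_iff_ne_zero.mpr ht)]
  congr 1 <;> rw [← huv] <;> ring

/-- The multiplication of `Y × Y` by elements of the quadratic algebra `k[ω]`, where
`ω² = b ω - a c`. If the form `a x² + b x y + c y²` is anisotropic then `k[ω]` is a field, and its
multiplicative group permutes the nonzero isotropic vectors freely. -/
def quadraticAct {a b c : k} (z : QuadraticAlgebra k (-(a * c)) b) (p : Y × Y) : Y × Y :=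
  (z.re • p.1 - (c * z.im) • p.2, (a * z.im) • p.1 + (z.re + b * z.im) • p.2)

theorem quadraticAct_mul {a b c : k} (z w : QuadraticAlgebra k (-(a * c)) b) (p : Y × Y) :
    quadraticAct (z * w) p = quadraticAct z (quadraticAct w p) := by
  simp only [quadraticAct, QuadraticAlgebra.re_mul, QuadraticAlgebra.im_mul]
  ext <;> simp only <;> module

theorem quadraticAct_one {a b c : k} (p : Y × Y) :
    quadraticAct (1 : QuadraticAlgebra k (-(a * c)) b) p = p := by
  simp [quadraticAct, QuadraticAlgebra.re_one, QuadraticAlgebra.im_one]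

theorem quadraticAct_sub {a b c : k} (z w : QuadraticAlgebra k (-(a * c)) b) (p : Y × Y) :
    quadraticAct (z - w) p = quadraticAct z p - quadraticAct w p := by
  simp only [quadraticAct, QuadraticAlgebra.re_sub, QuadraticAlgebra.im_sub]
  ext <;> simp only [Prod.fst_sub, Prod.snd_sub] <;> module

theorem quadraticAct_form (h : IsPerfectForm e B) {a b c : k}
    (z : QuadraticAlgebra k (-(a * c)) b) (p : Y × Y) :
    a • B (quadraticAct z p).1 (quadraticAct z p).1 +
      b • B (quadraticAct z p).1 (quadraticAct z p).2 +
      c • B (quadraticAct z p).2 (quadraticAct z p).2 =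
    z.norm • (a • B p.1 p.1 + b • B p.1 p.2 + c • B p.2 p.2) := by
  simp only [quadraticAct, map_add, map_sub, map_smul, LinearMap.add_apply, LinearMap.sub_apply,
    LinearMap.smul_apply, QuadraticAlgebra.norm_def]
  rw [h.symm p.2 p.1]
  module

theorem card_quadraticAlgebra {k : Type*} (a b : k) :
    Nat.card (QuadraticAlgebra k a b) = Nat.card k ^ 2 := by
  rw [Nat.card_congr (QuadraticAlgebra.equivProd a b), Nat.card_prod, sq]

/-- The nonzero isotropic vectors of an anisotropic form, with coordinates in `Y`, fall into free
orbits under the multiplicative group of the quadratic extension field. -/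
theorem card_units_dvd_card_isotropic [Finite k] [Finite Y] (h : IsPerfectForm e B) {a b c : k}
    (hani : ∀ x y, a * x ^ 2 + b * x * y + c * y ^ 2 = 0 → x = 0 ∧ y = 0) :
    Nat.card k ^ 2 - 1 ∣
      Nat.card {p : Y × Y // a • B p.1 p.1 + b • B p.1 p.2 + c • B p.2 p.2 = 0 ∧ p ≠ 0} := by
  classical
  have ha : a ≠ 0 := fun ha => one_ne_zero (hani 1 0 (by simp [ha])).1
  let E := QuadraticAlgebra k (-(a * c)) b
  have hnorm : ∀ z : E, z.norm = 0 → z = 0 := by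
    intro z hz
    rw [QuadraticAlgebra.norm_def] at hz
    have := hani z.re (a * z.im) (by linear_combination a * hz)
    exact QuadraticAlgebra.ext this.1 ((mul_eq_zero.mp this.2).resolve_left ha)
  have hfree : ∀ (z : E) (p : Y × Y), quadraticAct z p = 0 → z = 0 ∨ p = 0 := by
    intro z p hz
    by_cases hz0 : z.norm = 0
    · exact Or.inl (hnorm z hz0)
    · obtain ⟨w, hw⟩ := (QuadraticAlgebra.isUnit_iff_norm_isUnit.mpr
        (isUnit_iff_ne_zero.mpr hz0)).exists_left_inv
      right
      rw [← quadraticAct_one (a := a) (b := b) (c := c) p, ← hw, quadraticAct_mul, hz]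
      simp [quadraticAct]
  let X := {p : Y × Y // a • B p.1 p.1 + b • B p.1 p.2 + c • B p.2 p.2 = 0 ∧ p ≠ 0}
  let _ : MulAction Eˣ X :=
    { smul := fun z p => ⟨quadraticAct (z : E) p.1, by
          rw [quadraticAct_form h, p.2.1, smul_zero], fun h0 => (hfree _ _ h0).elim
          (fun h1 => z.ne_zero h1) p.2.2⟩
      one_smul := fun p => Subtype.ext (quadraticAct_one _)
      mul_smul := fun z w p => Subtype.ext (quadraticAct_mul _ _ _) }
  have := Fintype.ofFinite k
  have := Fintype.ofFinite Y
  let _ : Fintype E := Fintype.ofEquiv _ (QuadraticAlgebra.equivProd (-(a * c)) b).symm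
  have hfix : ∀ z : Eˣ, z ≠ 1 → Fintype.card (MulAction.fixedBy X z) = 0 := by
    intro z hz
    rw [Fintype.card_eq_zero_iff]
    refine ⟨fun ⟨p, hp⟩ => ?_⟩
    have h1 : quadraticAct (z : E) p.1 = p.1 := congrArg Subtype.val hp
    have h2 : quadraticAct ((z : E) - 1) p.1 = 0 := by
      rw [quadraticAct_sub, h1, quadraticAct_one, sub_self]
    rcases hfree _ _ h2 with h3 | h3
    · exact hz (Units.ext (sub_eq_zero.mp h3))
    · exact p.2.2 h3
  have hburn := MulAction.sum_card_fixedBy_eq_card_orbits_mul_card_group Eˣ X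
  rw [Finset.sum_eq_single 1 (fun z _ hz => hfix z hz) (by simp)] at hburn
  have hone : Fintype.card (MulAction.fixedBy X (1 : Eˣ)) = Fintype.card X := by
    rw [← Nat.card_eq_fintype_card, ← Nat.card_eq_fintype_card, MulAction.fixedBy_one_eq_univ]
    exact Nat.card_congr (Equiv.Set.univ X)
  have hunits : Fintype.card Eˣ = Nat.card k ^ 2 - 1 := by
    have hE : Nat.card E = Nat.card k ^ 2 := card_quadraticAlgebra _ _
    let _ : DivisionRing E := by
      refine DivisionRing.ofIsUnitOrEqZero fun z => ?_
      by_cases hz : z = 0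
      · exact Or.inr hz
      · exact Or.inl (QuadraticAlgebra.isUnit_iff_norm_isUnit.mpr
          (isUnit_iff_ne_zero.mpr fun h0 => hz (hnorm z h0)))
    rw [← hE, Nat.card_eq_fintype_card, Fintype.card_units]
  rw [show Nat.card _ = Fintype.card X from Nat.card_eq_fintype_card, ← hone, hburn, hunits]
  exact dvd_mul_left _ _

/-- The sum over an anisotropic plane. Averaging over the multiples of the form by scalars
expresses the sum through the number of isotropic vectors, which is `1` modulo `|k|² - 1`; as its
square is `|Y|²`, this determines it. -/
theorem planeSum_of_anisotropic [Finite k] [Fintype Y] (h : IsPerfectForm e B) {a b c : k}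
    (hani : ∀ x y, a * x ^ 2 + b * x * y + c * y ^ 2 = 0 → x = 0 ∧ y = 0)
    (hd : b ^ 2 - 4 * a * c ≠ 0) {f : ℕ} (hf : Nat.card Y = Nat.card k ^ f) :
    planeSum e B a b c = (-1) ^ f * Nat.card Y := by
  classical
  have := Fintype.ofFinite k
  set q := Nat.card k with hq
  have hq2 : 2 ≤ q := Finite.one_lt_card
  set G := planeSum e B a b c with hG
  have hneg : planeSum e B (-a) (-b) (-c) = G := by
    have := planeSum_smul h hd (t := -1) (by simp)
    simpa using this
  have hsq : G ^ 2 = ((q : ℂ) ^ f) ^ 2 := by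
    have := planeSum_mul_planeSum_neg h (isUnit_iff_ne_zero.mpr hd)
    rw [hneg, ← hG, hf] at this
    rw [sq, this]; push_cast; ring
  obtain ⟨m, hm⟩ := card_units_dvd_card_isotropic h hani
  set n0 := Nat.card {p : Y × Y // a • B p.1 p.1 + b • B p.1 p.2 + c • B p.2 p.2 = 0} with hn0
  have hn0m : n0 = 1 + (q ^ 2 - 1) * m := by
    rw [← hm, hn0, Nat.card_eq_fintype_card, Nat.card_eq_fintype_card, Fintype.card_subtype,
      Fintype.card_subtype, ← Finset.filter_filter, Finset.filter_ne', add_comm,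
      Finset.card_erase_add_one]
    simp
  -- Summation over all scalars `t` counts isotropic vectors; the terms with `t ≠ 0` are all `G`.
  have hsum : ∑ t : k, planeSum e B (t * a) (t * b) (t * c) = q * n0 := by
    unfold planeSum
    rw [Finset.sum_comm]
    have : ∀ p : Y × Y, ∑ t : k, e ((t * a) • B p.1 p.1 + (t * b) • B p.1 p.2 +
        (t * c) • B p.2 p.2) =
        if a • B p.1 p.1 + b • B p.1 p.2 + c • B p.2 p.2 = 0 then (q : ℂ) else 0 := by
      intro p
      have := h.sum_char (LinearMap.toSpanSingleton k W
        (a • B p.1 p.1 + b • B p.1 p.2 + c • B p.2 p.2))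
      simp only [LinearMap.toSpanSingleton_apply, smul_add, smul_smul,
        LinearMap.toSpanSingleton_eq_zero_iff] at this
      exact this
    rw [Finset.sum_congr rfl fun p _ => this p, ← Finset.sum_filter, Finset.sum_const,
      nsmul_eq_mul, mul_comm, hn0, Nat.card_eq_fintype_card, Fintype.card_subtype]
  have hmain : ((q : ℂ) - 1) * G = q * n0 - ((q : ℂ) ^ f) ^ 2 := by
    rw [← hsum, ← Finset.add_sum_erase _ _ (Finset.mem_univ (0 : k)),
      Finset.sum_congr rfl fun t ht => planeSum_smul h hd (Finset.ne_of_mem_erase ht),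
      Finset.sum_const, Finset.card_erase_of_mem (Finset.mem_univ _), Finset.card_univ,
      ← Nat.card_eq_fintype_card, ← hq, ← hG, nsmul_eq_mul, Nat.cast_sub (by lia)]
    have : planeSum e B (0 * a) (0 * b) (0 * c) = ((q : ℂ) ^ f) ^ 2 := by
      simp only [planeSum, zero_mul, zero_smul, add_zero, AddChar.map_zero_eq_one, Finset.sum_const,
        Finset.card_univ, ← Nat.card_eq_fintype_card, Nat.card_prod, hf, nsmul_eq_mul]
      push_cast; ring
    rw [this]; push_cast; ring
  obtain ⟨s, hs, hGs⟩ : ∃ s : ℤ, (s = 1 ∨ s = -1) ∧ G = s * (q : ℂ) ^ f := by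
    rcases sq_eq_sq_iff_eq_or_eq_neg.mp hsq with h1 | h1
    · exact ⟨1, Or.inl rfl, by rw [h1]; simp⟩
    · exact ⟨-1, Or.inr rfl, by rw [h1]; simp⟩
  have hint : ((q : ℤ) - 1) * (s * (q : ℤ) ^ f) =
      q * (1 + ((q : ℤ) ^ 2 - 1) * m) - ((q : ℤ) ^ f) ^ 2 := by
    have h1 : 1 ≤ q ^ 2 := Nat.one_le_pow _ _ (by lia)
    rw [hGs, hn0m] at hmain
    push_cast [Nat.cast_sub h1] at hmain
    exact_mod_cast hmain
  -- The sign is determined modulo `q + 1`, which is at least `3`.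
  have hq1 : (q : ℤ) ≡ -1 [ZMOD (q + 1 : ℤ)] := by
    rw [Int.modEq_iff_dvd]; exact ⟨-1, by ring⟩
  obtain ⟨l, hl⟩ : ((q : ℤ) ^ 2 - 1) ∣ ((q : ℤ) ^ f) ^ 2 - 1 := by
    rw [← pow_mul, mul_comm f 2, pow_mul]
    exact sub_one_dvd_pow_sub_one _ _
  have hkey : s * (q : ℤ) ^ f = 1 + (q + 1) * (q * m - l) := by
    have hne : ((q : ℤ) - 1) ≠ 0 := by
      have : (2 : ℤ) ≤ q := by exact_mod_cast hq2
      lia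
    apply mul_left_cancel₀ hne
    linear_combination hint - hl
  have hmod : s * (-1) ^ f ≡ 1 [ZMOD (q + 1 : ℤ)] := by
    calc s * (-1) ^ f ≡ s * (q : ℤ) ^ f [ZMOD (q + 1 : ℤ)] := ((hq1.pow f).symm).mul_left s
      _ ≡ 1 [ZMOD (q + 1 : ℤ)] := by
        rw [hkey, Int.modEq_iff_dvd]; exact ⟨-(q * m - l), by ring⟩
  have hsf : s = (-1) ^ f := by
    have hf1 : ((-1 : ℤ) ^ f = 1 ∨ (-1 : ℤ) ^ f = -1) := neg_one_pow_eq_or ℤ f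
    have hqz : (2 : ℤ) ≤ q := by exact_mod_cast hq2
    have hno : ¬ ((q + 1 : ℤ) ∣ 2) := fun hdvd => by
      have := Int.le_of_dvd (by norm_num) hdvd
      lia
    rw [Int.modEq_iff_dvd] at hmod
    rcases hs with rfl | rfl <;> rcases hf1 with h1 | h1 <;> rw [h1] at hmod ⊢ <;>
      exact absurd (by simpa using hmod) hno
  rw [hGs, hsf, hf]
  push_cast; ring

end FiniteField
end HilbertSiegel

/-! ### Change of the base ring, reduction by isotropic submodules, binary forms over local rings -/

namespace HilbertSiegel

section ChangeOfRing

variable {R Y W : Type*} [CommRing R] [AddCommGroup Y] [Module R Y] [AddCommGroup W] [Module R W]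
  (J : Ideal R) [Module (R ⧸ J) Y] [IsScalarTower R (R ⧸ J) Y]
  {e : AddChar W ℂ} {B : Y →ₗ[R] Y →ₗ[R] W}

theorem quotient_mk_smul (r : R) (y : Y) : (Ideal.Quotient.mk J r) • y = r • y := by
  rw [← Ideal.Quotient.algebraMap_eq, algebraMap_smul]

/-- A form on a module over `R ⧸ J` takes its values in the `J`-torsion, and is bilinear over
`R ⧸ J`. -/
def quotientForm (B : Y →ₗ[R] Y →ₗ[R] W) :
    Y →ₗ[R ⧸ J] Y →ₗ[R ⧸ J] Submodule.torsionBySet R W J :=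
  have hmem : ∀ x y, B x y ∈ Submodule.torsionBySet R W J := fun x y => by
    rw [Submodule.mem_torsionBySet_iff]
    rintro ⟨a, ha⟩
    rw [← LinearMap.smul_apply, ← map_smul, ← quotient_mk_smul J,
      Ideal.Quotient.eq_zero_iff_mem.mpr ha, zero_smul, map_zero, LinearMap.zero_apply]
  LinearMap.mk₂ (R ⧸ J) (fun x y => ⟨B x y, hmem x y⟩)
    (fun x x' y => Subtype.ext (by simp))
    (fun r x y => by
      obtain ⟨r, rfl⟩ := Ideal.Quotient.mk_surjective r
      rw [Submodule.torsionBySet.mk_smul]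
      exact Subtype.ext (by rw [quotient_mk_smul]; simp))
    (fun x y y' => Subtype.ext (by simp))
    (fun r x y => by
      obtain ⟨r, rfl⟩ := Ideal.Quotient.mk_surjective r
      rw [Submodule.torsionBySet.mk_smul]
      exact Subtype.ext (by rw [quotient_mk_smul]; simp))

theorem coe_quotientForm (x y : Y) : (quotientForm J B x y : W) = B x y := rfl

/-- The restriction of an additive character to the `J`-torsion. -/
def torsionChar (e : AddChar W ℂ) : AddChar (Submodule.torsionBySet R W J) ℂ :=
  e.compAddMonoidHom (Submodule.torsionBySet R W J).subtype.toAddMonoidHom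

theorem torsionChar_apply (w : Submodule.torsionBySet R W J) : torsionChar J e w = e w := rfl

theorem IsPerfectForm.quotientForm (h : IsPerfectForm e B) :
    IsPerfectForm (torsionChar J e) (HilbertSiegel.quotientForm J B) where
  primitive w hw := Subtype.ext (h.primitive w fun r => by
    rw [← hw (Ideal.Quotient.mk J r), Submodule.torsionBySet.mk_smul, torsionChar_apply]; rfl)
  symm x y := Subtype.ext (h.symm x y)
  nondegenerate x hx := h.nondegenerate x fun y => congrArg Subtype.val (hx y)

theorem coe_mk_smul (r : R) (w : Submodule.torsionBySet R W J) :
    ((Ideal.Quotient.mk J r • w : Submodule.torsionBySet R W J) : W) = r • (w : W) := rfl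

theorem planeSum_quotientForm [Fintype Y] (a b c : R) :
    planeSum (torsionChar J e) (HilbertSiegel.quotientForm J B) (Ideal.Quotient.mk J a)
      (Ideal.Quotient.mk J b) (Ideal.Quotient.mk J c) = planeSum e B a b c := rfl

theorem quadSum_quotientForm [Fintype Y] {ι : Type*} [Fintype ι] [DecidableEq ι]
    (T : Matrix ι ι R) :
    quadSum (torsionChar J e) (HilbertSiegel.quotientForm J B) (T.map (Ideal.Quotient.mk J)) =
      quadSum e B T := by
  unfold quadSum
  refine Finset.sum_congr rfl fun y _ => ?_
  rw [torsionChar_apply]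
  congr 1
  simp only [Submodule.coe_sum, Matrix.map_apply, coe_mk_smul, coe_quotientForm]

end ChangeOfRing

section Reduction

variable {R Y W : Type*} [CommRing R] [AddCommGroup Y] [Module R Y] [AddCommGroup W] [Module R W]
  {e : AddChar W ℂ} {B : Y →ₗ[R] Y →ₗ[R] W}

open IsPerfectForm

/-- The form induced on `I^⊥ / I` by a symmetric form with a totally isotropic submodule `I`. -/
def reducedForm (B : Y →ₗ[R] Y →ₗ[R] W) (hB : ∀ x y, B x y = B y x) (I : Submodule R Y) :
    (orth B I ⧸ I.submoduleOf (orth B I)) →ₗ[R] (orth B I ⧸ I.submoduleOf (orth B I)) →ₗ[R] W :=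
  Submodule.liftQ _
    { toFun := fun x => Submodule.liftQ _ ((B x).comp (orth B I).subtype) fun y hy => x.2 y hy
      map_add' := fun x x' => by
        ext y
        change B (x + x' : Y) y = B x y + B x' y
        rw [map_add, LinearMap.add_apply]
      map_smul' := fun r x => by
        ext y
        change B (r • x : Y) y = r • B x y
        rw [map_smul, LinearMap.smul_apply] }
    (fun x hx => by
      rw [LinearMap.mem_ker]
      ext y
      change B (x : Y) y = 0
      rw [hB]
      exact y.2 x hx)

theorem IsPerfectForm.reducedForm [Finite Y] (h : IsPerfectForm e B) (I : Submodule R Y) :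
    IsPerfectForm e (reducedForm B h.symm I) where
  primitive := h.primitive
  symm x y := by
    induction x using Submodule.Quotient.induction_on with | H x => ?_
    induction y using Submodule.Quotient.induction_on with | H y => ?_
    exact h.symm x y
  nondegenerate x hx := by
    induction x using Submodule.Quotient.induction_on with | H x => ?_
    rw [Submodule.Quotient.mk_eq_zero]
    have : (x : Y) ∈ orth B (orth B I) := fun y hy => hx (Submodule.Quotient.mk ⟨y, hy⟩)
    rwa [h.orth_orth] at this

theorem card_eq_card_reduced [Finite Y] (h : IsPerfectForm e B) {I : Submodule R Y}
    (hI : I ≤ orth B I) :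
    Nat.card Y = Nat.card I ^ 2 * Nat.card (orth B I ⧸ I.submoduleOf (orth B I)) := by
  rw [← h.card_mul_card_orth I, Submodule.card_eq_card_quotient_mul_card (I.submoduleOf (orth B I)),
    Nat.card_congr (Submodule.submoduleOfEquivOfLe hI).toEquiv]
  ring

/-- A function that factors through a quotient module, summed over the fibres. -/
theorem sum_comp_mkQ {M : Type*} [AddCommGroup M] [Module R M] [Fintype M] (N : Submodule R M)
    [Fintype (M ⧸ N)] (g : M ⧸ N → ℂ) :
    ∑ x : M, g (Submodule.Quotient.mk x) = Nat.card N * ∑ y, g y := by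
  classical
  rw [Finset.mul_sum, ← Finset.sum_fiberwise (s := Finset.univ)
    (g := fun x : M => (Submodule.Quotient.mk x : M ⧸ N))]
  refine Finset.sum_congr rfl fun y _ => ?_
  rw [Finset.sum_congr rfl (g := fun _ => g y) fun x hx => by rw [(Finset.mem_filter.mp hx).2],
    Finset.sum_const, nsmul_eq_mul]
  congr 2
  induction y using Submodule.Quotient.induction_on with | H y => ?_
  rw [← Fintype.card_subtype, ← Nat.card_eq_fintype_card]
  refine Nat.card_congr
    { toFun := fun x => ⟨x.1 - y, (Submodule.Quotient.eq N).mp x.2⟩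
      invFun := fun x => ⟨x.1 + y, (Submodule.Quotient.eq N).mpr (by simp)⟩
      left_inv := fun x => by simp
      right_inv := fun x => by simp }

/-- A totally isotropic submodule `I` may be divided out, at the price of passing to `I^⊥`. -/
theorem planeSum_eq_reduced [Fintype Y] (h : IsPerfectForm e B) {I : Submodule R Y}
    (hI : I ≤ orth B I) {a b c : R} (hd : IsUnit (b ^ 2 - 4 * a * c))
    [Fintype (orth B I ⧸ I.submoduleOf (orth B I))] :
    planeSum e B a b c =
      (Nat.card I : ℂ) ^ 2 * planeSum e (HilbertSiegel.reducedForm B h.symm I) a b c := by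
  classical
  set F : Y × Y → ℂ := fun p => e (a • B p.1 p.1 + b • B p.1 p.2 + c • B p.2 p.2) with hF
  have hIpos : (Nat.card I : ℂ) ^ 2 ≠ 0 := by
    exact_mod_cast (pow_pos (Nat.card_pos : 0 < Nat.card I) 2).ne'
  -- averaging over the translations by `I × I`
  have h1 : (Nat.card I : ℂ) ^ 2 * ∑ p, F p =
      ∑ p, F p * ∑ x : I × I, e (B ((2 * a) • p.1 + b • p.2) x.1) *
        e (B (b • p.1 + (2 * c) • p.2) x.2) := by
    simp_rw [Finset.mul_sum]
    rw [Finset.sum_comm, ← Finset.mul_sum]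
    have : ∀ x : I × I, ∑ p, F p * (e (B ((2 * a) • p.1 + b • p.2) x.1) *
        e (B (b • p.1 + (2 * c) • p.2) x.2)) = ∑ p, F p := by
      intro x
      rw [← Equiv.sum_comp (Equiv.addRight ((x.1 : Y), (x.2 : Y))) F]
      refine Finset.sum_congr rfl fun p _ => ?_
      simp only [hF, ← AddChar.map_add_eq_mul]
      congr 1
      have hz : ∀ i j : I, B (i : Y) (j : Y) = 0 := fun i j => hI i.2 j j.2
      simp only [Equiv.coe_addRight, Prod.fst_add, Prod.snd_add, map_add, map_smul,
        LinearMap.add_apply, LinearMap.smul_apply, hz]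
      rw [h.symm x.1 p.1, h.symm x.2 p.2, h.symm x.1 p.2]
      module
    rw [Finset.sum_congr rfl fun x _ => this x, Finset.sum_const, Finset.card_univ,
      Fintype.card_prod, ← Nat.card_eq_fintype_card, nsmul_eq_mul]
    push_cast; rw [sq]
  have h2 : ∀ p : Y × Y, ∑ x : I × I, e (B ((2 * a) • p.1 + b • p.2) x.1) *
        e (B (b • p.1 + (2 * c) • p.2) x.2) =
      if p.1 ∈ orth B I ∧ p.2 ∈ orth B I then (Nat.card I : ℂ) ^ 2 else 0 := by
    intro p
    rw [Fintype.sum_prod_type]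
    simp_rw [← Finset.mul_sum, ← Finset.sum_mul]
    have hsum : ∀ z : Y, ∑ x : I, e (B z x) = if z ∈ orth B I then (Nat.card I : ℂ) else 0 := by
      intro z
      have := h.sum_char ((B z).comp I.subtype)
      rw [show (∑ x : I, e (B z x)) = ∑ x, e ((B z ∘ₗ I.subtype) x) from rfl, this]
      refine if_congr ?_ rfl rfl
      simp [LinearMap.ext_iff, mem_orth]
    rw [hsum, hsum, ite_zero_mul_ite_zero, sq]
    exact if_congr (smul_add_smul_mem_iff hd) rfl rfl
  have h3 : ∑ p, F p = ∑ p : orth B I × orth B I, F (p.1, p.2) := by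
    apply mul_left_cancel₀ hIpos
    rw [h1, Finset.sum_congr rfl fun p _ => by rw [h2 p, mul_ite, mul_zero],
      ← Finset.sum_filter, ← Finset.sum_mul, mul_comm]
    congr 1
    exact Finset.sum_nbij' (fun p => if hp : p.1 ∈ orth B I ∧ p.2 ∈ orth B I then
        (⟨p.1, hp.1⟩, ⟨p.2, hp.2⟩) else 0) (fun p => (p.1, p.2))
      (by simp) (by simp) (fun p hp => by
        have := (Finset.mem_filter.mp hp).2
        simp [this]) (by simp) (fun p hp => by
        have := (Finset.mem_filter.mp hp).2
        simp [this])
  rw [planeSum, ← hF, h3, Fintype.sum_prod_type]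
  have h4 : ∀ x : orth B I, ∑ y : orth B I, F (x, y) = Nat.card I *
      ∑ y, e (a • HilbertSiegel.reducedForm B h.symm I (Submodule.Quotient.mk x)
          (Submodule.Quotient.mk x) +
        b • HilbertSiegel.reducedForm B h.symm I (Submodule.Quotient.mk x) y +
        c • HilbertSiegel.reducedForm B h.symm I y y) := fun x => by
    rw [← Nat.card_congr (Submodule.submoduleOfEquivOfLe hI).toEquiv,
      ← sum_comp_mkQ (I.submoduleOf (orth B I)) (fun y =>
        e (a • HilbertSiegel.reducedForm B h.symm I (Submodule.Quotient.mk x)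
          (Submodule.Quotient.mk x) +
        b • HilbertSiegel.reducedForm B h.symm I (Submodule.Quotient.mk x) y +
        c • HilbertSiegel.reducedForm B h.symm I y y))]
    rfl
  rw [Finset.sum_congr rfl fun x _ => h4 x, ← Finset.mul_sum,
    sum_comp_mkQ (I.submoduleOf (orth B I)) (fun x => ∑ y,
        e (a • HilbertSiegel.reducedForm B h.symm I x x +
        b • HilbertSiegel.reducedForm B h.symm I x y +
        c • HilbertSiegel.reducedForm B h.symm I y y)),
    Nat.card_congr (Submodule.submoduleOfEquivOfLe hI).toEquiv, planeSum, Fintype.sum_prod_type]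
  ring

end Reduction

section LocalPlane

open IsLocalRing

/-- The order of a finite module over a local ring is a power of the order of the residue field. -/
theorem exists_card_eq_pow {R : Type*} [CommRing R] [IsLocalRing R] {Y : Type*} [AddCommGroup Y]
    [Module R Y] [Finite Y] : ∃ f, Nat.card Y = Nat.card (ResidueField R) ^ f := by
  suffices ∀ n (N : Submodule R Y), Nat.card N = n → ∃ f, n = Nat.card (ResidueField R) ^ f by
    obtain ⟨f, hf⟩ := this _ ⊤ rfl
    refine ⟨f, ?_⟩
    rw [← hf]
    exact (Nat.card_congr Submodule.topEquiv.toEquiv).symm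
  intro n
  induction n using Nat.strong_induction_on with | _ n ih => ?_
  intro N hN
  by_cases hbot : N = ⊥
  · exact ⟨0, by rw [← hN, hbot]; simp⟩
  let N' : Submodule R N := maximalIdeal R • ⊤
  have hne : N' ≠ ⊤ := fun h0 => hbot (by
    have : (⊤ : Submodule R N) = ⊥ := Submodule.eq_bot_of_le_smul_of_le_jacobson_bot
      (maximalIdeal R) ⊤ Module.Finite.fg_top (by exact h0.ge) (maximalIdeal_le_jacobson _)
    rw [Submodule.eq_bot_iff] at this ⊢
    exact fun x hx => congrArg Subtype.val (this ⟨x, hx⟩ trivial))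
  have hcard := Submodule.card_eq_card_quotient_mul_card N'
  have : Finite (N ⧸ N') := Finite.of_surjective _ N'.mkQ_surjective
  have h1 : Nat.card (N'.map N.subtype) = Nat.card N' :=
    (Nat.card_congr (Submodule.equivMapOfInjective _ N.injective_subtype N').toEquiv).symm
  obtain ⟨g, hg⟩ := ih (Nat.card N') (by
    rw [← hN]
    have hpos : 0 < Nat.card N' := Nat.card_pos
    have : 1 < Nat.card (N ⧸ N') := by
      have : Nontrivial (N ⧸ N') := Submodule.Quotient.nontrivial_iff.mpr hne
      exact Finite.one_lt_card
    rw [hcard]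
    nlinarith) (N'.map N.subtype) h1
  let _ : Field (R ⧸ maximalIdeal R) := Ideal.Quotient.field _
  have : Module.Finite (R ⧸ maximalIdeal R) (N ⧸ N') := Module.Finite.of_finite
  have h2 : Nat.card (N ⧸ N') = Nat.card (ResidueField R) ^
      Module.finrank (R ⧸ maximalIdeal R) (N ⧸ N') :=
    Module.natCard_eq_pow_finrank (K := R ⧸ maximalIdeal R)
  refine ⟨Module.finrank (R ⧸ maximalIdeal R) (N ⧸ N') + g, ?_⟩
  rw [← hN, hcard, h2, hg, pow_add, mul_comm]

/-- In a finite local ring every element of the maximal ideal is nilpotent. -/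
theorem exists_pow_eq_zero {R : Type*} [CommRing R] [IsLocalRing R] [Finite R] {r : R}
    (hr : r ∈ maximalIdeal R) : ∃ n, r ^ n = 0 := by
  obtain ⟨i, j, hne, hij⟩ := Finite.exists_ne_map_eq_of_infinite fun n : ℕ => r ^ n
  wlog hlt : i < j generalizing i j
  · exact this j i hne.symm hij.symm (lt_of_le_of_ne (not_lt.mp hlt) hne.symm)
  refine ⟨i, ?_⟩
  have hu : IsUnit (1 - r ^ (j - i)) := by
    by_contra hu
    have h1 := Ideal.pow_mem_of_mem _ hr (j - i) (by lia)
    have := Ideal.add_mem _ ((mem_maximalIdeal _).mpr hu) h1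
    rw [sub_add_cancel] at this
    exact (Ideal.ne_top_iff_one _).mp (maximalIdeal.isMaximal R).ne_top this
  apply hu.mul_left_injective
  simp only [zero_mul, mul_sub, mul_one, ← pow_add]
  rw [show i + (j - i) = j by lia, sub_zero, sub_eq_zero]
  exact hij

/-- The sum over a plane of unit discriminant over a finite local ring, where `ε` is `1` or `-1`
according as the form is isotropic or anisotropic over the residue field. Totally isotropic
submodules are divided out until `Y` is a vector space over the residue field. -/
theorem planeSum_local {R : Type*} [CommRing R] [IsLocalRing R] [Finite R]
    {W : Type*} [AddCommGroup W] [Module R W] {e : AddChar W ℂ} {a b c : R}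
    (hd : IsUnit (b ^ 2 - 4 * a * c)) {ε : ℂ}
    (hiso : (∃ x y, (IsUnit x ∨ IsUnit y) ∧ ¬ IsUnit (a * x ^ 2 + b * x * y + c * y ^ 2)) → ε = 1)
    (hani : (¬ ∃ x y, (IsUnit x ∨ IsUnit y) ∧ ¬ IsUnit (a * x ^ 2 + b * x * y + c * y ^ 2)) →
      ε = -1)
    {Y : Type*} [AddCommGroup Y] [Module R Y] [Fintype Y] {B : Y →ₗ[R] Y →ₗ[R] W}
    (h : IsPerfectForm e B) {f : ℕ} (hf : Nat.card Y = Nat.card (ResidueField R) ^ f) :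
    planeSum e B a b c = ε ^ f * Nat.card Y := by
  classical
  generalize hn : Nat.card Y = n
  induction n using Nat.strong_induction_on generalizing Y f with | _ n ih => ?_
  have hε : ε ^ 2 = 1 := by
    by_cases hi : ∃ x y, (IsUnit x ∨ IsUnit y) ∧ ¬ IsUnit (a * x ^ 2 + b * x * y + c * y ^ 2)
    · rw [hiso hi, one_pow]
    · rw [hani hi]; norm_num
  by_cases htriv : ∀ r ∈ maximalIdeal R, ∀ y : Y, r • y = 0
  · let _ : Field (R ⧸ maximalIdeal R) := Ideal.Quotient.field _
    have htors : Module.IsTorsionBySet R Y (maximalIdeal R) := fun y r => htriv r r.2 y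
    let _ : Module (R ⧸ maximalIdeal R) Y := htors.module
    have : IsScalarTower R (R ⧸ maximalIdeal R) Y := htors.isScalarTower
    have : Finite (R ⧸ maximalIdeal R) := Finite.of_surjective _ Ideal.Quotient.mk_surjective
    have hunit : ∀ x : R, IsUnit x ↔ Ideal.Quotient.mk (maximalIdeal R) x ≠ 0 := fun x => by
      rw [Ne, Ideal.Quotient.eq_zero_iff_mem, mem_maximalIdeal, mem_nonunits_iff, not_not]
    rw [← planeSum_quotientForm (maximalIdeal R)]
    have hd' := (hunit _).mp hd
    simp only [map_sub, map_mul, map_pow, map_ofNat] at hd'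
    by_cases hi : ∃ x y, (IsUnit x ∨ IsUnit y) ∧ ¬ IsUnit (a * x ^ 2 + b * x * y + c * y ^ 2)
    · rw [hiso hi, one_pow, one_mul]
      obtain ⟨x, y, hxy, h0⟩ := hi
      rw [hunit, hunit] at hxy
      rw [hunit, not_not] at h0
      rw [← hn]
      exact planeSum_of_isotropic (h.quotientForm _) hd' hxy (by simpa using h0)
    · rw [hani hi, ← hn]
      refine planeSum_of_anisotropic (h.quotientForm _) ?_ hd' hf
      intro x y hxy
      obtain ⟨x, rfl⟩ := Ideal.Quotient.mk_surjective x
      obtain ⟨y, rfl⟩ := Ideal.Quotient.mk_surjective y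
      push Not at hi
      have := mt (hi x y)
      simp only [hunit, map_add, map_mul, map_pow, hxy, ne_eq, not_true_eq_false,
        not_false_eq_true, forall_const, not_or, not_not] at this
      exact this
  · push Not at htriv
    obtain ⟨r, hr, y, hry⟩ := htriv
    -- If `j` is the least exponent with `r ^ j Y = 0`, then `r ^ (j - 1) Y` is totally isotropic,
    -- as `2 (j - 1) ≥ j`.
    have hex : ∃ j, ∀ z : Y, r ^ j • z = 0 := by
      obtain ⟨j, hj⟩ := exists_pow_eq_zero hr
      exact ⟨j, fun z => by rw [hj, zero_smul]⟩
    let j := Nat.find hex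
    have hj : ∀ z : Y, r ^ j • z = 0 := Nat.find_spec hex
    have hj2 : 2 ≤ j := by
      by_contra hlt
      have : j = 0 ∨ j = 1 := by lia
      rcases this with h0 | h0
      · exact hry (by have := hj (r • y); rwa [h0, pow_zero, one_smul] at this)
      · exact hry (by have := hj y; rwa [h0, pow_one] at this)
    have hj' : ¬ ∀ z : Y, r ^ (j - 1) • z = 0 := Nat.find_min hex (by lia)
    let I : Submodule R Y := LinearMap.range (LinearMap.lsmul R Y (r ^ (j - 1)))
    have hI : I ≤ IsPerfectForm.orth B I := by
      rintro _ ⟨z, rfl⟩ _ ⟨w, rfl⟩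
      simp only [LinearMap.lsmul_apply, map_smul, LinearMap.smul_apply, smul_smul, ← pow_add]
      rw [show j - 1 + (j - 1) = (j - 2) + j by lia, pow_add, mul_smul, ← map_smul, hj, map_zero,
        smul_zero]
    have hI1 : 1 < Nat.card I := by
      have : Nontrivial I := by
        rw [Submodule.nontrivial_iff_ne_bot]
        intro h0
        exact hj' fun z => (Submodule.eq_bot_iff _).mp h0 _ ⟨z, rfl⟩
      exact Finite.one_lt_card
    have hcard := card_eq_card_reduced h hI
    set Y₁ := IsPerfectForm.orth B I ⧸ I.submoduleOf (IsPerfectForm.orth B I)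
    obtain ⟨g, hg⟩ := exists_card_eq_pow (R := R) (Y := I)
    obtain ⟨f₁, hf₁⟩ := exists_card_eq_pow (R := R) (Y := Y₁)
    have hpos : 0 < Nat.card Y₁ := Nat.card_pos
    have hlt : Nat.card Y₁ < n := by
      rw [← hn, hcard]
      have : 1 < Nat.card I ^ 2 := Nat.one_lt_pow (by norm_num) hI1
      nlinarith
    have hq : 2 ≤ Nat.card (ResidueField R) := by
      have : Finite (ResidueField R) := Finite.of_surjective _ (residue_surjective (R := R))
      exact Finite.one_lt_card
    have hff : f = 2 * g + f₁ := by
      apply Nat.pow_right_injective hq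
      simp only
      rw [← hf, hcard, hg, hf₁, pow_add, ← pow_mul, mul_comm g 2]
    have := Fintype.ofFinite Y₁
    rw [planeSum_eq_reduced h hI hd, ih _ hlt (h.reducedForm I) hf₁ rfl, ← hn, hcard, hff, pow_add,
      pow_mul, hε, one_pow]
    push_cast; ring

end LocalPlane
end HilbertSiegel

/-! ### Quadratic forms in several variables over local rings -/

namespace HilbertSiegel

section QuadSum

variable {R Y W : Type*} [CommRing R] [AddCommGroup Y] [Module R Y] [AddCommGroup W] [Module R W]
  {e : AddChar W ℂ} {B : Y →ₗ[R] Y →ₗ[R] W} [Fintype Y] {ι κ : Type*} [Fintype ι] [DecidableEq ι]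
  [Fintype κ] [DecidableEq κ]

/-- The sum depends only on the quadratic form defined by the matrix. -/
theorem quadSum_congr (h : IsPerfectForm e B) {T T' : Matrix ι ι R} (hdiag : ∀ i, T i i = T' i i)
    (hsum : ∀ i j, i ≠ j → T i j + T j i = T' i j + T' j i) : quadSum e B T = quadSum e B T' := by
  unfold quadSum
  refine Finset.sum_congr rfl fun y _ => congrArg e ?_
  rw [← sub_eq_zero, ← Finset.sum_sub_distrib]
  simp_rw [← Finset.sum_sub_distrib]
  rw [← Finset.sum_product']
  refine Finset.sum_involution (fun p _ => (p.2, p.1)) ?_ ?_ (by simp) (by simp)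
  · rintro ⟨i, j⟩ -
    by_cases hij : i = j
    · subst hij; simp [hdiag]
    · have h1 : T i j - T' i j = -(T j i - T' j i) := by linear_combination hsum i j hij
      simp only
      rw [← sub_smul, ← sub_smul, h1, h.symm (y j) (y i)]
      module
  · rintro ⟨i, j⟩ - hne heq
    simp only [Prod.mk.injEq] at heq
    obtain ⟨rfl, -⟩ := heq
    simp [hdiag] at hne

theorem quadSum_submatrix (σ : κ ≃ ι) (T : Matrix ι ι R) :
    quadSum e B (T.submatrix σ σ) = quadSum e B T := by
  unfold quadSum
  rw [← Equiv.sum_comp (Equiv.arrowCongr σ (Equiv.refl Y))]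
  refine Finset.sum_congr rfl fun y _ => congrArg e ?_
  rw [← Equiv.sum_comp σ]
  refine Finset.sum_congr rfl fun i _ => ?_
  rw [← Equiv.sum_comp σ]
  simp

/-- The linear substitution of a family by an invertible matrix. -/
def matrixSubst (g g' : Matrix ι ι R) (h : g * g' = 1) (h' : g' * g = 1) : (ι → Y) ≃ (ι → Y) where
  toFun y i := ∑ j, g i j • y j
  invFun y i := ∑ j, g' i j • y j
  left_inv y := by
    ext i
    simp_rw [Finset.smul_sum, smul_smul]
    rw [Finset.sum_comm]
    simp_rw [← Finset.sum_smul, ← Matrix.mul_apply, h', Matrix.one_apply, ite_smul]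
    simp
  right_inv y := by
    ext i
    simp_rw [Finset.smul_sum, smul_smul]
    rw [Finset.sum_comm]
    simp_rw [← Finset.sum_smul, ← Matrix.mul_apply, h, Matrix.one_apply, ite_smul]
    simp

theorem quadSum_conj {g : Matrix ι ι R} (hg : IsUnit g.det) (T : Matrix ι ι R) :
    quadSum e B (g.transpose * T * g) = quadSum e B T := by
  symm
  unfold quadSum
  rw [← Equiv.sum_comp (matrixSubst g g⁻¹ (Matrix.mul_nonsing_inv _ hg)
    (Matrix.nonsing_inv_mul _ hg))]
  refine Finset.sum_congr rfl fun y _ => congrArg e ?_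
  simp only [matrixSubst, Equiv.coe_fn_mk, map_sum, map_smul, LinearMap.sum_apply,
    LinearMap.smul_apply, Finset.smul_sum, smul_smul, Matrix.mul_apply, Matrix.transpose_apply,
    Finset.sum_smul, Finset.sum_mul]
  have swap : ∀ F : ι → ι → ι → ι → W,
      ∑ i, ∑ j, ∑ q, ∑ p, F i j q p = ∑ p, ∑ q, ∑ j, ∑ i, F i j q p := fun F =>
    calc ∑ i, ∑ j, ∑ q, ∑ p, F i j q p = ∑ i, ∑ p, ∑ j, ∑ q, F i j q p :=
          Finset.sum_congr rfl fun i _ => by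
            rw [Finset.sum_congr rfl fun j _ => Finset.sum_comm]; exact Finset.sum_comm
      _ = ∑ p, ∑ i, ∑ q, ∑ j, F i j q p := by
          rw [Finset.sum_comm]
          exact Finset.sum_congr rfl fun p _ => Finset.sum_congr rfl fun i _ => Finset.sum_comm
      _ = _ := Finset.sum_congr rfl fun p _ => by
          rw [Finset.sum_comm]; exact Finset.sum_congr rfl fun q _ => Finset.sum_comm
  rw [swap]
  refine Finset.sum_congr rfl fun p _ => Finset.sum_congr rfl fun q _ =>
    Finset.sum_congr rfl fun j _ => Finset.sum_congr rfl fun i _ => ?_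
  congr 1; ring

theorem quadSum_fromBlocks (T₁ : Matrix ι ι R) (T₂ : Matrix κ κ R) :
    quadSum e B (Matrix.fromBlocks T₁ 0 0 T₂) = quadSum e B T₁ * quadSum e B T₂ := by
  unfold quadSum
  rw [← Equiv.sum_comp (Equiv.sumArrowEquivProdArrow ι κ Y).symm, Fintype.sum_prod_type,
    Finset.sum_mul_sum]
  refine Finset.sum_congr rfl fun y _ => Finset.sum_congr rfl fun z _ => ?_
  rw [← AddChar.map_add_eq_mul]
  simp [Fintype.sum_sum_type, Equiv.sumArrowEquivProdArrow]

theorem quadSum_fin_two (h : IsPerfectForm e B) (T : Matrix (Fin 2) (Fin 2) R) :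
    quadSum e B T = planeSum e B (T 0 0) (T 0 1 + T 1 0) (T 1 1) := by
  unfold quadSum planeSum
  rw [← Equiv.sum_comp (finTwoArrowEquiv Y).symm]
  refine Finset.sum_congr rfl fun y _ => congrArg e ?_
  simp only [Fin.sum_univ_two, finTwoArrowEquiv_symm_apply, Matrix.cons_val_zero,
    Matrix.cons_val_one]
  rw [h.symm y.2 y.1]
  module

/-- Over a local ring, a symmetric matrix of unit determinant has a unit principal `2 × 2` minor
after at most one elementary change of basis. -/
theorem exists_isUnit_minor [IsLocalRing R] [Nontrivial ι] {G : Matrix ι ι R} (hG : G.IsSymm)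
    (hdet : IsUnit G.det) : ∃ g : Matrix ι ι R, IsUnit g.det ∧ ∃ i j, i ≠ j ∧
      IsUnit ((g.transpose * G * g) i i * (g.transpose * G * g) j j -
        (g.transpose * G * g) i j * (g.transpose * G * g) i j) := by
  -- a nonunit diagonal entry lies in a unit minor
  have key : ∀ H : Matrix ι ι R, IsUnit H.det → ∀ i, ¬ IsUnit (H i i) →
      ∃ j, i ≠ j ∧ IsUnit (H i i * H j j - H i j * H i j) := by
    intro H hH i hi
    have : ∃ j, IsUnit (H i j) := by
      by_contra! hno
      have h1 : H.det = ∑ j, H i j * H.adjugate j i := by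
        rw [← Matrix.mul_apply, Matrix.mul_adjugate]; simp
      have h2 : H.det ∈ IsLocalRing.maximalIdeal R := by
        rw [h1]
        exact Ideal.sum_mem _ fun j _ => Ideal.mul_mem_right _ _ (hno j)
      exact h2 hH
    obtain ⟨j, hj⟩ := this
    refine ⟨j, by rintro rfl; exact hi hj, ?_⟩
    by_contra hnu
    have h1 : H i i * H j j ∈ IsLocalRing.maximalIdeal R := Ideal.mul_mem_right _ _ hi
    have h2 := Ideal.sub_mem _ h1 hnu
    rw [sub_sub_cancel] at h2
    exact h2 (hj.mul hj)
  by_cases hall : ∃ i, ¬ IsUnit (G i i)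
  · obtain ⟨i, hi⟩ := hall
    obtain ⟨j, hij, hu⟩ := key G hdet i hi
    exact ⟨1, by simp, i, j, hij, by simpa using hu⟩
  push Not at hall
  obtain ⟨i, j, hij⟩ := exists_pair_ne ι
  by_cases hu : IsUnit (G i i * G j j - G i j * G i j)
  · exact ⟨1, by simp, i, j, hij, by simpa using hu⟩
  obtain ⟨v, hv⟩ := (hall i).exists_right_inv
  -- otherwise clearing the entry `(i, j)` makes the `j`-th diagonal entry a nonunit
  let g := Matrix.transvection i j (-(v * G i j))
  have hg : g.det = 1 := Matrix.det_transvection_of_ne i j hij _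
  have hjj : (g.transpose * G * g) j j = v * (G i i * G j j - G i j * G i j) := by
    have hji : G j i = G i j := hG.apply i j
    simp only [g, Matrix.transvection, Matrix.transpose_add, Matrix.transpose_one,
      Matrix.transpose_single, Matrix.add_mul, Matrix.mul_add, Matrix.one_mul, Matrix.mul_one,
      Matrix.add_apply, Matrix.mul_single_apply_same, Matrix.single_mul_apply_same, hji]
    linear_combination (G i j * G i j * v - G j j) * hv
  obtain ⟨l, hjl, hu'⟩ := key (g.transpose * G * g)
    (by rw [Matrix.det_mul, Matrix.det_mul, Matrix.det_transpose, hg]; simpa using hdet) j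
    (by rw [hjj]; exact fun h0 => hu (isUnit_of_mul_isUnit_right h0))
  exact ⟨g, by rw [hg]; exact isUnit_one, j, l, hjl, hu'⟩

/-- The Schur complement: over any ring, a block of unit determinant splits off. -/
theorem exists_splitting (h : IsPerfectForm e B) (T : Matrix (ι ⊕ κ) (ι ⊕ κ) R)
    (hu : IsUnit (T + T.transpose).toBlocks₁₁.det) :
    ∃ T₂ : Matrix κ κ R, (T + T.transpose).det =
        (T.toBlocks₁₁ + T.toBlocks₁₁.transpose).det * (T₂ + T₂.transpose).det ∧
      quadSum e B T = quadSum e B T.toBlocks₁₁ * quadSum e B T₂ := by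
  set G := T + T.transpose with hG
  have hGs : G.IsSymm := by
    rw [Matrix.IsSymm, hG, Matrix.transpose_add, Matrix.transpose_transpose, add_comm]
  set P := G.toBlocks₁₁
  set X := G.toBlocks₁₂
  let g : Matrix (ι ⊕ κ) (ι ⊕ κ) R := Matrix.fromBlocks 1 (-(P⁻¹ * X)) 0 1
  have hg : g.det = 1 := by simp [g]
  set T' := g.transpose * T * g with hT'
  have hG' : T' + T'.transpose = g.transpose * G * g := by
    simp only [hT', hG, Matrix.transpose_mul, Matrix.transpose_transpose, Matrix.mul_add,
      Matrix.add_mul, Matrix.mul_assoc]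
  have h11 : T'.toBlocks₁₁ = T.toBlocks₁₁ := by
    rw [hT', ← Matrix.fromBlocks_toBlocks T]
    simp [g, Matrix.fromBlocks_transpose, Matrix.fromBlocks_multiply]
  have h12 : (g.transpose * G * g).toBlocks₁₂ = 0 := by
    rw [← Matrix.fromBlocks_toBlocks G]
    simp only [g, Matrix.fromBlocks_transpose, Matrix.fromBlocks_multiply,
      Matrix.toBlocks_fromBlocks₁₂, Matrix.transpose_one, Matrix.transpose_zero, Matrix.one_mul,
      Matrix.zero_mul, add_zero, Matrix.mul_one]
    change P * -(P⁻¹ * X) + X = 0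
    rw [Matrix.mul_neg, ← Matrix.mul_assoc, Matrix.mul_nonsing_inv _ hu, Matrix.one_mul,
      neg_add_cancel]
  have h12' : ∀ i j, T' (Sum.inl i) (Sum.inr j) + T' (Sum.inr j) (Sum.inl i) = 0 := fun i j => by
    have := congrFun (congrFun h12 i) j
    rw [← hG'] at this
    exact this
  have hblocks : T' + T'.transpose = Matrix.fromBlocks (T.toBlocks₁₁ + T.toBlocks₁₁.transpose) 0 0
      (T'.toBlocks₂₂ + T'.toBlocks₂₂.transpose) := by
    rw [← h11]
    ext (i | i) (j | j)
    · rfl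
    · exact h12' i j
    · simpa [add_comm] using h12' j i
    · rfl
  refine ⟨T'.toBlocks₂₂, ?_, ?_⟩
  · rw [← Matrix.det_fromBlocks_zero₁₂, ← hblocks, hG', Matrix.det_mul, Matrix.det_mul,
      Matrix.det_transpose, hg]
    simp
  · rw [← quadSum_fromBlocks, ← quadSum_conj (by rw [hg]; exact isUnit_one) T, ← hT', ← h11]
    refine quadSum_congr h ?_ ?_
    · rintro (i | i) <;> rfl
    · rintro (i | i) (j | j) -
      · rfl
      · simpa using h12' i j
      · simpa [add_comm] using h12' j i
      · rfl

open IsLocalRing in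
/-- The sum of a quadratic form of unit determinant in `2k` variables over a finite local ring.
Here `sgn` is any quadratic character of the units whose value at the discriminant of a binary form
tells whether the form is isotropic over the residue field. -/
theorem quadSum_local [IsLocalRing R] [Finite R] (h : IsPerfectForm e B) (sgn : Rˣ →* ℤˣ)
    (hsgn : ∀ (a b c : R) (u : Rˣ), (u : R) = b ^ 2 - 4 * a * c → (sgn u = 1 ↔
      ∃ x y, (IsUnit x ∨ IsUnit y) ∧ ¬ IsUnit (a * x ^ 2 + b * x * y + c * y ^ 2)))
    {f : ℕ} (hf : Nat.card Y = Nat.card (ResidueField R) ^ f) {k : ℕ}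
    (hι : Fintype.card ι = 2 * k) (T : Matrix ι ι R) (u : Rˣ)
    (hu : (u : R) = (-1) ^ k * (T + T.transpose).det) :
    quadSum e B T = (((sgn u : ℤˣ) : ℤ) : ℂ) ^ f * (Nat.card Y : ℂ) ^ k := by
  classical
  induction k generalizing ι u with
  | zero =>
    have : IsEmpty ι := Fintype.card_eq_zero_iff.mp (by simpa using hι)
    have hu1 : u = 1 := Units.ext (by simpa using hu)
    simp [quadSum, hu1]
  | succ k ih =>
    have : Nontrivial ι := Fintype.one_lt_card_iff_nontrivial.mp (by lia)
    have hdet : IsUnit (T + T.transpose).det := by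
      have := u.isUnit
      rw [hu] at this
      exact isUnit_of_mul_isUnit_right this
    have hsymm : ∀ M : Matrix ι ι R, (M + M.transpose).IsSymm := fun M => by
      rw [Matrix.IsSymm, Matrix.transpose_add, Matrix.transpose_transpose, add_comm]
    obtain ⟨g, hg, i, j, hij, hmin⟩ := exists_isUnit_minor (hsymm T) hdet
    set T' := g.transpose * T * g with hT'
    have hG' : g.transpose * (T + T.transpose) * g = T' + T'.transpose := by
      simp only [hT', Matrix.transpose_mul, Matrix.transpose_transpose, Matrix.mul_add,
        Matrix.add_mul, Matrix.mul_assoc]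
    rw [hG'] at hmin
    let κ := {x : ι // x ≠ i ∧ x ≠ j}
    let σ : Fin 2 ⊕ κ ≃ ι := Equiv.ofBijective (Sum.elim ![i, j] Subtype.val) (by
      constructor
      · rintro (x | x) (y | y) hxy
        · fin_cases x <;> fin_cases y <;> simp_all
        · fin_cases x
          · exact absurd hxy.symm y.2.1
          · exact absurd hxy.symm y.2.2
        · fin_cases y
          · exact absurd hxy x.2.1
          · exact absurd hxy x.2.2
        · exact congrArg Sum.inr (Subtype.ext hxy)
      · intro x
        by_cases hxi : x = i
        · exact ⟨Sum.inl 0, hxi.symm⟩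
        by_cases hxj : x = j
        · exact ⟨Sum.inl 1, hxj.symm⟩
        exact ⟨Sum.inr ⟨x, hxi, hxj⟩, rfl⟩)
    have hcard : Fintype.card κ = 2 * k := by
      have := Fintype.card_congr σ
      rw [Fintype.card_sum, Fintype.card_fin, hι] at this
      lia
    let T'' := T'.submatrix σ σ
    have hT'' : T'' + T''.transpose = (T' + T'.transpose).submatrix σ σ := rfl
    have hdetP : (T'' + T''.transpose).toBlocks₁₁.det =
        (T' + T'.transpose) i i * (T' + T'.transpose) j j -
        (T' + T'.transpose) i j * (T' + T'.transpose) i j := by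
      rw [Matrix.det_fin_two]
      have hji : (T' + T'.transpose) j i = (T' + T'.transpose) i j := (hsymm T').apply i j
      change (T' + T'.transpose) i i * (T' + T'.transpose) j j -
        (T' + T'.transpose) i j * (T' + T'.transpose) j i = _
      rw [hji]
    obtain ⟨T₂, hsplit, hquad⟩ := exists_splitting h T'' (by rw [hdetP]; exact hmin)
    set a := T' i i
    set b := T' i j + T' j i
    set c := T' j j
    have hP : (T''.toBlocks₁₁ + T''.toBlocks₁₁.transpose).det = -(b ^ 2 - 4 * a * c) := by
      rw [Matrix.det_fin_two]
      change (T' i i + T' i i) * (T' j j + T' j j) - (T' i j + T' j i) * (T' j i + T' i j) = _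
      ring
    have hdisc : IsUnit (b ^ 2 - 4 * a * c) := by
      have : IsUnit (T''.toBlocks₁₁ + T''.toBlocks₁₁.transpose).det := by
        change IsUnit (T'' + T''.transpose).toBlocks₁₁.det
        rw [hdetP]; exact hmin
      rw [hP] at this
      exact IsUnit.neg_iff _ |>.mp this
    have hdetall : (T'' + T''.transpose).det = g.det ^ 2 * (T + T.transpose).det := by
      rw [hT'', Matrix.det_submatrix_equiv_self, ← hG', Matrix.det_mul, Matrix.det_mul,
        Matrix.det_transpose]
      ring
    obtain ⟨γ, hγ⟩ := hg
    obtain ⟨δ, hδ⟩ := hdisc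
    let u₂ : Rˣ := δ⁻¹ * γ ^ 2 * u
    have hu₂ : (u₂ : R) = (-1) ^ k * (T₂ + T₂.transpose).det := by
      have h1 : (δ : R) * u₂ = γ ^ 2 * u := by
        rw [← Units.val_mul]; simp [u₂, mul_assoc]
      apply δ.isUnit.mul_right_injective
      simp only
      rw [h1, hu, hγ, pow_succ]
      rw [hdetall, hP, ← hδ] at hsplit
      linear_combination (-1) ^ k * (-1) * hsplit
    have huu : sgn u = sgn δ * sgn u₂ := by
      simp only [u₂, map_mul, map_inv, map_pow, Int.units_sq, mul_one, mul_inv_cancel_left]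
    rw [← quadSum_conj ⟨γ, hγ⟩ T, ← hT', ← quadSum_submatrix σ T', hquad, ih hcard T₂ u₂ hu₂,
      quadSum_fin_two h]
    change planeSum e B a b c * _ = _
    have hs := hsgn a b c δ hδ
    rw [planeSum_local (ε := ((sgn δ : ℤˣ) : ℤ)) ⟨δ, hδ⟩ (fun hi => by rw [hs.mpr hi]; simp)
      (fun hi => by
        rw [(Int.units_eq_one_or _).resolve_left (mt hs.mp hi)]; simp) h hf, huu]
    push_cast
    ring

end QuadSum
end HilbertSiegel

/-! ### Modules over Dedekind domains -/

namespace HilbertSiegel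

section PrimePower

variable {R : Type*} [CommRing R] (p : Ideal R) [hp : p.IsMaximal] {n : ℕ}

theorem isUnit_mk_pow_iff (hn : n ≠ 0) (a : R) :
    IsUnit (Ideal.Quotient.mk (p ^ n) a) ↔ a ∉ p := by
  constructor
  · intro hu ha
    obtain ⟨b, hb⟩ := hu.exists_right_inv
    obtain ⟨b, rfl⟩ := Ideal.Quotient.mk_surjective b
    rw [← map_mul, ← map_one (Ideal.Quotient.mk (p ^ n)), Ideal.Quotient.eq] at hb
    have h1 := Ideal.sub_mem _ (Ideal.mul_mem_right b p ha) (Ideal.pow_le_self hn hb)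
    rw [sub_sub_cancel] at h1
    exact hp.ne_top ((Ideal.eq_top_iff_one _).mpr h1)
  · intro ha
    have h1 : Ideal.span {a} ⊔ p = ⊤ := by
      by_contra hne
      have := hp.eq_of_le hne le_sup_right
      exact ha (this ▸ Ideal.mem_sup_left (Ideal.mem_span_singleton_self a))
    have h2 : Ideal.span {a} ⊔ p ^ n = ⊤ := Ideal.sup_pow_eq_top h1
    obtain ⟨x, hx, y, hy, hxy⟩ := Submodule.mem_sup.mp ((Ideal.eq_top_iff_one _).mp h2)
    obtain ⟨b, rfl⟩ := Ideal.mem_span_singleton'.mp hx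
    refine IsUnit.of_mul_eq_one_right (Ideal.Quotient.mk (p ^ n) b) ?_
    rw [← map_mul, ← map_one (Ideal.Quotient.mk (p ^ n)), Ideal.Quotient.eq, ← hxy,
      sub_add_cancel_left]
    exact Ideal.neg_mem_iff _ |>.mpr hy

theorem isLocalRing_quotient_pow (hn : n ≠ 0) : IsLocalRing (R ⧸ p ^ n) := by
  have : Nontrivial (R ⧸ p ^ n) := Ideal.Quotient.nontrivial_iff.mpr fun h0 =>
    hp.ne_top (top_le_iff.mp (h0 ▸ Ideal.pow_le_self hn))
  refine IsLocalRing.of_nonunits_add fun a b ha hb => ?_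
  obtain ⟨a, rfl⟩ := Ideal.Quotient.mk_surjective a
  obtain ⟨b, rfl⟩ := Ideal.Quotient.mk_surjective b
  rw [mem_nonunits_iff, isUnit_mk_pow_iff p hn, not_not] at ha hb
  rw [← map_add, mem_nonunits_iff, isUnit_mk_pow_iff p hn, not_not]
  exact p.add_mem ha hb

theorem card_residueField_quotient_pow (hn : n ≠ 0) [IsLocalRing (R ⧸ p ^ n)] :
    Nat.card (IsLocalRing.ResidueField (R ⧸ p ^ n)) = Nat.card (R ⧸ p) := by
  let φ := (IsLocalRing.residue (R ⧸ p ^ n)).comp (Ideal.Quotient.mk (p ^ n))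
  have hφ : Function.Surjective φ :=
    IsLocalRing.residue_surjective.comp Ideal.Quotient.mk_surjective
  have hker : RingHom.ker φ = p := by
    ext a
    rw [RingHom.mem_ker, RingHom.comp_apply, IsLocalRing.residue_eq_zero_iff,
      IsLocalRing.mem_maximalIdeal, mem_nonunits_iff, isUnit_mk_pow_iff p hn, not_not]
  exact Nat.card_congr ((RingHom.quotientKerEquivOfSurjective hφ).symm.trans
    (Ideal.quotEquivOfEq hker)).toEquiv

/-- A sign `s`, defined for elements outside the prime `p`, which is multiplicative, depends only on
residue classes modulo `p ^ n`, and whose value at the discriminant of a binary quadratic form tells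
whether the form is isotropic modulo `p`. -/
structure IsDiscriminantSign (p : Ideal R) (n : ℕ) (s : R → ℤˣ) : Prop where
  map_mul : ∀ a b, a ∉ p → b ∉ p → s (a * b) = s a * s b
  congr : ∀ a b, a ∉ p → a - b ∈ p ^ n → s a = s b
  disc : ∀ a b c, b ^ 2 - 4 * a * c ∉ p → (s (b ^ 2 - 4 * a * c) = 1 ↔
    ∃ x y, (x ∉ p ∨ y ∉ p) ∧ a * x ^ 2 + b * x * y + c * y ^ 2 ∈ p)

variable {p} {Y W : Type*} [AddCommGroup Y] [Module R Y] [AddCommGroup W] [Module R W]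
  {e : AddChar W ℂ} {B : Y →ₗ[R] Y →ₗ[R] W}

/-- The sum of a quadratic form of determinant prime to `p` over a module that is killed by a power
of `p`. -/
theorem quadSum_primePower (hn : n ≠ 0) [Finite (R ⧸ p ^ n)] [Fintype Y] (h : IsPerfectForm e B)
    (hY : Module.IsTorsionBySet R Y (p ^ n : Ideal R)) {s : R → ℤˣ} (hs : IsDiscriminantSign p n s)
    {f : ℕ} (hf : Nat.card Y = Nat.card (R ⧸ p) ^ f) {ι : Type*} [Fintype ι] [DecidableEq ι] {k : ℕ}
    (hι : Fintype.card ι = 2 * k) (T : Matrix ι ι R)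
    (hT : (-1) ^ k * (T + T.transpose).det ∉ p) :
    quadSum e B T = (((s ((-1) ^ k * (T + T.transpose).det) : ℤˣ) : ℤ) : ℂ) ^ f *
      (Nat.card Y : ℂ) ^ k := by
  have := isLocalRing_quotient_pow p hn
  let mk := Ideal.Quotient.mk (p ^ n)
  have hsurj : Function.Surjective mk := Ideal.Quotient.mk_surjective
  let lift : R ⧸ p ^ n → R := Function.surjInv hsurj
  have hlift : ∀ x, mk (lift x) = x := Function.surjInv_eq hsurj
  have hunit : ∀ x : R, IsUnit (mk x) ↔ x ∉ p := isUnit_mk_pow_iff p hn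
  have hliftu : ∀ u : (R ⧸ p ^ n)ˣ, lift u ∉ p := fun u => by
    rw [← hunit, hlift]; exact u.isUnit
  have hcong : ∀ a b, a ∉ p → mk a = mk b → s a = s b := fun a b ha hab =>
    hs.congr a b ha (Ideal.Quotient.eq.mp hab)
  have hpmul : ∀ a b, a ∉ p → b ∉ p → a * b ∉ p := fun a b ha hb hab =>
    (hp.isPrime.mem_or_mem hab).elim ha hb
  let sgn : (R ⧸ p ^ n)ˣ →* ℤˣ := MonoidHom.mk' (fun u => s (lift u)) fun u v => by
    rw [← hs.map_mul _ _ (hliftu u) (hliftu v)]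
    refine hcong _ _ (hliftu _) ?_
    rw [map_mul, hlift, hlift, hlift, Units.val_mul]
  have hsgn : ∀ (u : (R ⧸ p ^ n)ˣ) (a : R), (u : R ⧸ p ^ n) = mk a → sgn u = s a := fun u a hua =>
    hcong _ _ (hliftu u) (by rw [hlift, hua])
  let _ : Module (R ⧸ p ^ n) Y := hY.module
  have : IsScalarTower R (R ⧸ p ^ n) Y := hY.isScalarTower
  have hdisc : ∀ (a b c : R ⧸ p ^ n) (u : (R ⧸ p ^ n)ˣ), (u : R ⧸ p ^ n) = b ^ 2 - 4 * a * c →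
      (sgn u = 1 ↔ ∃ x y, (IsUnit x ∨ IsUnit y) ∧
        ¬ IsUnit (a * x ^ 2 + b * x * y + c * y ^ 2)) := by
    intro a b c u hu
    obtain ⟨a, rfl⟩ := hsurj a
    obtain ⟨b, rfl⟩ := hsurj b
    obtain ⟨c, rfl⟩ := hsurj c
    have h1 : (u : R ⧸ p ^ n) = mk (b ^ 2 - 4 * a * c) := by
      rw [hu]; simp only [map_sub, map_mul, map_pow, map_ofNat]
    rw [hsgn u _ h1, hs.disc _ _ _ (by rw [← hunit, ← h1]; exact u.isUnit)]
    constructor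
    · rintro ⟨x, y, hxy, h0⟩
      refine ⟨mk x, mk y, by rwa [hunit, hunit], ?_⟩
      simp only [← map_mul, ← map_pow, ← map_add]
      rwa [hunit, not_not]
    · rintro ⟨x, y, hxy, h0⟩
      obtain ⟨x, rfl⟩ := hsurj x
      obtain ⟨y, rfl⟩ := hsurj y
      refine ⟨x, y, by rwa [hunit, hunit] at hxy, ?_⟩
      simp only [← map_mul, ← map_pow, ← map_add] at h0
      rwa [hunit, not_not] at h0
  obtain ⟨u, hu⟩ := (hunit _).mpr hT
  have hdet : (u : R ⧸ p ^ n) = (-1) ^ k * (T.map mk + (T.map mk).transpose).det := by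
    rw [hu, map_mul, map_pow, map_neg, map_one, RingHom.map_det, RingHom.mapMatrix_apply,
      Matrix.map_add _ (map_add mk), Matrix.transpose_map]
  rw [← quadSum_quotientForm (p ^ n), quadSum_local (h.quotientForm (p ^ n)) sgn hdisc
    (by rw [hf, card_residueField_quotient_pow p hn]) hι _ u hdet, hsgn u _ hu]

end PrimePower

section Orthogonal

variable {R Y W : Type*} [CommRing R] [AddCommGroup Y] [Module R Y] [AddCommGroup W] [Module R W]
  {e : AddChar W ℂ} {B : Y →ₗ[R] Y →ₗ[R] W}

theorem addChar_sum {A : Type*} [AddCommGroup A] (ψ : AddChar A ℂ) {s : Type*} (t : Finset s)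
    (g : s → A) : ψ (∑ i ∈ t, g i) = ∏ i ∈ t, ψ (g i) := by
  classical
  induction t using Finset.induction_on with
  | empty => simp
  | insert i t hi ih => rw [Finset.sum_insert hi, Finset.prod_insert hi, AddChar.map_add_eq_mul, ih]

/-- The restriction of a bilinear form to a submodule. -/
def restrictForm (B : Y →ₗ[R] Y →ₗ[R] W) (N : Submodule R Y) : N →ₗ[R] N →ₗ[R] W :=
  B.domRestrict₁₂ N N

variable {s : Type*} [Fintype s] [DecidableEq s] {N : s → Submodule R Y}

/-- The bijection between an internal direct sum and the product of the summands. -/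
def internalEquiv (hN : DirectSum.IsInternal N) : (∀ p, N p) ≃ Y :=
  (DFinsupp.equivFunOnFintype (β := fun p => N p)).symm.trans (Equiv.ofBijective _ hN)

theorem internalEquiv_apply (hN : DirectSum.IsInternal N) (y : ∀ p, N p) :
    internalEquiv hN y = ∑ p, (y p : Y) := by
  change DirectSum.coeAddMonoidHom N (DFinsupp.equivFunOnFintype.symm y) = _
  classical
  rw [DirectSum.coeAddMonoidHom_eq_dfinsuppSum, DFinsupp.sum_eq_sum_fintype _ (by simp)]
  rfl

/-- The restriction of a perfect form to an orthogonal direct summand is perfect. -/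
theorem IsPerfectForm.restrictForm (h : IsPerfectForm e B) (hN : DirectSum.IsInternal N)
    (horth : ∀ p q, p ≠ q → ∀ x ∈ N p, ∀ y ∈ N q, B x y = 0) (p : s) :
    IsPerfectForm e (restrictForm B (N p)) where
  primitive := h.primitive
  symm x y := h.symm x y
  nondegenerate x hx := by
    refine Subtype.ext (h.nondegenerate x fun y => ?_)
    obtain ⟨z, rfl⟩ := (internalEquiv hN).surjective y
    rw [internalEquiv_apply, map_sum]
    refine Finset.sum_eq_zero fun q _ => ?_
    by_cases hq : p = q
    · subst hq; exact hx (z p)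
    · exact horth p q hq x x.2 _ (z q).2

/-- The sum is multiplicative over orthogonal direct sums. -/
theorem quadSum_orthogonal [Fintype Y] [∀ p, Fintype (N p)] (hN : DirectSum.IsInternal N)
    (horth : ∀ p q, p ≠ q → ∀ x ∈ N p, ∀ y ∈ N q, B x y = 0)
    {ι : Type*} [Fintype ι] [DecidableEq ι] (T : Matrix ι ι R) :
    quadSum e B T = ∏ p, quadSum e (restrictForm B (N p)) T := by
  unfold quadSum
  rw [Finset.prod_univ_sum, Fintype.piFinset_univ,
    ← Equiv.sum_comp (((Equiv.piComm fun (p : s) (_ : ι) => N p)).trans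
      (Equiv.piCongrRight fun _ => internalEquiv hN))]
  refine Finset.sum_congr rfl fun y _ => ?_
  rw [← addChar_sum]
  congr 1
  conv_rhs => rw [Finset.sum_comm]
  refine Finset.sum_congr rfl fun i _ => ?_
  conv_rhs => rw [Finset.sum_comm]
  refine Finset.sum_congr rfl fun j _ => ?_
  rw [← Finset.smul_sum]
  congr 1
  simp only [Equiv.trans_apply, Equiv.piCongrRight_apply, Pi.map_apply, internalEquiv_apply,
    map_sum, LinearMap.sum_apply]
  refine Finset.sum_congr rfl fun p _ => ?_
  exact Finset.sum_eq_single p (fun q _ hq => horth q p hq _ (y q i).2 _ (y p j).2) (by simp)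

/-- Vectors killed by comaximal ideals are orthogonal. -/
theorem form_eq_zero_of_coprime {I J : Ideal R} (hIJ : I ⊔ J = ⊤) {x y : Y}
    (hx : x ∈ Submodule.torsionBySet R Y I) (hy : y ∈ Submodule.torsionBySet R Y J) :
    B x y = 0 := by
  obtain ⟨a, ha, b, hb, hab⟩ := Submodule.mem_sup.mp ((Ideal.eq_top_iff_one _).mp hIJ)
  have h1 : a • B x y = 0 := by
    rw [← LinearMap.smul_apply, ← map_smul, (Submodule.mem_torsionBySet_iff _ _).mp hx ⟨a, ha⟩,
      map_zero, LinearMap.zero_apply]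
  have h2 : b • B x y = 0 := by
    rw [← map_smul, (Submodule.mem_torsionBySet_iff _ _).mp hy ⟨b, hb⟩, map_zero]
  rw [← one_smul R (B x y), ← hab, add_smul, h1, h2, add_zero]

end Orthogonal

section Dedekind

open UniqueFactorizationMonoid

variable {R : Type*} [CommRing R] [IsDedekindDomain R] {Y W : Type*} [AddCommGroup Y] [Module R Y]
  [AddCommGroup W] [Module R W] {e : AddChar W ℂ} {B : Y →ₗ[R] Y →ₗ[R] W}

/-- The sum over a finite module over a Dedekind domain, as a product over the primes dividing an
annihilator `J`. -/
theorem quadSum_dedekind [Fintype Y] (h : IsPerfectForm e B) {J : Ideal R} (hJ : J ≠ ⊥)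
    (hY : Module.IsTorsionBySet R Y J)
    (hfin : ∀ I : Ideal R, I ≠ ⊥ → Finite (R ⧸ I)) (s : Ideal R → R → ℤˣ)
    (hs : ∀ p ∈ factors J, IsDiscriminantSign p ((factors J).count p) (s p)) (f : Ideal R → ℕ)
    (hf : ∀ p ∈ factors J, Nat.card (Submodule.torsionBySet R Y (p ^ (factors J).count p : Ideal R)) =
      Nat.card (R ⧸ p) ^ f p)
    {ι : Type*} [Fintype ι] [DecidableEq ι] {k : ℕ} (hι : Fintype.card ι = 2 * k)
    (T : Matrix ι ι R) (hT : ∀ p ∈ factors J, (-1) ^ k * (T + T.transpose).det ∉ p) :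
    quadSum e B T = (∏ p ∈ (factors J).toFinset,
      (((s p ((-1) ^ k * (T + T.transpose).det) : ℤˣ) : ℤ) : ℂ) ^ f p) *
        ((∏ p ∈ (factors J).toFinset, Nat.card (R ⧸ p) ^ f p : ℕ) : ℂ) ^ k := by
  have hN := Submodule.isInternal_prime_power_torsion_of_is_torsion_by_ideal hJ hY
  have hprime : ∀ p ∈ factors J, Prime p := fun p hp => prime_of_factor p hp
  have horth : ∀ p q : (factors J).toFinset, p ≠ q →
      ∀ x ∈ Submodule.torsionBySet R Y (p ^ (factors J).count ↑p : Ideal R),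
      ∀ y ∈ Submodule.torsionBySet R Y (q ^ (factors J).count ↑q : Ideal R), B x y = 0 := by
    intro p q hpq x hx y hy
    have h1 := hprime p (Multiset.mem_toFinset.mp p.2)
    have h2 := hprime q (Multiset.mem_toFinset.mp q.2)
    have : (p : Ideal R).IsMaximal := (Ideal.isPrime_of_prime h1).isMaximal h1.ne_zero
    have : (q : Ideal R).IsMaximal := (Ideal.isPrime_of_prime h2).isMaximal h2.ne_zero
    refine form_eq_zero_of_coprime ?_ hx hy
    exact Ideal.pow_sup_pow_eq_top (Ideal.IsMaximal.coprime_of_ne ‹_› ‹_›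
      fun h0 => hpq (Subtype.ext h0))
  have := fun p : (factors J).toFinset =>
    Fintype.ofFinite (Submodule.torsionBySet R Y (p ^ (factors J).count ↑p : Ideal R))
  rw [quadSum_orthogonal hN horth, ← Finset.prod_coe_sort (factors J).toFinset,
    ← Finset.prod_coe_sort (factors J).toFinset, Nat.cast_prod,
    ← Finset.prod_pow, ← Finset.prod_mul_distrib]
  refine Finset.prod_congr rfl fun p _ => ?_
  have hpm := Multiset.mem_toFinset.mp p.2
  have h1 := hprime p hpm
  have : (p : Ideal R).IsMaximal := (Ideal.isPrime_of_prime h1).isMaximal h1.ne_zero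
  have := hfin ((p : Ideal R) ^ (factors J).count ↑p) (pow_ne_zero _ h1.ne_zero)
  rw [quadSum_primePower (Multiset.count_ne_zero.mpr hpm) (h.restrictForm hN horth p)
    (Submodule.torsionBySet_isTorsionBySet _) (hs p hpm) (hf p hpm) hι T (hT p hpm), hf p hpm]

end Dedekind
end HilbertSiegel

/-! ### A case of Hensel's lemma -/

namespace HilbertSiegel

section Hensel

open WithZero Filter Topology

variable {F : Type*} [Field F] [Valued F (WithZero (Multiplicative ℤ))]

local notation "vF" => (Valued.v : Valuation F (WithZero (Multiplicative ℤ)))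

theorem tendsto_zero_of_valuation_le {u : ℕ → F} (hu : ∀ n : ℕ, vF (u n) ≤ exp (-(n : ℤ))) :
    Tendsto u atTop (𝓝 0) := by
  rw [(Valued.hasBasis_nhds_zero F (WithZero (Multiplicative ℤ))).tendsto_right_iff]
  intro γ _
  have hγ : MonoidWithZeroHom.ValueGroup₀.embedding (γ : MonoidWithZeroHom.ValueGroup₀ (.ofClass vF)) ≠ 0 := by
    simp
  obtain ⟨N, hN⟩ : ∃ N : ℕ, exp (-(N : ℤ)) <
      MonoidWithZeroHom.ValueGroup₀.embedding (γ : MonoidWithZeroHom.ValueGroup₀ (.ofClass vF)) := by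
    obtain ⟨z, hz⟩ : ∃ z : ℤ, MonoidWithZeroHom.ValueGroup₀.embedding
        (γ : MonoidWithZeroHom.ValueGroup₀ (.ofClass vF)) = exp z := ⟨_, (exp_log hγ).symm⟩
    refine ⟨(-z).toNat + 1, ?_⟩
    rw [hz, exp_lt_exp]
    push_cast
    have := Int.self_le_toNat (-z)
    omega
  filter_upwards [eventually_ge_atTop N] with n hn
  rw [Valuation.restrict_lt_iff_lt_embedding]
  refine lt_of_le_of_lt ((hu n).trans ?_) hN
  rw [exp_le_exp]
  omega

theorem cauchySeq_of_valuation_le {u : ℕ → F}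
    (hu : ∀ n m : ℕ, n ≤ m → vF (u m - u n) ≤ exp (-(n : ℤ))) : CauchySeq u := by
  refine Valued.cauchy_iff.mpr ⟨inferInstance, fun γ => ?_⟩
  have hγ : MonoidWithZeroHom.ValueGroup₀.embedding
      (γ : MonoidWithZeroHom.ValueGroup₀ (.ofClass vF)) ≠ 0 := by
    simp
  obtain ⟨z, hz⟩ : ∃ z : ℤ, MonoidWithZeroHom.ValueGroup₀.embedding
      (γ : MonoidWithZeroHom.ValueGroup₀ (.ofClass vF)) = exp z := ⟨_, (exp_log hγ).symm⟩
  refine ⟨u '' Set.Ici ((-z).toNat + 1), image_mem_map (mem_atTop _), ?_⟩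
  have key : ∀ n m : ℕ, (-z).toNat + 1 ≤ n → n ≤ m → vF (u m - u n) < exp z := by
    intro n m hn hm
    refine lt_of_le_of_lt (hu n m hm) ?_
    rw [exp_lt_exp]
    have := Int.self_le_toNat (-z)
    omega
  rintro _ ⟨n, hn, rfl⟩ _ ⟨m, hm, rfl⟩
  rw [Valuation.restrict_lt_iff_lt_embedding, hz]
  rcases le_total n m with h | h
  · exact key n m hn h
  · rw [Valuation.map_sub_swap]
    exact key m n hm h

/-- The instance of Hensel's lemma that governs dyadic squares: an approximate root of
`x² + x + s` is refined to a root by iterating the contraction `x ↦ -x² - s`. -/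
theorem exists_root_of_valuation_lt_one [CompleteSpace F] (h2 : vF 2 < 1) {s x₀ : F}
    (hs : vF s ≤ 1) (hx₀ : vF x₀ ≤ 1) (h : vF (x₀ ^ 2 + x₀ + s) < 1) :
    ∃ x : F, x ^ 2 + x + s = 0 := by
  let u : ℕ → F := fun n => Nat.rec x₀ (fun _ x => -x ^ 2 - s) n
  have hu : ∀ n, u (n + 1) = -u n ^ 2 - s := fun n => rfl
  have hint : ∀ n, vF (u n) ≤ 1 := by
    intro n
    induction n with
    | zero => exact hx₀
    | succ n ih =>
      rw [hu]
      refine (Valuation.map_sub _ _ _).trans (max_le ?_ hs)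
      rw [Valuation.map_neg, map_pow]
      exact pow_le_one₀ zero_le ih
  have hlt : ∀ {y : F}, vF y < 1 → vF y ≤ exp (-1 : ℤ) := by
    intro y hy
    rcases eq_or_ne (vF y) 0 with h0 | h0
    · rw [h0]; exact zero_le
    · rw [← exp_log h0] at hy ⊢
      rw [← exp_zero, exp_lt_exp] at hy
      rw [exp_le_exp]
      omega
  have hstep : ∀ n : ℕ, vF (u (n + 1) - u n) ≤ exp (-((n : ℤ) + 1)) := by
    intro n
    induction n with
    | zero =>
      have : u (0 + 1) - u 0 = -(x₀ ^ 2 + x₀ + s) := by rw [hu]; change -x₀ ^ 2 - s - x₀ = _; ring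
      rw [this, Valuation.map_neg]
      exact (hlt h).trans (by simp)
    | succ n ih =>
      have e1 : u (n + 1 + 1) - u (n + 1) = -((u (n + 1) - u n) * ((u (n + 1) - u n) + 2 * u n)) := by
        rw [hu (n + 1), hu n]; ring
      rw [e1, Valuation.map_neg, map_mul]
      have e2 : vF ((u (n + 1) - u n) + 2 * u n) ≤ exp (-1 : ℤ) := by
        refine (Valuation.map_add _ _ _).trans (max_le (ih.trans ?_) ?_)
        · rw [exp_le_exp]; omega
        · rw [map_mul]
          exact (mul_le_mul' (hlt h2) (hint n)).trans (by simp)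
      refine (mul_le_mul' ih e2).trans ?_
      rw [← exp_add, exp_le_exp]
      push_cast
      omega
  have hdiff : ∀ n m : ℕ, n ≤ m → vF (u m - u n) ≤ exp (-(n : ℤ)) := by
    intro n m hm
    induction m, hm using Nat.le_induction with
    | base => simp
    | succ m hm ih =>
      have : u (m + 1) - u n = (u (m + 1) - u m) + (u m - u n) := by ring
      rw [this]
      refine (Valuation.map_add _ _ _).trans (max_le ((hstep m).trans ?_) ih)
      rw [exp_le_exp]
      omega
  obtain ⟨x, hx⟩ := cauchySeq_tendsto_of_complete (cauchySeq_of_valuation_le hdiff)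
  refine ⟨x, ?_⟩
  have t1 : Tendsto (fun n => u n ^ 2 + u n + s) atTop (𝓝 (x ^ 2 + x + s)) :=
    ((hx.pow 2).add hx).add_const s
  have t2 : Tendsto (fun n => u n ^ 2 + u n + s) atTop (𝓝 0) := by
    refine tendsto_zero_of_valuation_le fun n => ?_
    have : u n ^ 2 + u n + s = -(u (n + 1) - u n) := by rw [hu]; ring
    rw [this, Valuation.map_neg]
    refine (hstep n).trans ?_
    rw [exp_le_exp]
    omega
  exact tendsto_nhds_unique t1 t2

end Hensel
end HilbertSiegel

/-! ### The quadratic symbols at the primes of a number field -/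

namespace HilbertSiegel

open IsDedekindDomain HeightOneSpectrum NumberField

section Symbols

variable {K : Type*} [Field K] [NumberField K]

local notation "vK" v:max =>
  (Valued.v : Valuation (HeightOneSpectrum.adicCompletion K v) (WithZero (Multiplicative ℤ)))

theorem valued_algebraMap (v : HeightOneSpectrum (𝓞 K)) (x : K) :
    (vK v) (algebraMap K (v.adicCompletion K) x) = v.valuation K x :=
  valuedAdicCompletion_eq_valuation' v x

theorem valued_algebraMap_lt_one_iff (v : HeightOneSpectrum (𝓞 K)) (y : 𝓞 K) :
    (vK v) (algebraMap K (v.adicCompletion K) y) < 1 ↔ y ∈ v.asIdeal := by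
  rw [valued_algebraMap]
  exact valuation_lt_one_iff_mem v y

theorem valued_algebraMap_eq_one_iff (v : HeightOneSpectrum (𝓞 K)) (y : 𝓞 K) :
    (vK v) (algebraMap K (v.adicCompletion K) y) = 1 ↔ y ∉ v.asIdeal := by
  rw [valued_algebraMap]
  exact valuation_eq_one_iff_notMem v

theorem valued_algebraMap_le_one (v : HeightOneSpectrum (𝓞 K)) (y : 𝓞 K) :
    (vK v) (algebraMap K (v.adicCompletion K) y) ≤ 1 := by
  rw [valued_algebraMap]
  exact valuation_le_one v y

theorem valued_algebraMap_le_exp_iff (v : HeightOneSpectrum (𝓞 K)) (y : 𝓞 K) (n : ℕ) :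
    (vK v) (algebraMap K (v.adicCompletion K) y) ≤ WithZero.exp (-(n : ℤ)) ↔
      y ∈ v.asIdeal ^ n := by
  rw [valued_algebraMap]
  rw [show v.valuation K (y : K) = v.intValuation y from valuation_of_algebraMap v y]
  exact intValuation_le_pow_iff_mem v y n

/-- Elements of the completed integer ring are congruent to elements of `𝓞 K` modulo the
maximal ideal. -/
theorem exists_integer_valued_sub_lt_one (v : HeightOneSpectrum (𝓞 K)) (t : v.adicCompletion K)
    (ht : (vK v) t ≤ 1) :
    ∃ y : 𝓞 K, (vK v) (algebraMap K (v.adicCompletion K) y - t) < 1 := by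
  have hopen : {x : v.adicCompletion K | (vK v) (x - t) < 1} ∈ nhds t := by
    rw [Valued.mem_nhds]
    refine ⟨1, fun x hx => ?_⟩
    have := (Valuation.restrict_lt_iff_lt_embedding _).mp hx
    simpa using this
  obtain ⟨κ, hκ⟩ := (denseRange_algebraMap K v).exists_mem_open isOpen_interior
    ⟨t, mem_interior_iff_mem_nhds.mpr hopen⟩
  have hκ' : (vK v) (algebraMap K (v.adicCompletion K) κ - t) < 1 :=
    (interior_subset : interior {x : v.adicCompletion K | (vK v) (x - t) < 1} ⊆ _) hκ
  have hκ1 : v.valuation K κ ≤ 1 := by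
    rw [← valued_algebraMap]
    have : algebraMap K (v.adicCompletion K) κ = (algebraMap K (v.adicCompletion K) κ - t) + t := by
      ring
    rw [this]
    exact (Valuation.map_add _ _ _).trans (max_le hκ'.le ht)
  obtain ⟨y, hy⟩ := exists_valuation_sub_lt_of_integer v hκ1 1
  refine ⟨y, ?_⟩
  have e : algebraMap K (v.adicCompletion K) (y : K) - t =
      algebraMap K (v.adicCompletion K) ((y : K) - κ) +
        (algebraMap K (v.adicCompletion K) κ - t) := by
    rw [map_sub]; ring
  rw [e]
  refine (Valuation.map_add _ _ _).trans_lt (max_lt ?_ hκ')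
  rw [valued_algebraMap]
  simpa using hy

theorem valued_two_lt_one {v : HeightOneSpectrum (𝓞 K)} (h : (2 : 𝓞 K) ∈ v.asIdeal) :
    (vK v) 2 < 1 := by
  have := (valued_algebraMap_lt_one_iff v 2).mpr h
  rwa [show ((2 : 𝓞 K) : K) = 2 from map_ofNat _ _, map_ofNat] at this

theorem valued_four_ne_zero (v : HeightOneSpectrum (𝓞 K)) : (vK v) 4 ≠ 0 := by
  have : (vK v) (algebraMap K (v.adicCompletion K) 4) ≠ 0 := by
    rw [valued_algebraMap]
    exact (Valuation.ne_zero_iff _).mpr (by norm_num)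
  rwa [map_ofNat] at this

/-- An element whose value under a monic integral quadratic polynomial is integral is integral. -/
theorem valued_le_one_of_quadratic {F : Type*} [Field F]
    [Valued F (WithZero (Multiplicative ℤ))] {s t : F}
    (hs : (Valued.v : Valuation F (WithZero (Multiplicative ℤ))) s ≤ 1)
    (h : (Valued.v : Valuation F (WithZero (Multiplicative ℤ))) (t ^ 2 + t + s) ≤ 1) :
    (Valued.v : Valuation F (WithZero (Multiplicative ℤ))) t ≤ 1 := by
  by_contra! ht
  have h1 : (Valued.v : Valuation F (WithZero (Multiplicative ℤ))) (t + s) =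
      (Valued.v : Valuation F (WithZero (Multiplicative ℤ))) t :=
    Valuation.map_add_eq_of_lt_left _ (hs.trans_lt ht)
  have h2 : (Valued.v : Valuation F (WithZero (Multiplicative ℤ))) (t + s) <
      (Valued.v : Valuation F (WithZero (Multiplicative ℤ))) (t ^ 2) := by
    rw [h1, map_pow, sq]
    exact lt_mul_of_one_lt_left (zero_lt_one.trans ht) ht
  have h3 := Valuation.map_add_eq_of_lt_left _ h2
  rw [show t ^ 2 + (t + s) = t ^ 2 + t + s by ring] at h3
  rw [h3, map_pow] at h
  exact absurd h (not_le.mpr (one_lt_pow₀ ht two_ne_zero))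

namespace KroneckerSymbol

variable {v : HeightOneSpectrum (𝓞 K)} (φ : KroneckerSymbol v)

theorem toHom_eq_one_of_sq (u : (v.adicCompletionIntegers K)ˣ) (x : v.adicCompletion K)
    (hx : ((u : v.adicCompletionIntegers K) : v.adicCompletion K) = x ^ 2) : φ.toHom u = 1 := by
  have hu : (vK v) ((u : v.adicCompletionIntegers K) : v.adicCompletion K) = 1 :=
    adicCompletionIntegers.isUnit_iff_valued_eq_one.mp u.isUnit
  have hx1 : (vK v) x = 1 := by
    rw [hx, map_pow] at hu
    exact (pow_eq_one_iff_of_nonneg zero_le two_ne_zero).mp hu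
  have hw : IsUnit (⟨x, hx1.le⟩ : v.adicCompletionIntegers K) :=
    adicCompletionIntegers.isUnit_iff_valued_eq_one.mpr hx1
  have : u = hw.unit ^ 2 := Units.ext (Subtype.ext (by simpa using hx))
  rw [this, map_pow, Int.units_sq]

/-- A dyadic symbol takes the value `1` on a unit `β² (1 - 4 s)` exactly if `t² + t + s` has a root
modulo the maximal ideal: a root lifts by Hensel's lemma and makes the unit a square, and without
a root the quadratic defect is `4 𝒪_𝔓`. -/
theorem toHom_eq_one_iff (h2 : (2 : 𝓞 K) ∈ v.asIdeal) (u : (v.adicCompletionIntegers K)ˣ)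
    {β s : v.adicCompletion K} (hβ : (vK v) β = 1) (hs : (vK v) s ≤ 1)
    (hu : ((u : v.adicCompletionIntegers K) : v.adicCompletion K) = β ^ 2 * (1 - 4 * s)) :
    φ.toHom u = 1 ↔ ∃ t, (vK v) t ≤ 1 ∧ (vK v) (t ^ 2 + t + s) < 1 := by
  have hβ0 : β ≠ 0 := by rintro rfl; simp at hβ
  have h40 : (4 : v.adicCompletion K) ≠ 0 := by
    intro h; exact valued_four_ne_zero v (by rw [h, map_zero])
  have h20 : (2 : v.adicCompletion K) ≠ 0 := by
    intro h; apply h40; rw [show (4 : v.adicCompletion K) = 2 * 2 by norm_num, h, mul_zero]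
  constructor
  · intro h
    by_contra! hcon
    have := φ.map_defect u ?_
    · rw [this] at h
      exact absurd h (by decide)
    · refine le_antisymm ?_ ?_
      · refine (iInf_le _ β).trans ?_
        rw [Submodule.span_singleton_le_iff_mem, Submodule.mem_span_singleton]
        refine ⟨⟨-(s * β ^ 2), ?_⟩, ?_⟩
        · change (vK v) _ ≤ 1
          rw [Valuation.map_neg, map_mul, map_pow, hβ, one_pow, mul_one]
          exact hs
        · change -(s * β ^ 2) * 4 = _
          rw [hu]; ring
      · refine le_iInf fun η => ?_
        rw [Submodule.span_singleton_le_iff_mem, Submodule.mem_span_singleton]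
        -- A square closer to the unit than `4` would have the form `β² (1 + 2t)²` with `t` a root
        -- modulo the maximal ideal.
        have hle : (vK v) 4 ≤ (vK v) (((u : v.adicCompletionIntegers K) :
            v.adicCompletion K) - η ^ 2) := by
          by_contra! hlt
          set t := (η / β - 1) / 2 with ht
          have hη : η = β * (1 + 2 * t) := by
            rw [ht]; field_simp; ring
          have e : ((u : v.adicCompletionIntegers K) : v.adicCompletion K) - η ^ 2 =
              -(4 * (β ^ 2 * (t ^ 2 + t + s))) := by
            rw [hu, hη]; ring
          rw [e, Valuation.map_neg, map_mul, map_mul, map_pow, hβ, one_pow, one_mul] at hlt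
          have hlt' : (vK v) (t ^ 2 + t + s) < 1 := by
            by_contra! hge
            exact absurd hlt (not_lt.mpr (le_mul_of_one_le_right' hge))
          exact absurd hlt' (not_lt.mpr (hcon t (valued_le_one_of_quadratic hs hlt'.le)))
        set ξ := ((u : v.adicCompletionIntegers K) : v.adicCompletion K) - η ^ 2 with hξ
        have hξ0 : ξ ≠ 0 := by
          intro h0
          rw [h0, map_zero] at hle
          exact valued_four_ne_zero v (le_antisymm hle zero_le)
        refine ⟨⟨4 / ξ, ?_⟩, ?_⟩
        · change (vK v) _ ≤ 1
          rw [map_div₀]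
          exact div_le_one_of_le₀ hle zero_le
        · change 4 / ξ * ξ = 4
          field_simp
  · rintro ⟨t, ht, hlt⟩
    obtain ⟨x, hx⟩ := exists_root_of_valuation_lt_one (valued_two_lt_one h2) hs ht hlt
    refine φ.toHom_eq_one_of_sq u (β * (1 + 2 * x)) ?_
    rw [hu]
    linear_combination -4 * β ^ 2 * hx

end KroneckerSymbol

theorem exists_unit_coe (v : HeightOneSpectrum (𝓞 K)) {y : 𝓞 K} (hy : y ∉ v.asIdeal) :
    ∃ u : (v.adicCompletionIntegers K)ˣ, ((u : v.adicCompletionIntegers K) : v.adicCompletion K) =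
      algebraMap K (v.adicCompletion K) y := by
  have h1 := (valued_algebraMap_eq_one_iff v y).mpr hy
  have hw : IsUnit (⟨algebraMap K (v.adicCompletion K) y, h1.le⟩ : v.adicCompletionIntegers K) :=
    adicCompletionIntegers.isUnit_iff_valued_eq_one.mpr h1
  exact ⟨hw.unit, rfl⟩

namespace CharacterChoice

variable {k : ℕ} {L : QuadLattice K k} (c : CharacterChoice L)

theorem symbol_of_two_mem {v : HeightOneSpectrum (𝓞 K)} (h : (2 : 𝓞 K) ∈ v.asIdeal) {y : K}
    (u : (v.adicCompletionIntegers K)ˣ)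
    (hu : ((u : v.adicCompletionIntegers K) : v.adicCompletion K) =
      algebraMap K (v.adicCompletion K) y) : c.symbol v y = (c.phi v h).toHom u := by
  rw [symbol, dif_pos h]
  split_ifs with hex
  · obtain ⟨w, hw, h1⟩ := hex
    have : w = u := by ext; rw [hw, hu]
    rw [← this, h1]
  · rcases Int.units_eq_one_or ((c.phi v h).toHom u) with h1 | h1
    · exact absurd ⟨u, hu, h1⟩ hex
    · exact h1.symm

/-- At a dyadic prime the discriminant `b² - 4ac` is a unit only if `b` is, and then it equals
`b² (1 - 4s)` with `s = ac / b²`; isotropy modulo `𝔓` of the form `a x² + b x y + c y²` amounts to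
the solubility of `t² + t + s = 0` modulo `𝔓`. -/
theorem isDiscriminantSign_symbol_even {v : HeightOneSpectrum (𝓞 K)} (h : (2 : 𝓞 K) ∈ v.asIdeal)
    {n : ℕ} (hn : (4 : 𝓞 K) ∉ v.asIdeal ^ n) :
    IsDiscriminantSign v.asIdeal n (fun y => c.symbol v (y : K)) where
  map_mul a b ha hb := by
    obtain ⟨u, hu⟩ := exists_unit_coe v ha
    obtain ⟨w, hw⟩ := exists_unit_coe v hb
    rw [c.symbol_of_two_mem h u hu, c.symbol_of_two_mem h w hw, ← map_mul]
    refine c.symbol_of_two_mem h (u * w) ?_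
    simp [hu, hw]
  congr a b ha hab := by
    have hn0 : n ≠ 0 := by rintro rfl; simp at hn
    have hb : b ∉ v.asIdeal := fun hb => ha (by
      have := v.asIdeal.add_mem (Ideal.pow_le_self hn0 hab) hb
      simpa using this)
    obtain ⟨u, hu⟩ := exists_unit_coe v ha
    obtain ⟨w, hw⟩ := exists_unit_coe v hb
    rw [c.symbol_of_two_mem h u hu, c.symbol_of_two_mem h w hw]
    set α := algebraMap K (v.adicCompletion K) (a : K) with hα
    set β := algebraMap K (v.adicCompletion K) (b : K) with hβ
    have hα1 : (vK v) α = 1 := (valued_algebraMap_eq_one_iff v a).mpr ha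
    have hβ1 : (vK v) β = 1 := (valued_algebraMap_eq_one_iff v b).mpr hb
    have hβ0 : β ≠ 0 := by intro h0; rw [h0, map_zero] at hβ1; simp at hβ1
    have h40 : (4 : v.adicCompletion K) ≠ 0 := by
      intro h; exact valued_four_ne_zero v (by rw [h, map_zero])
    have hlt : (vK v) (α - β) < (vK v) 4 := by
      have h1 : (vK v) (α - β) ≤ WithZero.exp (-(n : ℤ)) := by
        have := (valued_algebraMap_le_exp_iff v (a - b) n).mpr hab
        simpa [hα, hβ] using this
      have h2 : ¬ (vK v) 4 ≤ WithZero.exp (-(n : ℤ)) := by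
        intro h4
        apply hn
        rw [← valued_algebraMap_le_exp_iff,
          show ((4 : 𝓞 K) : K) = 4 from map_ofNat _ _, map_ofNat]
        exact h4
      exact h1.trans_lt (not_le.mp h2)
    -- `a / b = 1 - 4 s` with `s` in the maximal ideal, so the ratio is a square
    have key : (c.phi v h).toHom (u * w⁻¹) = 1 := by
      refine ((c.phi v h).toHom_eq_one_iff h (u * w⁻¹) (β := 1) (s := -((α - β) / (4 * β)))
        (by simp) ?_ ?_).mpr ⟨0, by simp, ?_⟩
      · rw [Valuation.map_neg, map_div₀, map_mul, hβ1, mul_one]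
        exact div_le_one_of_le₀ hlt.le zero_le
      · have e : (((u * w⁻¹ : (v.adicCompletionIntegers K)ˣ) : v.adicCompletionIntegers K) :
            v.adicCompletion K) * β = α := by
          rw [← hw, ← hu]
          norm_cast
          simp
        rw [eq_div_of_mul_eq hβ0 e]
        field_simp
        ring
      · have : (0 : v.adicCompletion K) ^ 2 + 0 + -((α - β) / (4 * β)) = -((α - β) / (4 * β)) := by
          ring
        rw [this, Valuation.map_neg, map_div₀, map_mul, hβ1, mul_one]
        exact (div_lt_one₀ (zero_lt_iff.mpr (valued_four_ne_zero v))).mpr hlt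
    rw [map_mul, map_inv, mul_inv_eq_one] at key
    exact key
  disc a b e hd := by
    have hb : b ∉ v.asIdeal := by
      intro hb
      apply hd
      have h4 : (4 : 𝓞 K) ∈ v.asIdeal := by
        rw [show (4 : 𝓞 K) = 2 * 2 by norm_num]; exact Ideal.mul_mem_left _ _ h
      rw [show b ^ 2 - 4 * a * e = b * b - (a * e) * 4 by ring]
      exact sub_mem (Ideal.mul_mem_left _ _ hb) (Ideal.mul_mem_left _ _ h4)
    obtain ⟨u, hu⟩ := exists_unit_coe v hd
    rw [c.symbol_of_two_mem h u hu]
    set α := algebraMap K (v.adicCompletion K) (a : K) with hα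
    set β := algebraMap K (v.adicCompletion K) (b : K) with hβ
    set ε := algebraMap K (v.adicCompletion K) (e : K) with hε
    have hβ1 : (vK v) β = 1 := (valued_algebraMap_eq_one_iff v b).mpr hb
    have hα1 : (vK v) α ≤ 1 := valued_algebraMap_le_one v a
    have hε1 : (vK v) ε ≤ 1 := valued_algebraMap_le_one v e
    have hβ0 : β ≠ 0 := by intro h0; rw [h0, map_zero] at hβ1; simp at hβ1
    have hs : (vK v) (α * ε / β ^ 2) ≤ 1 := by
      rw [map_div₀, map_mul, map_pow, hβ1, one_pow, div_one]
      exact mul_le_one' hα1 hε1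
    rw [(c.phi v h).toHom_eq_one_iff h u hβ1 hs (by
      rw [hu]; simp only [map_sub, map_mul, map_pow, map_ofNat, hα, hβ, hε] at hβ0 ⊢; field_simp)]
    constructor
    · rintro ⟨t, ht, hlt⟩
      by_cases ha : a ∈ v.asIdeal
      · refine ⟨1, 0, Or.inl fun h1 => v.isPrime.ne_top ((Ideal.eq_top_iff_one _).mpr h1), ?_⟩
        simpa using ha
      · obtain ⟨τ, hτ⟩ := exists_integer_valued_sub_lt_one v (β * t)
          (by rw [map_mul, hβ1, one_mul]; exact ht)
        -- The isotropic vector is `(bt, a)`, with `bt` replaced by an element of `𝓞 K` congruent to it.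
        refine ⟨τ, a, Or.inr ha, ?_⟩
        rw [show a * τ ^ 2 + b * τ * a + e * a ^ 2 = a * (τ ^ 2 + b * τ + a * e) by ring]
        refine Ideal.mul_mem_left _ _ ((valued_algebraMap_lt_one_iff v _).mp ?_)
        set T := algebraMap K (v.adicCompletion K) (τ : K) with hT
        have hT1 : (vK v) T ≤ 1 := valued_algebraMap_le_one v τ
        have e1 : algebraMap K (v.adicCompletion K) ((τ ^ 2 + b * τ + a * e : 𝓞 K) : K) =
            (T - β * t) * (T + β * t + β) + β ^ 2 * (t ^ 2 + t + α * ε / β ^ 2) := by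
          have e2 : algebraMap K (v.adicCompletion K) ((τ ^ 2 + b * τ + a * e : 𝓞 K) : K) =
            T ^ 2 + β * T + α * ε := by simp [hα, hβ, hε, hT]
          rw [e2]
          field_simp
          ring
        rw [e1]
        refine (Valuation.map_add _ _ _).trans_lt (max_lt ?_ ?_)
        · rw [map_mul]
          refine mul_lt_one_of_lt_of_le hτ ?_
          refine (Valuation.map_add _ _ _).trans (max_le ((Valuation.map_add _ _ _).trans
            (max_le hT1 ?_)) hβ1.le)
          rw [map_mul, hβ1, one_mul]
          exact ht
        · rw [map_mul, map_pow, hβ1, one_pow, one_mul]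
          exact hlt
    · rintro ⟨x, y, hxy, hmem⟩
      set X := algebraMap K (v.adicCompletion K) (x : K) with hX
      set Y := algebraMap K (v.adicCompletion K) (y : K) with hY
      have hX1 : (vK v) X ≤ 1 := valued_algebraMap_le_one v x
      by_cases hy : y ∈ v.asIdeal
      · have hx : x ∉ v.asIdeal := hxy.resolve_right (not_not.mpr hy)
        have ha : a ∈ v.asIdeal := by
          have h1 : a * x ^ 2 ∈ v.asIdeal := by
            have h2 : (b * x + e * y) * y ∈ v.asIdeal := Ideal.mul_mem_left _ _ hy
            have := sub_mem hmem h2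
            rwa [show a * x ^ 2 + b * x * y + e * y ^ 2 - (b * x + e * y) * y = a * x ^ 2 by ring]
              at this
          rcases v.isPrime.mem_or_mem h1 with h2 | h2
          · exact h2
          · exact absurd (v.isPrime.mem_of_pow_mem _ h2) hx
        refine ⟨0, by simp, ?_⟩
        have : (0 : v.adicCompletion K) ^ 2 + 0 + α * ε / β ^ 2 = α * ε / β ^ 2 := by ring
        rw [this, map_div₀, map_mul, map_pow, hβ1, one_pow, div_one]
        exact mul_lt_one_of_lt_of_le ((valued_algebraMap_lt_one_iff v a).mpr ha) hε1
      · have hY1 : (vK v) Y = 1 := (valued_algebraMap_eq_one_iff v y).mpr hy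
        have hY0 : Y ≠ 0 := by intro h0; rw [h0, map_zero] at hY1; simp at hY1
        refine ⟨α * X / (β * Y), ?_, ?_⟩
        · rw [map_div₀, map_mul, map_mul, hβ1, hY1, mul_one, div_one]
          exact mul_le_one' hα1 hX1
        · have e1 : (α * X / (β * Y)) ^ 2 + α * X / (β * Y) + α * ε / β ^ 2 =
              α * (α * X ^ 2 + β * X * Y + ε * Y ^ 2) / (β ^ 2 * Y ^ 2) := by
            field_simp
          rw [e1, map_div₀, map_mul, map_mul, map_pow, map_pow, hβ1, hY1, one_pow, mul_one, div_one]
          refine (mul_le_of_le_one_left' hα1).trans_lt ?_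
          have := (valued_algebraMap_lt_one_iff v _).mpr hmem
          simpa [hα, hβ, hε, hX, hY] using this

theorem symbol_eq_one_iff_of_two_notMem {v : HeightOneSpectrum (𝓞 K)} (h : (2 : 𝓞 K) ∉ v.asIdeal)
    (y : 𝓞 K) : c.symbol v (y : K) = 1 ↔ IsSquare (Ideal.Quotient.mk v.asIdeal y) := by
  have key : (∃ z : 𝓞 K, (y : K) - (z : K) ^ 2 ∈ (v.asIdeal : FractionalIdeal (𝓞 K)⁰ K)) ↔
      IsSquare (Ideal.Quotient.mk v.asIdeal y) := by
    constructor
    · rintro ⟨z, hz⟩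
      obtain ⟨x, hx, hxz⟩ := (FractionalIdeal.mem_coeIdeal _).mp hz
      have hx' : x = y - z ^ 2 := by
        apply RingOfIntegers.coe_injective
        rw [hxz]; simp
      refine ⟨Ideal.Quotient.mk v.asIdeal z, ?_⟩
      rw [← map_mul, Ideal.Quotient.eq, ← sq, ← hx']
      exact hx
    · rintro ⟨z, hz⟩
      obtain ⟨z, rfl⟩ := Ideal.Quotient.mk_surjective z
      rw [← map_mul, Ideal.Quotient.eq, ← sq] at hz
      exact ⟨z, (FractionalIdeal.mem_coeIdeal _).mpr ⟨_, hz, by simp⟩⟩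
  rw [symbol, dif_neg h]
  split_ifs with hex
  · exact iff_of_true rfl (key.mp hex)
  · exact iff_of_false (by decide) (mt key.mpr hex)

open Classical in
theorem coe_symbol_eq_quadraticCharFun {v : HeightOneSpectrum (𝓞 K)} (h : (2 : 𝓞 K) ∉ v.asIdeal)
    {y : 𝓞 K} (hy : y ∉ v.asIdeal) :
    ((c.symbol v (y : K) : ℤˣ) : ℤ) = quadraticCharFun (𝓞 K ⧸ v.asIdeal)
      (Ideal.Quotient.mk v.asIdeal y) := by
  have hy0 : Ideal.Quotient.mk v.asIdeal y ≠ 0 := fun h0 => hy (Ideal.Quotient.eq_zero_iff_mem.mp h0)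
  rw [quadraticCharFun, if_neg hy0]
  split_ifs with hsq
  · rw [(c.symbol_eq_one_iff_of_two_notMem h y).mpr hsq]; rfl
  · rcases Int.units_eq_one_or (c.symbol v (y : K)) with h1 | h1
    · exact absurd ((c.symbol_eq_one_iff_of_two_notMem h y).mp h1) hsq
    · rw [h1]; rfl

/-- At an odd prime the discriminant of a binary form is a square modulo `𝔓` exactly if the form is
isotropic modulo `𝔓`, by completion of the square. -/
theorem isDiscriminantSign_symbol_odd {v : HeightOneSpectrum (𝓞 K)} (h : (2 : 𝓞 K) ∉ v.asIdeal)
    {n : ℕ} (hn : n ≠ 0) :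
    IsDiscriminantSign v.asIdeal n (fun y => c.symbol v (y : K)) where
  map_mul a b ha hb := by
    classical
    let : Field (𝓞 K ⧸ v.asIdeal) := @Ideal.Quotient.field _ _ v.asIdeal v.isMaximal
    have : Finite (𝓞 K ⧸ v.asIdeal) := Ideal.finiteQuotientOfFreeOfNeBot _ v.ne_bot
    have : Fintype (𝓞 K ⧸ v.asIdeal) := Fintype.ofFinite _
    have hab : a * b ∉ v.asIdeal := fun hab => (v.isPrime.mem_or_mem hab).elim ha hb
    apply Units.ext
    rw [Units.val_mul, c.coe_symbol_eq_quadraticCharFun h ha, c.coe_symbol_eq_quadraticCharFun h hb,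
      c.coe_symbol_eq_quadraticCharFun h hab, map_mul]
    convert quadraticCharFun_mul (F := 𝓞 K ⧸ v.asIdeal) _ _
  congr a b ha hab := by
    have e : Ideal.Quotient.mk v.asIdeal a = Ideal.Quotient.mk v.asIdeal b :=
      Ideal.Quotient.eq.mpr (Ideal.pow_le_self hn hab)
    have key : c.symbol v (a : K) = 1 ↔ c.symbol v (b : K) = 1 := by
      rw [c.symbol_eq_one_iff_of_two_notMem h, c.symbol_eq_one_iff_of_two_notMem h, e]
    rcases Int.units_eq_one_or (c.symbol v (a : K)) with h1 | h1
    · rw [h1, key.mp h1]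
    · rcases Int.units_eq_one_or (c.symbol v (b : K)) with h2 | h2
      · rw [key.mpr h2, h2]
      · rw [h1, h2]
  disc a b e hd := by
    rw [c.symbol_eq_one_iff_of_two_notMem h]
    have one_notMem : (1 : 𝓞 K) ∉ v.asIdeal := fun h1 =>
      v.isPrime.ne_top ((Ideal.eq_top_iff_one _).mpr h1)
    constructor
    · rintro ⟨z, hz⟩
      obtain ⟨z, rfl⟩ := Ideal.Quotient.mk_surjective z
      rw [← map_mul, Ideal.Quotient.eq] at hz
      by_cases ha : a ∈ v.asIdeal
      · exact ⟨1, 0, Or.inl one_notMem, by simpa using ha⟩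
      · -- a root of the quadratic polynomial, by the formula `(-b + z) / (2a)`
        refine ⟨z - b, 2 * a, Or.inr fun h2 => (v.isPrime.mem_or_mem h2).elim h ha, ?_⟩
        rw [show a * (z - b) ^ 2 + b * (z - b) * (2 * a) + e * (2 * a) ^ 2 =
          -a * (b ^ 2 - 4 * a * e - z * z) by ring]
        exact Ideal.mul_mem_left _ _ hz
    · rintro ⟨x, y, hxy, hmem⟩
      by_cases hy : y ∈ v.asIdeal
      · have hx : x ∉ v.asIdeal := hxy.resolve_right (not_not.mpr hy)
        have ha : a ∈ v.asIdeal := by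
          have h1 : a * x ^ 2 ∈ v.asIdeal := by
            have h2 : (b * x + e * y) * y ∈ v.asIdeal := Ideal.mul_mem_left _ _ hy
            have := sub_mem hmem h2
            rwa [show a * x ^ 2 + b * x * y + e * y ^ 2 - (b * x + e * y) * y = a * x ^ 2 by ring]
              at this
          rcases v.isPrime.mem_or_mem h1 with h2 | h2
          · exact h2
          · exact absurd (v.isPrime.mem_of_pow_mem _ h2) hx
        refine ⟨Ideal.Quotient.mk _ b, ?_⟩
        rw [← map_mul, Ideal.Quotient.eq, show b ^ 2 - 4 * a * e - b * b = (-4 * e) * a by ring]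
        exact Ideal.mul_mem_left _ _ ha
      · let : Field (𝓞 K ⧸ v.asIdeal) := @Ideal.Quotient.field _ _ v.asIdeal v.isMaximal
        have hy0 : Ideal.Quotient.mk v.asIdeal y ≠ 0 :=
          fun h0 => hy (Ideal.Quotient.eq_zero_iff_mem.mp h0)
        refine ⟨Ideal.Quotient.mk _ (2 * a * x + b * y) / Ideal.Quotient.mk _ y, ?_⟩
        rw [div_mul_div_comm, eq_div_iff (mul_ne_zero hy0 hy0), ← map_mul, ← map_mul, ← map_mul,
          Ideal.Quotient.eq]
        rw [show (b ^ 2 - 4 * a * e) * (y * y) - (2 * a * x + b * y) * (2 * a * x + b * y) =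
          (-4 * a) * (a * x ^ 2 + b * x * y + e * y ^ 2) by ring]
        exact Ideal.mul_mem_left _ _ hmem

/-- The symbol at `𝔓` detects, modulo any power of `𝔓` that does not contain `4` if `𝔓 ∣ 2`,
whether a binary quadratic form of unit discriminant is isotropic modulo `𝔓`. -/
theorem isDiscriminantSign_symbol (v : HeightOneSpectrum (𝓞 K)) {n : ℕ} (hn : n ≠ 0)
    (h4 : (2 : 𝓞 K) ∈ v.asIdeal → (4 : 𝓞 K) ∉ v.asIdeal ^ n) :
    IsDiscriminantSign v.asIdeal n (fun y => c.symbol v (y : K)) := by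
  by_cases h : (2 : 𝓞 K) ∈ v.asIdeal
  · exact c.isDiscriminantSign_symbol_even h (h4 h)
  · exact c.isDiscriminantSign_symbol_odd h hn

end CharacterChoice
end Symbols
end HilbertSiegel

/-! ### The order of a cokernel -/

namespace HilbertSiegel

section Length

/-- The order of the cokernel of a matrix over a discrete valuation ring, by the Smith normal
form. -/
theorem card_quotient_range_mulVecLin {V ι : Type*} [CommRing V] [IsDomain V]
    [IsDiscreteValuationRing V] [Fintype ι] [DecidableEq ι] (M : Matrix ι ι V) {ϖ : V}
    (hϖ : Irreducible ϖ) {f : ℕ} (hM : Associated M.det (ϖ ^ f)) :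
    Nat.card ((ι → V) ⧸ LinearMap.range M.mulVecLin) =
      Nat.card (V ⧸ IsLocalRing.maximalIdeal V) ^ f := by
  have hdet : M.det ≠ 0 := fun h0 => pow_ne_zero f hϖ.ne_zero (hM.eq_zero_iff.mp h0)
  set N := LinearMap.range M.mulVecLin with hN
  have hinj : Function.Injective M.mulVecLin := by
    rw [← LinearMap.ker_eq_bot]
    exact Matrix.ker_mulVecLin_eq_bot_iff.mpr fun w hw => by
      by_contra hw0
      exact hdet (Matrix.exists_mulVec_eq_zero_iff.mp ⟨w, hw0, hw⟩)
  let e : (ι → V) ≃ₗ[V] N := LinearEquiv.ofInjective M.mulVecLin hinj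
  let b := Pi.basisFun V ι
  have h : Module.finrank V N = Module.finrank V (ι → V) := e.symm.finrank_eq
  let a := Submodule.smithNormalFormCoeffs b h
  let b' := Submodule.smithNormalFormTopBasis b h
  let ab := Submodule.smithNormalFormBotBasis b h
  have ab_eq := Submodule.smithNormalFormBotBasis_def b h
  let e' : (ι → V) ≃ₗ[V] N := b'.equiv ab (Equiv.refl _)
  have hdiag : LinearMap.det (N.subtype ∘ₗ (e' : (ι → V) →ₗ[V] N)) = ∏ i, a i := by
    rw [← LinearMap.det_toMatrix b', ← Matrix.det_diagonal]
    congr 1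
    ext i j
    rw [LinearMap.toMatrix_apply]
    have : (N.subtype ∘ₗ (e' : (ι → V) →ₗ[V] N)) (b' j) = a j • b' j := by
      change ((b'.equiv ab (Equiv.refl _)) (b' j) : ι → V) = _
      rw [b'.equiv_apply, Equiv.refl_apply]
      exact ab_eq j
    rw [this, map_smul, Module.Basis.repr_self, Finsupp.smul_single, smul_eq_mul, mul_one]
    by_cases hij : i = j
    · rw [hij, Matrix.diagonal_apply_eq, Finsupp.single_eq_same]
    · rw [Matrix.diagonal_apply_ne _ hij, Finsupp.single_eq_of_ne hij]
  have hdetM : LinearMap.det (N.subtype ∘ₗ (e : (ι → V) →ₗ[V] N)) = M.det := by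
    have : N.subtype ∘ₗ (e : (ι → V) →ₗ[V] N) = Matrix.toLin' M := rfl
    rw [this, LinearMap.det_toLin']
  have hassoc : Associated (∏ i, a i) (ϖ ^ f) := by
    rw [← hdiag]
    refine (LinearMap.associated_det_comp_equiv N.subtype e' e).trans ?_
    rw [hdetM]
    exact hM
  have ha : ∀ i, ∃ r : ℕ, Associated (a i) (ϖ ^ r) := fun i =>
    IsDiscreteValuationRing.associated_pow_irreducible
      (Submodule.smithNormalFormCoeffs_ne_zero b h i) hϖ
  choose r hr using ha
  have hsum : ∑ i, r i = f := by
    have h1 : Associated (ϖ ^ ∑ i, r i) (ϖ ^ f) := by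
      rw [← Finset.prod_pow_eq_pow_sum]
      exact (Associated.prod _ _ _ fun i _ => (hr i).symm).trans hassoc
    refine le_antisymm ?_ ?_
    · exact (pow_dvd_pow_iff hϖ.ne_zero hϖ.not_isUnit).mp h1.dvd
    · exact (pow_dvd_pow_iff hϖ.ne_zero hϖ.not_isUnit).mp h1.symm.dvd
  have hcard : ∀ i, Nat.card (V ⧸ Ideal.span {a i}) =
      Nat.card (V ⧸ IsLocalRing.maximalIdeal V) ^ r i := by
    intro i
    have e1 : Ideal.span {a i} = IsLocalRing.maximalIdeal V ^ r i := by
      rw [hϖ.maximalIdeal_eq, Ideal.span_singleton_pow]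
      exact Ideal.span_singleton_eq_span_singleton.mpr (hr i)
    rw [e1]
    exact cardQuot_pow_of_prime (IsDiscreteValuationRing.not_a_field V)
  rw [Nat.card_congr (Submodule.quotientEquivPiSpan N b h).toEquiv, Nat.card_pi]
  rw [← hsum, ← Finset.prod_pow_eq_pow_sum]
  exact Finset.prod_congr rfl fun i _ => hcard i

variable {R Y ι : Type*} [CommRing R] [IsDedekindDomain R] [AddCommGroup Y] [Module R Y]
  [Fintype ι] [DecidableEq ι]

/-- A module `Y` presented, locally at `p`, by a square matrix `M` has `p`-primary part of
order `|R / p| ^ ord_p (det M)`: it is identified with the cokernel of `M` over the local ring at `p`. -/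
theorem card_torsionBySet_of_presentation {p : Ideal R} [hp : p.IsPrime] (hp0 : p ≠ ⊥)
    (M : Matrix ι ι R) {f N : ℕ} (hfN : f ≤ N) (hf : M.det ∈ p ^ f) (hf' : M.det ∉ p ^ (f + 1))
    (g : (ι → R) →ₗ[R] Y) (hg : Function.Surjective g) (hgM : ∀ w, g (M.mulVec w) = 0)
    (hker : ∀ u, g u = 0 → ∃ s ∉ p, ∃ w, s • u = M.mulVec w)
    {J' : Ideal R} (hJ : p ^ N ⊔ J' = ⊤) (hY : ∀ a ∈ p ^ N, ∀ b ∈ J', ∀ y : Y, (a * b) • y = 0) :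
    Nat.card (Submodule.torsionBySet R Y (p ^ N : Ideal R)) = Nat.card (R ⧸ p) ^ f := by
  classical
  have hpm : p.IsMaximal := hp.isMaximal hp0
  let V := Localization.AtPrime p
  have : IsDiscreteValuationRing V :=
    IsLocalization.AtPrime.isDiscreteValuationRing_of_dedekind_domain R hp0 V
  obtain ⟨ϖ, hϖ⟩ := IsDiscreteValuationRing.exists_irreducible V
  have hmax : IsLocalRing.maximalIdeal V = p.map (algebraMap R V) :=
    (Localization.AtPrime.map_eq_maximalIdeal (I := p)).symm
  have hmem : ∀ (m : ℕ) (x : R), algebraMap R V x ∈ IsLocalRing.maximalIdeal V ^ m ↔ x ∈ p ^ m := fun m x => by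
    rw [← IsLocalization.AtPrime.under_maximalIdeal_pow p V m, Ideal.under, Ideal.mem_comap]
  have hunit : ∀ x : R, x ∉ p → IsUnit (algebraMap R V x) := fun x hx =>
    (IsLocalization.AtPrime.isUnit_to_map_iff V p x).mpr hx
  let MV : Matrix ι ι V := M.map (algebraMap R V)
  have hMVdet : MV.det = algebraMap R V M.det := ((algebraMap R V).map_det M).symm
  have hspan : ∀ m : ℕ, IsLocalRing.maximalIdeal V ^ m = Ideal.span {ϖ ^ m} := fun m => by
    rw [hϖ.maximalIdeal_eq, Ideal.span_singleton_pow]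
  have hassoc : Associated MV.det (ϖ ^ f) := by
    have h1 : ϖ ^ f ∣ MV.det := by
      rw [← Ideal.mem_span_singleton, ← hspan, hMVdet, hmem]
      exact hf
    have h2 : ¬ ϖ ^ (f + 1) ∣ MV.det := by
      rw [← Ideal.mem_span_singleton, ← hspan, hMVdet, hmem]
      exact hf'
    have h0 : MV.det ≠ 0 := fun h0 => h2 (h0 ▸ dvd_zero _)
    obtain ⟨r, hr⟩ := IsDiscreteValuationRing.associated_pow_irreducible h0 hϖ
    have h3 : f ≤ r := (pow_dvd_pow_iff hϖ.ne_zero hϖ.not_isUnit).mp (h1.trans hr.dvd)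
    have h4 : ¬ f + 1 ≤ r := fun h => h2 ((pow_dvd_pow ϖ h).trans hr.symm.dvd)
    have : r = f := by omega
    rwa [this] at hr
  have hq : Nat.card (V ⧸ IsLocalRing.maximalIdeal V) = Nat.card (R ⧸ p) := by
    exact (Nat.card_congr (IsLocalization.AtPrime.equivQuotMaximalIdeal p V).toEquiv).symm
  rw [← hq, ← card_quotient_range_mulVecLin MV hϖ hassoc]
  let Q := (ι → V) ⧸ LinearMap.range MV.mulVecLin
  let inc : (ι → R) →ₗ[R] (ι → V) := LinearMap.compLeft (Algebra.linearMap R V) ι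
  have hinc : ∀ w, inc (M.mulVec w) = MV.mulVec (inc w) := fun w => by
    ext i
    exact (RingHom.map_mulVec (algebraMap R V) M w i)
  let φ : (ι → R) →ₗ[R] Q :=
    ((LinearMap.range MV.mulVecLin).mkQ.restrictScalars R) ∘ₗ inc
  have hφ0 : ∀ u, φ u = 0 ↔ ∃ w, MV.mulVec w = inc u := fun u => by
    change (LinearMap.range MV.mulVecLin).mkQ (inc u) = 0 ↔ _
    rw [Submodule.mkQ_apply, Submodule.Quotient.mk_eq_zero]
    rfl
  have hinc_inj : Function.Injective inc := by
    intro u u' huu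
    ext i
    exact IsLocalization.injective V p.primeCompl_le_nonZeroDivisors (congrFun huu i)
  have hdenom : ∀ w : ι → V, ∃ s ∉ p, ∃ u : ι → R, inc u = s • w := by
    intro w
    obtain ⟨s, hs⟩ := IsLocalization.exist_integer_multiples_of_finite p.primeCompl w
    choose u hu using hs
    exact ⟨s, s.2, u, funext hu⟩
  -- the cokernel over `V` is killed by `p ^ N`
  have hkill : ∀ a ∈ p ^ N, ∀ w : ι → V, ∃ w', MV.mulVec w' = a • w := by
    intro a ha w
    obtain ⟨c, hc⟩ : MV.det ∣ algebraMap R V a := by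
      refine hassoc.dvd.trans ?_
      rw [← Ideal.mem_span_singleton, ← hspan, hmem]
      exact Ideal.pow_le_pow_right hfN ha
    refine ⟨c • MV.adjugate.mulVec w, ?_⟩
    rw [Matrix.mulVec_smul, Matrix.mulVec_mulVec, Matrix.mul_adjugate, Matrix.smul_mulVec,
      Matrix.one_mulVec, smul_smul, mul_comm, ← hc, algebraMap_smul]
  -- elements outside `p` are invertible modulo `p ^ N`
  have hsplit : ∀ s ∉ p, ∃ t : R, ∃ a ∈ p ^ N, s * t = 1 + a := by
    intro s hs
    have hu : IsUnit (Ideal.Quotient.mk (p ^ N) s) := by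
      rcases Nat.eq_zero_or_pos N with rfl | hN
      · have : Subsingleton (R ⧸ p ^ 0) := Ideal.Quotient.subsingleton_iff.mpr (by simp)
        exact isUnit_of_subsingleton _
      · exact (isUnit_mk_pow_iff p hN.ne' s).mpr hs
    obtain ⟨t, ht⟩ := hu.exists_right_inv
    obtain ⟨t, rfl⟩ := Ideal.Quotient.mk_surjective t
    refine ⟨t, s * t - 1, ?_, by ring⟩
    rw [← map_mul, ← map_one (Ideal.Quotient.mk (p ^ N)), Ideal.Quotient.eq] at ht
    exact ht
  have hφsurj : Function.Surjective φ := by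
    intro z
    obtain ⟨w, rfl⟩ := Submodule.mkQ_surjective _ z
    obtain ⟨s, hs, u, hu⟩ := hdenom w
    obtain ⟨t, a, ha, hst⟩ := hsplit s hs
    refine ⟨t • u, ?_⟩
    change (LinearMap.range MV.mulVecLin).mkQ (inc (t • u)) = _
    rw [← sub_eq_zero, ← map_sub, Submodule.mkQ_apply, Submodule.Quotient.mk_eq_zero]
    obtain ⟨w', hw'⟩ := hkill a ha w
    refine ⟨w', ?_⟩
    rw [Matrix.mulVecLin_apply, hw', map_smul, hu, smul_smul, mul_comm t s, hst, add_smul, one_smul]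
    abel
  have hle : LinearMap.ker g ≤ LinearMap.ker φ := by
    intro u hu
    obtain ⟨s, hs, w, hw⟩ := hker u hu
    rw [LinearMap.mem_ker, hφ0]
    obtain ⟨s', hs'⟩ := (hunit s hs).exists_right_inv
    refine ⟨s' • inc w, ?_⟩
    rw [Matrix.mulVec_smul, ← hinc, ← hw, map_smul, ← algebraMap_smul V s, smul_smul, mul_comm,
      hs', one_smul]
  let ψ : Y →ₗ[R] Q :=
    (Submodule.liftQ _ φ hle) ∘ₗ (g.quotKerEquivOfSurjective hg).symm.toLinearMap
  have hψ : ∀ u, ψ (g u) = φ u := by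
    intro u
    have : (g.quotKerEquivOfSurjective hg).symm (g u) = Submodule.Quotient.mk u := by
      rw [LinearEquiv.symm_apply_eq]
      rfl
    change Submodule.liftQ _ φ hle ((g.quotKerEquivOfSurjective hg).symm (g u)) = _
    rw [this, Submodule.liftQ_apply]
  refine Nat.card_congr (Equiv.ofBijective
    (ψ ∘ₗ (Submodule.torsionBySet R Y (p ^ N : Ideal R)).subtype) ⟨?_, ?_⟩)
  · refine (injective_iff_map_eq_zero _).mpr ?_
    rintro ⟨y, hy⟩ h0
    rw [Submodule.mem_torsionBySet_iff] at hy
    obtain ⟨u, rfl⟩ := hg y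
    have h0' : φ u = 0 := by rw [← hψ]; exact h0
    obtain ⟨w, hw⟩ := (hφ0 u).mp h0'
    obtain ⟨s, hs, w', hw'⟩ := hdenom w
    have hsu : s • u = M.mulVec w' := by
      apply hinc_inj
      rw [hinc, hw', map_smul, ← hw, Matrix.mulVec_smul]
    obtain ⟨t, a, ha, hst⟩ := hsplit s hs
    have hsg : s • g u = 0 := by rw [← map_smul, hsu, hgM]
    have hag : a • g u = 0 := hy ⟨a, ha⟩
    have : g u = (s * t) • g u - a • g u := by rw [hst, add_smul, one_smul]; abel
    apply Subtype.ext
    change g u = 0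
    rw [this, hag, mul_comm, mul_smul, hsg, smul_zero, sub_zero]
  · intro z
    obtain ⟨u, rfl⟩ := hφsurj z
    obtain ⟨a, ha, b, hb, hab⟩ := Submodule.mem_sup.mp
      (show (1 : R) ∈ p ^ N ⊔ J' from hJ ▸ Submodule.mem_top)
    refine ⟨⟨b • g u, ?_⟩, ?_⟩
    · rw [Submodule.mem_torsionBySet_iff]
      rintro ⟨x, hx⟩
      change x • b • g u = 0
      rw [smul_smul]
      exact hY x hx b hb _
    · change ψ (b • g u) = φ u
      rw [map_smul, hψ]
      have hau : φ (a • u) = 0 := by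
        rw [hφ0]
        obtain ⟨w', hw'⟩ := hkill a ha (inc u)
        exact ⟨w', by rw [hw', map_smul]⟩
      have : φ u = φ (a • u) + b • φ u := by rw [← map_smul, ← map_add, ← add_smul, hab, one_smul]
      conv_rhs => rw [this, hau, zero_add]

end Length
end HilbertSiegel

/-! ### Fractional ideals -/

namespace HilbertSiegel

open IsDedekindDomain NumberField

section FractionalIdeals

theorem prod_mem_prod {R K ι : Type*} [CommRing R] [Field K] [Algebra R K] (s : Finset ι)
    (I : ι → FractionalIdeal R⁰ K) (x : ι → K)
    (h : ∀ i ∈ s, x i ∈ I i) : ∏ i ∈ s, x i ∈ ∏ i ∈ s, I i := by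
  classical
  induction s using Finset.induction_on with
  | empty =>
    rw [Finset.prod_empty, Finset.prod_empty]
    exact FractionalIdeal.one_mem_one _
  | insert a s ha ih =>
    rw [Finset.prod_insert ha, Finset.prod_insert ha]
    exact FractionalIdeal.mul_mem_mul (h a (Finset.mem_insert_self _ _))
      (ih fun i hi => h i (Finset.mem_insert_of_mem hi))

variable {K : Type*} [Field K] [NumberField K]

theorem mul_mem_one {A : FractionalIdeal (𝓞 K)⁰ K} (hA : A ≠ 0) {a b : K} (ha : a ∈ A)
    (hb : b ∈ A⁻¹) : ∃ r : 𝓞 K, (r : K) = a * b := by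
  have := FractionalIdeal.mul_mem_mul ha hb
  rw [mul_inv_cancel₀ hA] at this
  exact (FractionalIdeal.mem_one_iff _).mp this

/-- Approximate local generators: a nonzero fractional ideal `A` and its inverse contain nonzero
elements whose product is `1` modulo a prescribed ideal `J`. -/
theorem exists_mul_eq_one_add {A : FractionalIdeal (𝓞 K)⁰ K} (hA : A ≠ 0) {J : Ideal (𝓞 K)}
    (hJ : J ≠ ⊥) : ∃ a ∈ A, ∃ b ∈ A⁻¹, a ≠ 0 ∧ b ≠ 0 ∧ ∃ j ∈ J, a * b = 1 + (j : K) := by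
  -- An additional prime `v` in the modulus ensures that the product is not `0`, also for `J = ⊤`.
  obtain ⟨v, hv⟩ := Ideal.exists_maximal (𝓞 K)
  have hv0 : v ≠ ⊥ := Ring.ne_bot_of_isMaximal_of_not_isField hv (RingOfIntegers.not_isField K)
  obtain ⟨d, I, hd, hI⟩ := FractionalIdeal.exists_eq_spanSingleton_mul A
  have hI0 : I ≠ ⊥ := by
    rintro rfl
    rw [FractionalIdeal.coeIdeal_bot, mul_zero] at hI
    exact hA hI
  have hd0 : algebraMap (𝓞 K) K d ≠ 0 := by
    simpa using hd
  obtain ⟨a, ha⟩ := IsDedekindDomain.exists_sup_span_eq (I := I * (J * v)) (J := I)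
    Ideal.mul_le_left (mul_ne_zero hI0 (mul_ne_zero hJ hv0))
  have h1 : FractionalIdeal.spanSingleton (𝓞 K)⁰ ((algebraMap (𝓞 K) K d)⁻¹ * (a : K)) +
      A * ((J * v : Ideal (𝓞 K)) : FractionalIdeal (𝓞 K)⁰ K) = A := by
    rw [← FractionalIdeal.spanSingleton_mul_spanSingleton, hI, mul_assoc, ← mul_add]
    congr 1
    conv_rhs => rw [← ha]
    rw [FractionalIdeal.coeIdeal_sup, FractionalIdeal.coeIdeal_span_singleton,
      FractionalIdeal.coeIdeal_mul, FractionalIdeal.coeIdeal_mul, FractionalIdeal.coeIdeal_mul,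
      add_comm]
  have h2 : FractionalIdeal.spanSingleton (𝓞 K)⁰ ((algebraMap (𝓞 K) K d)⁻¹ * (a : K)) * A⁻¹ +
      ((J * v : Ideal (𝓞 K)) : FractionalIdeal (𝓞 K)⁰ K) = 1 := by
    have := congrArg (· * A⁻¹) h1
    simp only [add_mul] at this
    rwa [mul_right_comm, mul_inv_cancel₀ hA, one_mul] at this
  have h3 : (1 : K) ∈ FractionalIdeal.spanSingleton (𝓞 K)⁰ ((algebraMap (𝓞 K) K d)⁻¹ * (a : K))
      * A⁻¹ + ((J * v : Ideal (𝓞 K)) : FractionalIdeal (𝓞 K)⁰ K) := by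
    rw [h2]; exact FractionalIdeal.one_mem_one _
  obtain ⟨x, hx, z, hz, hxz⟩ := (FractionalIdeal.mem_add _ _ _).mp h3
  obtain ⟨b, hb, rfl⟩ := FractionalIdeal.mem_singleton_mul.mp hx
  obtain ⟨j, hj, rfl⟩ := (FractionalIdeal.mem_coeIdeal _).mp hz
  have hab : (algebraMap (𝓞 K) K d)⁻¹ * (a : K) * b = 1 + ((-j : 𝓞 K) : K) := by
    rw [eq_sub_of_add_eq hxz]; simp [sub_eq_add_neg]
  have hne : (algebraMap (𝓞 K) K d)⁻¹ * (a : K) * b ≠ 0 := by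
    intro h0
    rw [h0] at hab
    have h1 : (1 : 𝓞 K) = j := by
      apply RingOfIntegers.coe_injective
      have := hab.symm
      push_cast at this ⊢
      linear_combination this
    exact hv.ne_top ((Ideal.eq_top_iff_one _).mpr (h1 ▸ Ideal.mul_le_right hj))
  refine ⟨_, ?_, b, hb, left_ne_zero_of_mul hne, right_ne_zero_of_mul hne, -j,
    neg_mem (Ideal.mul_le_left hj), hab⟩
  rw [hI]
  exact FractionalIdeal.mul_mem_mul (FractionalIdeal.mem_spanSingleton_self _ _)
    (FractionalIdeal.mem_coeIdeal_of_mem _ (ha ▸ Ideal.mem_sup_right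
      (Ideal.mem_span_singleton_self a)))

/-- The square of a fractional ideal is generated by the squares of its elements, also at the primes
above `2`, since it is locally principal. -/
theorem mul_mul_mem_of_sq_mem {A M : FractionalIdeal (𝓞 K)⁰ K} (hA : A ≠ 0) {t : K}
    (h : ∀ x ∈ A, t * x ^ 2 ∈ M) {x y : K} (hx : x ∈ A) (hy : y ∈ A) : t * (x * y) ∈ M := by
  let 𝔞 : Ideal (𝓞 K) :=
    { carrier := {r | (r : K) * (t * (x * y)) ∈ M}
      add_mem' := fun {a b} ha hb => by
        have : ((a + b : 𝓞 K) : K) * (t * (x * y)) = a * (t * (x * y)) + b * (t * (x * y)) := by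
          push_cast; ring
        change _ ∈ M
        rw [this]
        exact M.1.add_mem ha hb
      zero_mem' := by
        change _ ∈ M
        rw [show ((0 : 𝓞 K) : K) * (t * (x * y)) = 0 by simp]
        exact M.1.zero_mem
      smul_mem' := fun c r hr => by
        change _ ∈ M
        rw [show ((c • r : 𝓞 K) : K) * (t * (x * y)) = c • ((r : K) * (t * (x * y))) by
          rw [Algebra.smul_def c ((r : K) * _), smul_eq_mul]
          simp only [RingOfIntegers.coe_eq_algebraMap, map_mul, mul_assoc]]
        exact M.1.smul_mem c hr }
  by_cases htop : 𝔞 = ⊤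
  · have : (1 : 𝓞 K) ∈ 𝔞 := htop ▸ Submodule.mem_top
    change _ ∈ M at this
    simpa using this
  · exfalso
    obtain ⟨v, hv, hle⟩ := Ideal.exists_le_maximal 𝔞 htop
    have hv0 : v ≠ ⊥ := Ring.ne_bot_of_isMaximal_of_not_isField hv (RingOfIntegers.not_isField K)
    obtain ⟨a, ha, b, hb, -, -, j, hj, hab⟩ := exists_mul_eq_one_add hA hv0
    obtain ⟨r, hr⟩ := mul_mem_one hA hx hb
    obtain ⟨s, hs⟩ := mul_mem_one hA hy hb
    have hmem : (1 + j) ^ 2 ∈ 𝔞 := by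
      change _ ∈ M
      have : (((1 + j) ^ 2 : 𝓞 K) : K) * (t * (x * y)) = (r * s) • (t * a ^ 2) := by
        simp only [RingOfIntegers.coe_eq_algebraMap] at hr hs hab ⊢
        rw [Algebra.smul_def, map_mul, map_pow, map_add, map_one, ← hab, hr, hs]
        ring
      rw [this]
      exact M.1.smul_mem _ (h a ha)
    have h1 : (1 : 𝓞 K) = (1 + j) ^ 2 - (2 + j) * j := by ring
    exact hv.ne_top ((Ideal.eq_top_iff_one _).mpr (h1 ▸ sub_mem (hle hmem)
      (Ideal.mul_mem_left _ _ hj)))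

theorem spanSingleton_mul_le_iff {A B M : FractionalIdeal (𝓞 K)⁰ K} {t : K} :
    FractionalIdeal.spanSingleton (𝓞 K)⁰ t * (A * B) ≤ M ↔
      ∀ x ∈ A, ∀ y ∈ B, t * (x * y) ∈ M := by
  constructor
  · intro h x hx y hy
    exact h (FractionalIdeal.mul_mem_mul (FractionalIdeal.mem_spanSingleton_self _ _)
      (FractionalIdeal.mul_mem_mul hx hy))
  · intro h
    rw [FractionalIdeal.spanSingleton_mul_le_iff]
    intro z hz
    refine FractionalIdeal.mul_induction_on hz h fun x y hx hy => ?_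
    rw [mul_add]
    exact M.1.add_mem hx hy

theorem det_mem_prod {K : Type*} [Field K] {n : ℕ} {I J : Fin n → FractionalIdeal (𝓞 K)⁰ K}
    {E : Matrix (Fin n) (Fin n) K}
    (hE : E ∈ idealMatrix I J) : E.det ∈ (∏ i, I i) * ∏ i, J i := by
  rw [Matrix.det_apply]
  refine ((∏ i, I i) * ∏ i, J i).1.sum_mem fun σ _ => ?_
  have h1 : ∏ i, E (σ i) i ∈ (∏ i, I i) * ∏ i, J i := by
    have := prod_mem_prod Finset.univ (fun i => I (σ i) * J i) (fun i => E (σ i) i)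
      fun i _ => hE _ _
    rwa [Finset.prod_mul_distrib, Equiv.prod_comp σ I] at this
  rcases Int.units_eq_one_or (Equiv.Perm.sign σ) with h | h
  · rw [h, one_smul]; exact h1
  · rw [h, Units.neg_smul, one_smul]; exact ((∏ i, I i) * ∏ i, J i).1.neg_mem h1

theorem det_mem_one {n : ℕ} {I : Fin n → FractionalIdeal (𝓞 K)⁰ K} (hI : ∀ j, I j ≠ 0)
    {E : Matrix (Fin n) (Fin n) K} (hE : E ∈ idealMatrix I fun j => (I j)⁻¹) :
    ∃ y : 𝓞 K, (y : K) = E.det := by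
  have := det_mem_prod hE
  rw [Finset.prod_inv_distrib, mul_inv_cancel₀ (Finset.prod_ne_zero_iff.mpr fun i _ => hI i)] at this
  exact (FractionalIdeal.mem_one_iff _).mp this

theorem one_mem_mul_inv {A : FractionalIdeal (𝓞 K)⁰ K} (hA : A ≠ 0) : (1 : K) ∈ A * A⁻¹ := by
  rw [mul_inv_cancel₀ hA]; exact FractionalIdeal.one_mem_one _

/-- The lattice `⟨I⟩ 𝒪^{n,n} ⟨I⁻¹⟩` is a ring, the endomorphism ring of `⨁ I_j`, and contains the
adjugates of its elements. -/
theorem adjugate_mem {n : ℕ} {I : Fin n → FractionalIdeal (𝓞 K)⁰ K} (hI : ∀ j, I j ≠ 0)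
    {E : Matrix (Fin n) (Fin n) K} (hE : E ∈ idealMatrix I fun j => (I j)⁻¹) :
    E.adjugate ∈ idealMatrix I fun j => (I j)⁻¹ := by
  intro i j
  rw [Matrix.adjugate_apply]
  have h1 : E.updateRow j (Pi.single i 1) ∈
      idealMatrix (Function.update I j (I i)) fun j => (I j)⁻¹ := by
    intro l m
    by_cases hl : l = j
    · subst hl
      rw [Matrix.updateRow_self, Function.update_self]
      by_cases hm : m = i
      · subst hm
        rw [Pi.single_eq_same]
        exact one_mem_mul_inv (hI m)
      · rw [Pi.single_eq_of_ne hm]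
        exact (_ : FractionalIdeal (𝓞 K)⁰ K).1.zero_mem
    · rw [Matrix.updateRow_ne hl, Function.update_of_ne hl]
      exact hE l m
  have h2 := det_mem_prod h1
  rw [Finset.prod_update_of_mem (Finset.mem_univ j), Finset.prod_inv_distrib,
    ← Finset.mul_prod_erase Finset.univ I (Finset.mem_univ j), mul_inv, mul_mul_mul_comm,
    Finset.sdiff_singleton_eq_erase, mul_inv_cancel₀
      (Finset.prod_ne_zero_iff.mpr fun i _ => hI i), mul_one] at h2
  exact h2

end FractionalIdeals
end HilbertSiegel

/-! ### The Gram matrix and the level -/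

namespace HilbertSiegel

open IsDedekindDomain NumberField FractionalIdeal

/-- Polarisation of `½ 𝔮`: the values of the bilinear form lie in the ideal `½ norm`. -/
theorem cross_term_mem {K : Type*} [Field K] [NumberField K] {M : FractionalIdeal (𝓞 K)⁰ K}
    {a b c : K} (h1 : 2⁻¹ * (a + 2 * b + c) ∈ M) (h2 : 2⁻¹ * a ∈ M) (h3 : 2⁻¹ * c ∈ M) : b ∈ M := by
  have h4 := M.1.sub_mem (M.1.sub_mem h1 h2) h3
  have e : 2⁻¹ * (a + 2 * b + c) - 2⁻¹ * a - 2⁻¹ * c = b := by ring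
  rwa [e] at h4

namespace QuadLattice

variable {K : Type*} [Field K] [NumberField K] {k : ℕ} (L : QuadLattice K k)

theorem bil_add_add (v w : Fin (2 * k) → K) :
    L.bil (v + w) (v + w) = L.bil v v + 2 * L.bil v w + L.bil w w := by
  have h : L.bil w v = L.bil v w := by
    rw [bil, bil, Matrix.dotProduct_mulVec, ← Matrix.mulVec_transpose, L.symm, dotProduct_comm]
  have e1 : L.bil (v + w) (v + w) = L.bil v v + L.bil v w + (L.bil w v + L.bil w w) := by
    simp only [bil, Matrix.mulVec_add, add_dotProduct, dotProduct_add]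
    ring
  rw [e1, h]
  ring

theorem bil_single (i j : Fin (2 * k)) (x y : K) :
    L.bil (Pi.single i x) (Pi.single j y) = L.Q i j * (x * y) := by
  rw [bil, single_dotProduct, Matrix.mulVec_single]
  simp
  ring

theorem single_mem_lattice {i : Fin (2 * k)} {x : K} (hx : x ∈ L.A i) :
    Pi.single i x ∈ L.lattice := fun l => by
  by_cases hl : l = i
  · subst hl; simpa using hx
  · rw [Pi.single_eq_of_ne hl]; exact (L.A l).1.zero_mem

theorem bil_self_mem_norm {v : Fin (2 * k) → K} (hv : v ∈ L.lattice) : L.bil v v ∈ L.norm :=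
  Submodule.subset_span ⟨v, hv, rfl⟩

theorem half_mul_mem_halfNorm {x : K} (hx : x ∈ L.norm) : 2⁻¹ * x ∈ L.halfNorm :=
  FractionalIdeal.mul_mem_mul (mem_spanSingleton_self _ _) hx

theorem half_diag_mem {i : Fin (2 * k)} {x y : K} (hx : x ∈ L.A i) (hy : y ∈ L.A i) :
    2⁻¹ * L.Q i i * (x * y) ∈ L.halfNorm := by
  refine mul_mul_mem_of_sq_mem (L.A_ne_zero i) (fun z hz => ?_) hx hy
  have := L.half_mul_mem_halfNorm (L.bil_self_mem_norm (L.single_mem_lattice hz))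
  rw [bil_single] at this
  rwa [mul_assoc, sq]

theorem gram_mem {i j : Fin (2 * k)} {x y : K} (hx : x ∈ L.A i) (hy : y ∈ L.A j) :
    L.Q i j * (x * y) ∈ L.halfNorm := by
  have hx' := L.single_mem_lattice hx
  have hy' := L.single_mem_lattice hy
  have h1 := L.half_mul_mem_halfNorm (L.bil_self_mem_norm (L.lattice.add_mem hx' hy'))
  have h2 := L.half_mul_mem_halfNorm (L.bil_self_mem_norm hx')
  have h3 := L.half_mul_mem_halfNorm (L.bil_self_mem_norm hy')
  rw [bil_add_add] at h1
  rw [← bil_single]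
  exact cross_term_mem h1 h2 h3

/-- An upper triangular matrix with the quadratic form `½ 𝔮`; its symmetrisation is `Q`. -/
def halfGram : Matrix (Fin (2 * k)) (Fin (2 * k)) K := fun i j =>
  if i = j then 2⁻¹ * L.Q i i else if i < j then L.Q i j else 0

theorem halfGram_add_transpose : L.halfGram + L.halfGram.transpose = L.Q := by
  ext i j
  rw [Matrix.add_apply, Matrix.transpose_apply, halfGram, halfGram]
  rcases lt_trichotomy i j with h | h | h
  · simp [h, h.ne, h.ne', h.not_gt]
  · subst h; simp; ring
  · simp [h, h.ne, h.ne', h.not_gt, L.symm.apply i j]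

theorem halfGram_mem {i j : Fin (2 * k)} {x y : K} (hx : x ∈ L.A i) (hy : y ∈ L.A j) :
    L.halfGram i j * (x * y) ∈ L.halfNorm := by
  rw [halfGram]
  split_ifs with h1 h2
  · subst h1; exact L.half_diag_mem hx hy
  · exact L.gram_mem hx hy
  · rw [zero_mul]; exact L.halfNorm.1.zero_mem

theorem inv_gram_symm (i j : Fin (2 * k)) : L.Q⁻¹ i j = L.Q⁻¹ j i := by
  have : L.Q⁻¹.IsSymm := by
    rw [Matrix.IsSymm, Matrix.transpose_nonsing_inv, L.symm]
  exact this.apply j i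

variable [IsTotallyReal K]

theorem isUnit_det : IsUnit L.Q.det := isUnit_iff_ne_zero.mpr L.det_ne_zero

theorem bil_inv_row (i : Fin (2 * k)) (x : K) (w : Fin (2 * k) → K) :
    L.bil (x • L.Q⁻¹ i) w = x * w i := by
  have : L.Q⁻¹ i = Matrix.vecMul (Pi.single i 1) L.Q⁻¹ := by
    rw [Matrix.single_one_vecMul]; rfl
  rw [bil, smul_dotProduct, this, Matrix.dotProduct_mulVec, Matrix.vecMul_vecMul,
    Matrix.nonsing_inv_mul _ L.isUnit_det, Matrix.vecMul_one, single_one_dotProduct, smul_eq_mul]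

theorem inv_row_mem_dual {i : Fin (2 * k)} {x : K} (hx : x ∈ (L.A i)⁻¹) :
    x • L.Q⁻¹ i ∈ L.dual := fun w hw => by
  rw [bil_inv_row]
  have := FractionalIdeal.mul_mem_mul hx (hw i)
  rwa [inv_mul_cancel₀ (L.A_ne_zero i)] at this

theorem bil_self_mem_normDual {v : Fin (2 * k) → K} (hv : v ∈ L.dual) : L.bil v v ∈ L.normDual :=
  Submodule.subset_span ⟨v, hv, rfl⟩

theorem half_mul_mem_halfNormDual {x : K} (hx : x ∈ L.normDual) :
    2⁻¹ * x ∈ spanSingleton (𝓞 K)⁰ (2⁻¹ : K) * L.normDual :=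
  FractionalIdeal.mul_mem_mul (mem_spanSingleton_self _ _) hx

theorem inv_gram_mem {i j : Fin (2 * k)} {x y : K} (hx : x ∈ (L.A i)⁻¹) (hy : y ∈ (L.A j)⁻¹) :
    L.Q⁻¹ i j * (x * y) ∈ spanSingleton (𝓞 K)⁰ (2⁻¹ : K) * L.normDual := by
  have hx' := L.inv_row_mem_dual hx
  have hy' := L.inv_row_mem_dual hy
  have h1 := L.half_mul_mem_halfNormDual (L.bil_self_mem_normDual (L.dual.add_mem hx' hy'))
  have h2 := L.half_mul_mem_halfNormDual (L.bil_self_mem_normDual hx')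
  have h3 := L.half_mul_mem_halfNormDual (L.bil_self_mem_normDual hy')
  rw [bil_add_add] at h1
  have e : L.bil (x • L.Q⁻¹ i) (y • L.Q⁻¹ j) = L.Q⁻¹ i j * (x * y) := by
    rw [bil_inv_row, Pi.smul_apply, smul_eq_mul, L.inv_gram_symm j i]
    ring
  rw [← e]
  exact cross_term_mem h1 h2 h3

theorem gram_mul_inv_mem (i j : Fin (2 * k)) : L.Q i j * L.Q⁻¹ j i ∈
    L.halfNorm * (spanSingleton (𝓞 K)⁰ (2⁻¹ : K) * L.normDual) := by
  have h1 : spanSingleton (𝓞 K)⁰ (L.Q i j) * (L.A i * L.A j) ≤ L.halfNorm :=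
    spanSingleton_mul_le_iff.mpr fun x hx y hy => L.gram_mem hx hy
  have h2 : spanSingleton (𝓞 K)⁰ (L.Q⁻¹ j i) * ((L.A j)⁻¹ * (L.A i)⁻¹) ≤
      spanSingleton (𝓞 K)⁰ (2⁻¹ : K) * L.normDual :=
    spanSingleton_mul_le_iff.mpr fun x hx y hy => L.inv_gram_mem hx hy
  have h3 := mul_le_mul' h1 h2
  have e : spanSingleton (𝓞 K)⁰ (L.Q i j) * (L.A i * L.A j) *
      (spanSingleton (𝓞 K)⁰ (L.Q⁻¹ j i) * ((L.A j)⁻¹ * (L.A i)⁻¹)) =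
      spanSingleton (𝓞 K)⁰ (L.Q i j * L.Q⁻¹ j i) := by
    rw [← spanSingleton_mul_spanSingleton]
    have := L.A_ne_zero i
    have := L.A_ne_zero j
    field_simp
  rw [e] at h3
  exact h3 (mem_spanSingleton_self _ _)

/-- Since `Q Q⁻¹ = 1`, the ideals `½ norm L` and `½ norm L^#` have a product containing `1`; this gives
the integrality of the level. -/
theorem one_le_halfNorm_mul (hk : 0 < k) :
    1 ≤ L.halfNorm * (spanSingleton (𝓞 K)⁰ (2⁻¹ : K) * L.normDual) := by
  rw [FractionalIdeal.one_le]
  let i : Fin (2 * k) := ⟨0, by omega⟩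
  have h1 : (1 : K) = ∑ j, L.Q i j * L.Q⁻¹ j i := by
    rw [← Matrix.mul_apply, Matrix.mul_nonsing_inv _ L.isUnit_det, Matrix.one_apply_eq]
  rw [h1]
  exact Submodule.sum_mem _ fun j _ => L.gram_mul_inv_mem i j

theorem halfNorm_ne_zero (hk : 0 < k) : L.halfNorm ≠ 0 := by
  intro h
  have := L.one_le_halfNorm_mul hk
  rw [h, zero_mul] at this
  exact one_ne_zero (le_antisymm this (zero_le _))

/-- The level is the inverse of `½ norm L · ½ norm L^#`. -/
theorem level_mul (hk : 0 < k) :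
    L.level * (L.halfNorm * (spanSingleton (𝓞 K)⁰ (2⁻¹ : K) * L.normDual)) = 1 := by
  have h0 : L.halfNorm * (spanSingleton (𝓞 K)⁰ (2⁻¹ : K) * L.normDual) ≠ 0 := fun h => by
    have := L.one_le_halfNorm_mul hk
    rw [h] at this
    exact one_ne_zero (le_antisymm this (zero_le _))
  have e : L.halfNorm * (spanSingleton (𝓞 K)⁰ (2⁻¹ : K) * L.normDual) =
      spanSingleton (𝓞 K)⁰ (4⁻¹ : K) * (L.norm * L.normDual) := by
    rw [halfNorm, show (4⁻¹ : K) = 2⁻¹ * 2⁻¹ by norm_num, ← spanSingleton_mul_spanSingleton]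
    ring
  rw [e] at h0 ⊢
  have h1 : L.norm * L.normDual ≠ 0 := right_ne_zero_of_mul h0
  rw [level, mul_mul_mul_comm, spanSingleton_mul_spanSingleton, inv_mul_cancel₀ h1,
    mul_inv_cancel₀ (by norm_num), spanSingleton_one, one_mul]

theorem level_le_one (hk : 0 < k) : L.level ≤ 1 := by
  calc L.level = L.level * 1 := (mul_one _).symm
    _ ≤ L.level * (L.halfNorm * (spanSingleton (𝓞 K)⁰ (2⁻¹ : K) * L.normDual)) :=
      mul_le_mul_right (L.one_le_halfNorm_mul hk) _
    _ = 1 := L.level_mul hk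

end QuadLattice
end HilbertSiegel

/-! ### Approximate generators of fractional ideals -/

namespace HilbertSiegel

open IsDedekindDomain NumberField FractionalIdeal

/-- A generator of the fractional ideal `A` and a generator of `A⁻¹` up to an error in `J`: nonzero
elements of `A` and of `A⁻¹` whose product is `1` modulo `J`. -/
structure ApproxGenerator {K : Type*} [Field K] [NumberField K] (A : FractionalIdeal (𝓞 K)⁰ K)
    (J : Ideal (𝓞 K)) where
  gen : K
  inv : K
  unit : 𝓞 K
  gen_mem : gen ∈ A
  inv_mem : inv ∈ A⁻¹
  gen_ne_zero : gen ≠ 0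
  inv_ne_zero : inv ≠ 0
  mul_eq : gen * inv = algebraMap (𝓞 K) K unit
  unit_sub_one_mem : unit - 1 ∈ J

theorem nonempty_approxGenerator {K : Type*} [Field K] [NumberField K]
    {A : FractionalIdeal (𝓞 K)⁰ K} (hA : A ≠ 0) {J : Ideal (𝓞 K)} (hJ : J ≠ ⊥) :
    Nonempty (ApproxGenerator A J) := by
  obtain ⟨a, ha, b, hb, ha0, hb0, j, hj, hab⟩ := exists_mul_eq_one_add hA hJ
  refine ⟨⟨a, b, 1 + j, ha, hb, ha0, hb0, ?_, by simpa using hj⟩⟩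
  rw [hab, map_add, map_one]

theorem prod_sub_one_mem {R ι : Type*} [CommRing R] {J : Ideal R} (s : Finset ι) {f : ι → R}
    (h : ∀ i ∈ s, f i - 1 ∈ J) : ∏ i ∈ s, f i - 1 ∈ J := by
  rw [← Ideal.Quotient.eq, map_prod, map_one]
  exact Finset.prod_eq_one fun i hi => by
    rw [← map_one (Ideal.Quotient.mk J)]
    exact Ideal.Quotient.eq.mpr (h i hi)

theorem notMem_of_sub_one_mem {R : Type*} [CommRing R] {p : Ideal R} (hp : p ≠ ⊤) {x : R}
    (h : x - 1 ∈ p) : x ∉ p := fun hx =>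
  hp ((Ideal.eq_top_iff_one _).mpr (by simpa using sub_mem hx h))

section Conjugation

variable {K : Type*} [Field K] [NumberField K] {n : ℕ} {I : Fin n → FractionalIdeal (𝓞 K)⁰ K}
  {J : Ideal (𝓞 K)} (g : ∀ j, ApproxGenerator (I j) J)

/-- A matrix in `⟨I⟩ 𝔟 ⟨I⁻¹⟩` becomes, after conjugation by generators of the `I_j` and a
multiplication by a factor prime to `J`, a matrix with entries in the ideal `𝔟`. -/
theorem exists_integral_conj {𝔟 : Ideal (𝓞 K)} {E : Matrix (Fin n) (Fin n) K}
    (hE : ∀ i j, E i j ∈ (𝔟 : FractionalIdeal (𝓞 K)⁰ K) * (I i * (I j)⁻¹))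
    (hI : ∀ j, I j ≠ 0) :
    ∃ F : Matrix (Fin n) (Fin n) (𝓞 K), (∀ i j, F i j ∈ 𝔟) ∧ ∀ i j,
      algebraMap (𝓞 K) K (F i j) =
        algebraMap (𝓞 K) K (∏ l, (g l).unit) * ((g i).gen⁻¹ * E i j * (g j).gen) := by
  have key : ∀ i j, ∃ r ∈ 𝔟, algebraMap (𝓞 K) K r =
      algebraMap (𝓞 K) K (∏ l, (g l).unit) * ((g i).gen⁻¹ * E i j * (g j).gen) := by
    intro i j
    have h1 : (g i).inv * (g j).gen * E i j ∈ (𝔟 : FractionalIdeal (𝓞 K)⁰ K) := by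
      have := FractionalIdeal.mul_mem_mul (FractionalIdeal.mul_mem_mul (g i).inv_mem
        (g j).gen_mem) (hE i j)
      have e : (I i)⁻¹ * I j * ((𝔟 : FractionalIdeal (𝓞 K)⁰ K) * (I i * (I j)⁻¹)) = 𝔟 := by
        have := hI i
        have := hI j
        field_simp
      rwa [e] at this
    obtain ⟨r, hr, hr'⟩ := (FractionalIdeal.mem_coeIdeal _).mp h1
    refine ⟨(∏ l ∈ Finset.univ.erase i, (g l).unit) * r, Ideal.mul_mem_left _ _ hr, ?_⟩
    rw [← Finset.mul_prod_erase _ _ (Finset.mem_univ i), map_mul, map_mul, hr', ← (g i).mul_eq]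
    have := (g i).gen_ne_zero
    field_simp
  choose F hF hF' using key
  exact ⟨fun i j => F i j, hF, hF'⟩

theorem det_of_conj {E : Matrix (Fin n) (Fin n) K} {F : Matrix (Fin n) (Fin n) (𝓞 K)} {θ : 𝓞 K}
    (hF : ∀ i j, algebraMap (𝓞 K) K (F i j) =
        algebraMap (𝓞 K) K θ * ((g i).gen⁻¹ * E i j * (g j).gen)) :
    algebraMap (𝓞 K) K F.det = algebraMap (𝓞 K) K θ ^ n * E.det := by
  have e : (algebraMap (𝓞 K) K).mapMatrix F = Matrix.of fun i j => (g j).gen *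
      (Matrix.of fun i j => (algebraMap (𝓞 K) K θ * (g i).gen⁻¹) * E i j) i j := by
    ext i j
    rw [RingHom.mapMatrix_apply, Matrix.map_apply, hF, Matrix.of_apply, Matrix.of_apply]
    ring
  rw [RingHom.map_det, e, Matrix.det_mul_row, Matrix.det_mul_column, Finset.prod_mul_distrib,
    Finset.prod_inv_distrib, Finset.prod_const, Finset.card_univ, Fintype.card_fin]
  have : ∏ i, (g i).gen ≠ 0 := Finset.prod_ne_zero_iff.mpr fun i _ => (g i).gen_ne_zero
  field_simp

/-- The determinant of a matrix in `⟨I⟩ 𝒪^{n,n} ⟨I⁻¹⟩` that is congruent to the identity modulo a prime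
is prime to it, and hence so are its divisors. -/
theorem det_one_add_mul_notMem {v : Ideal (𝓞 K)} [hv : v.IsPrime] (hv0 : v ≠ ⊥)
    {E : Matrix (Fin n) (Fin n) K} (hI : ∀ j, I j ≠ 0)
    (hE : ∀ i j, E i j ∈ (v : FractionalIdeal (𝓞 K)⁰ K) * (I i * (I j)⁻¹)) {a b : 𝓞 K}
    (hab : algebraMap (𝓞 K) K (a * b) = (1 + E).det) : b ∉ v := by
  intro hb
  let g : ∀ j, ApproxGenerator (I j) v := fun j => (nonempty_approxGenerator (hI j) hv0).some
  obtain ⟨F, hF, hFE⟩ := exists_integral_conj g hE hI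
  set θ := ∏ l, (g l).unit with hθ
  have hθv : θ ∉ v := notMem_of_sub_one_mem hv.ne_top
    (prod_sub_one_mem _ fun l _ => (g l).unit_sub_one_mem)
  have h1 : algebraMap (𝓞 K) K (θ • (1 : Matrix (Fin n) (Fin n) (𝓞 K)) + F).det =
      algebraMap (𝓞 K) K θ ^ n * (1 + E).det := by
    refine det_of_conj g fun i j => ?_
    rw [Matrix.add_apply, Matrix.add_apply, map_add, hFE, Matrix.smul_apply, Matrix.one_apply,
      Matrix.one_apply]
    split_ifs with h
    · subst h
      have := (g i).gen_ne_zero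
      rw [smul_eq_mul, mul_one]
      field_simp
    · simp
  rw [← hab, ← map_pow, ← map_mul] at h1
  have h2 : (θ • (1 : Matrix (Fin n) (Fin n) (𝓞 K)) + F).det = θ ^ n * (a * b) :=
    RingOfIntegers.coe_injective h1
  have h3 : (θ • (1 : Matrix (Fin n) (Fin n) (𝓞 K)) + F).det - θ ^ n ∈ v := by
    rw [← Ideal.Quotient.eq, RingHom.map_det]
    have : (Ideal.Quotient.mk v).mapMatrix (θ • (1 : Matrix (Fin n) (Fin n) (𝓞 K)) + F) =
        (Ideal.Quotient.mk v θ) • 1 := by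
      ext i j
      rw [RingHom.mapMatrix_apply, Matrix.map_apply, Matrix.add_apply, map_add,
        Ideal.Quotient.eq_zero_iff_mem.mpr (hF i j), add_zero, Matrix.smul_apply, Matrix.smul_apply,
        Matrix.one_apply, Matrix.one_apply]
      split_ifs <;> simp
    rw [this, Matrix.det_smul, Matrix.det_one, mul_one, Fintype.card_fin, map_pow]
  refine hθv (hv.mem_of_pow_mem n ?_)
  have h4 := sub_mem (Ideal.mul_mem_left v (θ ^ n * a) hb) h3
  rwa [h2, show θ ^ n * a * b - (θ ^ n * (a * b) - θ ^ n) = θ ^ n by ring] at h4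

end Conjugation

namespace QuadLattice

variable {K : Type*} [Field K] [NumberField K] {k : ℕ} (L : QuadLattice K k)

/-- The local Gram matrix is integral; this is the Gram matrix before symmetrisation. -/
theorem exists_integral_halfGram (hN : L.halfNorm ≠ 0)
    {η : K} (hη : η ∈ L.halfNorm⁻¹) {α : Fin (2 * k) → K} (hα : ∀ i, α i ∈ L.A i) :
    ∃ T : Matrix (Fin (2 * k)) (Fin (2 * k)) (𝓞 K), ∀ i j,
      algebraMap (𝓞 K) K (T i j) = η * (L.halfGram i j * (α i * α j)) := by
  have key : ∀ i j, ∃ r : 𝓞 K, algebraMap (𝓞 K) K r = η * (L.halfGram i j * (α i * α j)) := by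
    intro i j
    have := FractionalIdeal.mul_mem_mul hη (L.halfGram_mem (hα i) (hα j))
    rw [inv_mul_cancel₀ hN] at this
    exact (mem_one_iff _).mp this
  choose T hT using key
  exact ⟨fun i j => T i j, hT⟩

theorem det_of_halfGram {η : K} {α : Fin (2 * k) → K}
    {T : Matrix (Fin (2 * k)) (Fin (2 * k)) (𝓞 K)} (hT : ∀ i j,
      algebraMap (𝓞 K) K (T i j) = η * (L.halfGram i j * (α i * α j))) :
    algebraMap (𝓞 K) K (T + T.transpose).det = η ^ (2 * k) * (∏ i, α i) ^ 2 * L.Q.det := by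
  have e : (algebraMap (𝓞 K) K).mapMatrix (T + T.transpose) = Matrix.of fun i j => α j *
      (Matrix.of fun i j => (η * α i) * L.Q i j) i j := by
    ext i j
    rw [RingHom.mapMatrix_apply, Matrix.map_apply, Matrix.add_apply, map_add, hT,
      Matrix.transpose_apply, hT, Matrix.of_apply, Matrix.of_apply]
    conv_rhs => rw [← L.halfGram_add_transpose]
    rw [Matrix.add_apply, Matrix.transpose_apply]
    ring
  rw [RingHom.map_det, e, Matrix.det_mul_row, Matrix.det_mul_column, Finset.prod_mul_distrib,
    Finset.prod_const, Finset.card_univ, Fintype.card_fin]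
  ring

/-- At a prime that does not divide the level, the local Gram matrix is unimodular. -/
theorem det_notMem_of_not_level_le [IsTotallyReal K] (hk : 0 < k) {v : Ideal (𝓞 K)}
    [hv : v.IsPrime] {J : Ideal (𝓞 K)} (hJ : J ≤ v)
    (hlevel : ¬ L.level ≤ (v : FractionalIdeal (𝓞 K)⁰ K))
    (η : ApproxGenerator L.halfNorm⁻¹ J) (α : ∀ i, ApproxGenerator (L.A i) J) {y : 𝓞 K}
    (hy : algebraMap (𝓞 K) K y = η.gen ^ (2 * k) * (∏ i, (α i).gen) ^ 2 * L.Q.det) : y ∉ v := by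
  obtain ⟨ν, hν, hνv⟩ : ∃ ν ∈ L.level, ν ∉ (v : FractionalIdeal (𝓞 K)⁰ K) := by
    by_contra! hcon
    exact hlevel hcon
  obtain ⟨m, rfl⟩ := (mem_one_iff _).mp (L.level_le_one hk hν)
  have hm : m ∉ v := fun hm => hνv (mem_coeIdeal_of_mem _ hm)
  have key : ∀ i j, ∃ r : 𝓞 K, algebraMap (𝓞 K) K r = algebraMap (𝓞 K) K m *
      (η.inv * (L.Q⁻¹ i j * ((α i).inv * (α j).inv))) := by
    intro i j
    have h1 := η.inv_mem
    rw [inv_inv] at h1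
    have := FractionalIdeal.mul_mem_mul hν (FractionalIdeal.mul_mem_mul h1
      (L.inv_gram_mem (α i).inv_mem (α j).inv_mem))
    rw [L.level_mul hk] at this
    exact (mem_one_iff _).mp this
  choose P hP using key
  have hdet : algebraMap (𝓞 K) K (Matrix.of fun i j => P i j).det =
      (algebraMap (𝓞 K) K m * η.inv) ^ (2 * k) * (∏ i, (α i).inv) ^ 2 * L.Q.det⁻¹ := by
    have e : (algebraMap (𝓞 K) K).mapMatrix (Matrix.of fun i j => P i j) =
        Matrix.of fun i j => (α j).inv *
        (Matrix.of fun i j => (algebraMap (𝓞 K) K m * η.inv * (α i).inv) * L.Q⁻¹ i j) i j := by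
      ext i j
      rw [RingHom.mapMatrix_apply, Matrix.map_apply, Matrix.of_apply, hP, Matrix.of_apply,
        Matrix.of_apply]
      ring
    rw [RingHom.map_det, e, Matrix.det_mul_row, Matrix.det_mul_column, Finset.prod_mul_distrib,
      Finset.prod_const, Finset.card_univ, Fintype.card_fin, Matrix.det_nonsing_inv,
      Ring.inverse_eq_inv']
    ring
  have hprod : y * (Matrix.of fun i j => P i j).det =
      (m * η.unit) ^ (2 * k) * (∏ i, (α i).unit) ^ 2 := by
    apply RingOfIntegers.coe_injective
    rw [map_mul, hy, hdet, map_mul, map_pow, map_pow, map_mul, map_prod, ← η.mul_eq,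
      Finset.prod_congr rfl fun i _ => ((α i).mul_eq).symm, Finset.prod_mul_distrib]
    have := L.det_ne_zero
    field_simp
    ring
  intro hyv
  have h1 : (m * η.unit) ^ (2 * k) * (∏ i, (α i).unit) ^ 2 ∈ v := by
    rw [← hprod]; exact Ideal.mul_mem_right _ _ hyv
  rcases hv.mem_or_mem h1 with h2 | h2
  · rcases hv.mem_or_mem (hv.mem_of_pow_mem _ h2) with h3 | h3
    · exact hm h3
    · exact notMem_of_sub_one_mem hv.ne_top (hJ η.unit_sub_one_mem) h3
  · exact notMem_of_sub_one_mem hv.ne_top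
      (prod_sub_one_mem _ fun i _ => hJ (α i).unit_sub_one_mem) (hv.mem_of_pow_mem _ h2)

end QuadLattice
end HilbertSiegel

/-! ### The matrix group and the determinant of `D` -/

namespace HilbertSiegel

open IsDedekindDomain NumberField FractionalIdeal

section Congruence

variable {K : Type*} [Field K] [NumberField K] {n : ℕ} {I : Fin n → FractionalIdeal (𝓞 K)⁰ K}
  {D : Matrix (Fin n) (Fin n) K}

theorem mulVec_mem {a : FractionalIdeal (𝓞 K)⁰ K} (hI : ∀ j, I j ≠ 0)
    (hD : D ∈ idealMatrix I fun j => (I j)⁻¹) {x : Fin n → K} (hx : ∀ j, x j ∈ a * I j) (j : Fin n) :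
    D.mulVec x j ∈ a * I j := by
  rw [Matrix.mulVec, dotProduct]
  refine Submodule.sum_mem (a * I j).1 fun l _ => ?_
  have := FractionalIdeal.mul_mem_mul (hD j l) (hx l)
  rwa [show I j * (I l)⁻¹ * (a * I l) = a * I j by have := hI l; field_simp] at this

theorem mul_inv_mulVec_mem {a : FractionalIdeal (𝓞 K)⁰ K} (hI : ∀ j, I j ≠ 0)
    (hD : D ∈ idealMatrix I fun j => (I j)⁻¹) (hdet : D.det ≠ 0) {y : 𝓞 K}
    (hy : algebraMap (𝓞 K) K y = D.det) {c : 𝓞 K} (hc : c ∈ Ideal.span {y}) {x : Fin n → K}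
    (hx : ∀ j, x j ∈ a * I j) (j : Fin n) :
    algebraMap (𝓞 K) K c * D⁻¹.mulVec x j ∈ a * I j := by
  obtain ⟨r, rfl⟩ := Ideal.mem_span_singleton'.mp hc
  have h1 := mulVec_mem hI (adjugate_mem hI hD) hx j
  have e : algebraMap (𝓞 K) K (r * y) * D⁻¹.mulVec x j = r • D.adjugate.mulVec x j := by
    rw [Algebra.smul_def, map_mul, hy, Matrix.inv_def, Matrix.smul_mulVec, Ring.inverse_eq_inv',
      Pi.smul_apply, smul_eq_mul, mul_assoc, mul_inv_cancel_left₀ hdet]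
  rw [e]
  exact (a * I j).1.smul_mem r h1

end Congruence

namespace QuadLattice

variable {K : Type*} [Field K] [NumberField K] {k n : ℕ} {L : QuadLattice K k}
  {I : Fin n → FractionalIdeal (𝓞 K)⁰ K} {A B C D : Matrix (Fin n) (Fin n) K}

/-- The different of `K`, as a fractional ideal. -/
def different (K : Type*) [Field K] [NumberField K] : FractionalIdeal (𝓞 K)⁰ K :=
  (differentIdeal ℤ (𝓞 K) : Ideal (𝓞 K))

theorem different_ne_zero : different K ≠ 0 := by
  rw [different, Ne, FractionalIdeal.coeIdeal_eq_zero]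
  exact differentIdeal_ne_bot

theorem latticeMatrixMul_le (hI : ∀ j, I j ≠ 0) (hD : D ∈ idealMatrix I fun j => (I j)⁻¹) :
    L.latticeMatrixMul I D ≤ L.latticeMatrix I := by
  rintro _ ⟨U, hU, rfl⟩ i j
  have := mulVec_mem hI hD (x := U i) (fun l => hU i l) j
  convert this using 1
  change (U * D.transpose) i j = _
  simp only [Matrix.mul_apply, Matrix.transpose_apply, Matrix.mulVec, dotProduct]
  exact Finset.sum_congr rfl fun l _ => mul_comm _ _

theorem mem_latticeMatrixMul_iff (hD : D.det ≠ 0) (U : Matrix (Fin (2 * k)) (Fin n) K) :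
    U ∈ L.latticeMatrixMul I D ↔ ∀ i j, D⁻¹.mulVec (U i) j ∈ L.A i * I j := by
  have hu : IsUnit D.det := isUnit_iff_ne_zero.mpr hD
  have e : ∀ (M : Matrix (Fin n) (Fin n) K) (V : Matrix (Fin (2 * k)) (Fin n) K) i j,
      (V * M.transpose) i j = M.mulVec (V i) j := fun M V i j => by
    simp only [Matrix.mul_apply, Matrix.transpose_apply, Matrix.mulVec, dotProduct]
    exact Finset.sum_congr rfl fun l _ => mul_comm _ _
  constructor
  · rintro ⟨V, hV, rfl⟩ i j
    have e1 : (mulRightLinearMap (Fin (2 * k)) (𝓞 K) D.transpose V) i = D.mulVec (V i) := by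
      ext l
      exact e D V i l
    rw [e1, Matrix.mulVec_mulVec, Matrix.nonsing_inv_mul _ hu, Matrix.one_mulVec]
    exact hV i j
  · intro h
    refine ⟨U * D⁻¹.transpose, fun i j => ?_, ?_⟩
    · rw [e]; exact h i j
    · change U * D⁻¹.transpose * D.transpose = U
      rw [Matrix.mul_assoc, ← Matrix.transpose_mul, Matrix.mul_nonsing_inv _ hu,
        Matrix.transpose_one, Matrix.mul_one]

variable [IsTotallyReal K]

/-- The conditions on the blocks of a matrix in `Γ₀(𝒩; ℐ_1, …, ℐ_n; 𝔑)`, with the powers of the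
different and of `𝔑` collected. -/
structure Gamma0Blocks (L : QuadLattice K k) (I : Fin n → FractionalIdeal (𝓞 K)⁰ K)
    (A B C D : Matrix (Fin n) (Fin n) K) : Prop where
  upperLeft_mem : ∀ i j, A i j ∈ (I i)⁻¹ * I j
  upperRight_mem : ∀ i j, B i j ∈ (L.halfNorm * different K)⁻¹ * ((I i)⁻¹ * (I j)⁻¹)
  lowerLeft_mem : ∀ i j, C i j ∈ L.level * (L.halfNorm * different K) * (I i * I j)
  lowerRight_mem : D ∈ idealMatrix I fun j => (I j)⁻¹
  transpose_mul_symm : B.transpose * D = D.transpose * B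
  transpose_mul_sub : A.transpose * D - C.transpose * B = 1

theorem gamma0Blocks (hk : 0 < k) (h : Matrix.fromBlocks A B C D ∈ L.Gamma0 I) :
    Gamma0Blocks L I A B C D where
  upperLeft_mem i j := by
    have h1 : A i j ∈ (L.halfNorm * different K * I i)⁻¹ * (L.halfNorm * different K * I j) :=
      h.2.1 i j
    rwa [mul_inv_rev, mul_assoc, inv_mul_cancel_left₀
      (mul_ne_zero (L.halfNorm_ne_zero hk) different_ne_zero)] at h1
  upperRight_mem i j := by
    have h1 : B i j ∈ (L.halfNorm * different K * I i)⁻¹ * (I j)⁻¹ := h.2.2.1 i j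
    rwa [mul_inv, mul_assoc] at h1
  lowerLeft_mem i j := by
    have h1 : C i j ∈ (I i * L.level) * (L.halfNorm * different K * I j) := h.2.2.2.1 i j
    rwa [show (I i * L.level) * (L.halfNorm * different K * I j) =
      L.level * (L.halfNorm * different K) * (I i * I j) by ring] at h1
  lowerRight_mem := h.2.2.2.2
  transpose_mul_symm := (SymplecticGroup.fromBlocks_mem_iff.mp h.1).2.1
  transpose_mul_sub := (SymplecticGroup.fromBlocks_mem_iff.mp h.1).2.2

/-- The matrix `B D⁻¹` is symmetric. -/
theorem Gamma0Blocks.isSymm (h : Gamma0Blocks L I A B C D) (hD : D.det ≠ 0) :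
    (B * D⁻¹).IsSymm := by
  have hu : IsUnit D.det := isUnit_iff_ne_zero.mpr hD
  have hu' : IsUnit D.transpose.det := by rwa [Matrix.det_transpose]
  rw [Matrix.IsSymm, Matrix.transpose_mul, Matrix.transpose_nonsing_inv]
  calc D.transpose⁻¹ * B.transpose = D.transpose⁻¹ * (B.transpose * D) * D⁻¹ := by
        rw [Matrix.mul_assoc, Matrix.mul_assoc, Matrix.mul_nonsing_inv _ hu, Matrix.mul_one]
    _ = B * D⁻¹ := by
        rw [h.transpose_mul_symm, ← Matrix.mul_assoc, Matrix.nonsing_inv_mul _ hu', Matrix.one_mul]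

theorem Gamma0Blocks.inv_eq (h : Gamma0Blocks L I A B C D) (hD : D.det ≠ 0) :
    D⁻¹ = A.transpose - C.transpose * (B * D⁻¹) := by
  have hu : IsUnit D.det := isUnit_iff_ne_zero.mpr hD
  calc D⁻¹ = (A.transpose * D - C.transpose * B) * D⁻¹ := by
        rw [h.transpose_mul_sub, Matrix.one_mul]
    _ = A.transpose - C.transpose * (B * D⁻¹) := by
        rw [Matrix.sub_mul, Matrix.mul_assoc, Matrix.mul_nonsing_inv _ hu, Matrix.mul_one,
          Matrix.mul_assoc]

/-- Up to the factor `det D`, the entries of `B D⁻¹` are as integral as those of `B`. -/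
theorem Gamma0Blocks.mul_form_mem (h : Gamma0Blocks L I A B C D) (hI : ∀ j, I j ≠ 0)
    (hD : D.det ≠ 0) {y : 𝓞 K} (hy : algebraMap (𝓞 K) K y = D.det) {c : 𝓞 K}
    (hc : c ∈ Ideal.span {y}) (i j : Fin n) :
    algebraMap (𝓞 K) K c * (B * D⁻¹) i j ∈
      (L.halfNorm * different K)⁻¹ * ((I i)⁻¹ * (I j)⁻¹) := by
  obtain ⟨r, rfl⟩ := Ideal.mem_span_singleton'.mp hc
  have e : algebraMap (𝓞 K) K (r * y) * (B * D⁻¹) i j = r • (B * D.adjugate) i j := by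
    rw [Algebra.smul_def, map_mul, hy, Matrix.inv_def, Matrix.mul_smul, Ring.inverse_eq_inv',
      Matrix.smul_apply, smul_eq_mul, mul_assoc, mul_inv_cancel_left₀ hD]
  rw [e]
  refine Submodule.smul_mem _ r ?_
  rw [Matrix.mul_apply]
  refine Submodule.sum_mem _ fun l _ => ?_
  have := FractionalIdeal.mul_mem_mul (h.upperRight_mem i l)
    (adjugate_mem hI h.lowerRight_mem l j)
  rwa [show (L.halfNorm * different K)⁻¹ * ((I i)⁻¹ * (I l)⁻¹) *
    (I l * (I j)⁻¹) = (L.halfNorm * different K)⁻¹ *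
      ((I i)⁻¹ * (I j)⁻¹) by
        have h1 := hI l
        generalize (L.halfNorm * different K)⁻¹ = δ
        field_simp] at this

theorem Gamma0Blocks.exists_det (h : Gamma0Blocks L I A B C D) (hI : ∀ j, I j ≠ 0) :
    ∃ y : 𝓞 K, algebraMap (𝓞 K) K y = D.det :=
  det_mem_one hI h.lowerRight_mem

/-- `det D` is prime to the level, as `ᵗA D ≡ 1` modulo the level. -/
theorem Gamma0Blocks.det_notMem (h : Gamma0Blocks L I A B C D) (hk : 0 < k)
    (hI : ∀ j, I j ≠ 0) {y : 𝓞 K} (hy : algebraMap (𝓞 K) K y = D.det) {v : Ideal (𝓞 K)}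
    [hv : v.IsPrime] (hv0 : v ≠ ⊥) (hlevel : L.level ≤ (v : FractionalIdeal (𝓞 K)⁰ K)) : y ∉ v := by
  have hA : A.transpose ∈ idealMatrix I fun j => (I j)⁻¹ := fun i j => by
    have := h.upperLeft_mem j i
    rwa [mul_comm] at this
  obtain ⟨a, ha⟩ := det_mem_one hI hA
  refine det_one_add_mul_notMem hv0 (E := C.transpose * B) (a := a) hI (fun i j => ?_) ?_
  · rw [Matrix.mul_apply]
    refine Submodule.sum_mem (_ : FractionalIdeal (𝓞 K)⁰ K).1 fun l _ => ?_
    have h1 := FractionalIdeal.mul_mem_mul (h.lowerLeft_mem l i) (h.upperRight_mem l j)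
    have e : L.level * (L.halfNorm * different K) * (I l * I i) *
        ((L.halfNorm * different K)⁻¹ * ((I l)⁻¹ * (I j)⁻¹)) =
        L.level * (I i * (I j)⁻¹) := by
      have h3 := hI l
      have h2 := mul_ne_zero (L.halfNorm_ne_zero hk) (different_ne_zero (K := K))
      generalize L.halfNorm * different K = δ at *
      calc _ = L.level * (δ * δ⁻¹) * ((I l * (I l)⁻¹) * (I i * (I j)⁻¹)) := by ring
        _ = _ := by rw [mul_inv_cancel₀ h3, mul_inv_cancel₀ h2, mul_one, one_mul]
    rw [e] at h1
    exact mul_le_mul_left hlevel _ h1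
  · rw [map_mul, hy, ← sub_eq_iff_eq_add.mp h.transpose_mul_sub, Matrix.det_mul]
    rw [← ha]

end QuadLattice
end HilbertSiegel

/-! ### The trace character and the cokernel of `D` -/

namespace HilbertSiegel

open IsDedekindDomain NumberField FractionalIdeal

section TraceCharacter

variable {K : Type*} [Field K] [NumberField K]

/-- The inverse different, as a submodule of `K`. -/
def inverseDifferent (K : Type*) [Field K] [NumberField K] : Submodule (𝓞 K) K :=
  ((QuadLattice.different K)⁻¹ : FractionalIdeal (𝓞 K)⁰ K)

theorem mem_inverseDifferent_iff {x : K} : x ∈ inverseDifferent K ↔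
    ∀ r : 𝓞 K, ∃ m : ℤ, (m : ℚ) = Algebra.trace ℚ K (algebraMap (𝓞 K) K r * x) := by
  rw [inverseDifferent, QuadLattice.different, coeIdeal_differentIdeal ℤ ℚ K (𝓞 K), inv_inv]
  have h1 : (1 : FractionalIdeal (𝓞 K)⁰ K) ≠ 0 := one_ne_zero
  rw [FractionalIdeal.mem_coe, FractionalIdeal.mem_dual h1]
  constructor
  · intro h r
    obtain ⟨m, hm⟩ := h (algebraMap (𝓞 K) K r) ((mem_one_iff _).mpr ⟨r, rfl⟩)
    refine ⟨m, ?_⟩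
    rw [Algebra.traceForm_apply, mul_comm] at hm
    simpa using hm
  · rintro h a ha
    obtain ⟨r, rfl⟩ := (mem_one_iff _).mp ha
    obtain ⟨m, hm⟩ := h r
    refine ⟨m, ?_⟩
    rw [Algebra.traceForm_apply, mul_comm]
    simpa using hm

/-- The exponential `exp(2πi Tr(x))` on `K`. -/
def traceExp (x : K) : ℂ :=
  Complex.exp (2 * Real.pi * Complex.I * (Algebra.trace ℚ K x : ℚ))

theorem traceExp_add (x y : K) : traceExp (x + y) = traceExp x * traceExp y := by
  rw [traceExp, traceExp, traceExp, ← Complex.exp_add, map_add]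
  congr 1
  push_cast
  ring

theorem traceExp_eq_one_iff (x : K) :
    traceExp x = 1 ↔ ∃ m : ℤ, (m : ℚ) = Algebra.trace ℚ K x := by
  rw [traceExp, Complex.exp_eq_one_iff]
  refine exists_congr fun m => ?_
  have h0 : (2 * Real.pi * Complex.I : ℂ) ≠ 0 := by simp [Real.pi_ne_zero]
  constructor
  · intro h
    have h1 : (2 * Real.pi * Complex.I : ℂ) * ((Algebra.trace ℚ K x : ℚ) : ℂ) =
      (2 * Real.pi * Complex.I : ℂ) * (m : ℂ) := by rw [h]; ring
    have h2 := mul_left_cancel₀ h0 h1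
    exact_mod_cast h2.symm
  · intro h
    rw [← h]
    push_cast
    ring

theorem traceExp_eq_one_of_mem {x : K} (hx : x ∈ inverseDifferent K) : traceExp x = 1 := by
  rw [traceExp_eq_one_iff]
  simpa using mem_inverseDifferent_iff.mp hx 1

theorem traceExp_congr {x y : K} (h : x - y ∈ inverseDifferent K) : traceExp x = traceExp y := by
  have := traceExp_add (x - y) y
  rw [sub_add_cancel, traceExp_eq_one_of_mem h, one_mul] at this
  exact this

/-- The additive character of `K / 𝔡⁻¹`, `𝔡` the different, induced by `exp(2πi Tr(x))`. -/
def traceChar (K : Type*) [Field K] [NumberField K] : AddChar (K ⧸ inverseDifferent K) ℂ where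
  toFun w := traceExp w.out
  map_zero_eq_one' := traceExp_eq_one_of_mem (by
    rw [← Submodule.Quotient.mk_eq_zero, ← Submodule.Quotient.mk''_eq_mk, Quotient.out_eq'])
  map_add_eq_mul' w w' := by
    rw [← traceExp_add]
    refine traceExp_congr ?_
    rw [← Submodule.Quotient.eq, Submodule.Quotient.mk_add]
    simp only [← Submodule.Quotient.mk''_eq_mk, Quotient.out_eq']

theorem traceChar_mk (x : K) : traceChar K (Submodule.Quotient.mk x) = traceExp x := by
  refine traceExp_congr ?_
  rw [← Submodule.Quotient.eq]
  simp only [← Submodule.Quotient.mk''_eq_mk, Quotient.out_eq']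

/-- By duality of the trace form, the kernel of the character contains no nonzero submodule. -/
theorem traceChar_primitive (w : K ⧸ inverseDifferent K) (h : ∀ r : 𝓞 K, traceChar K (r • w) = 1) :
    w = 0 := by
  obtain ⟨x, rfl⟩ := Submodule.mkQ_surjective _ w
  rw [Submodule.mkQ_apply] at h ⊢
  rw [Submodule.Quotient.mk_eq_zero, mem_inverseDifferent_iff]
  intro r
  rw [← traceExp_eq_one_iff, ← h r, ← Submodule.Quotient.mk_smul, traceChar_mk, Algebra.smul_def]

end TraceCharacter

section Cokernel

variable {K : Type*} [Field K] [NumberField K] {n : ℕ} {I : Fin n → FractionalIdeal (𝓞 K)⁰ K}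
  {J : Ideal (𝓞 K)} (g : ∀ j, ApproxGenerator (I j) J) (D : Matrix (Fin n) (Fin n) K)

/-- The vector in `ℐ_1 ⊕ ⋯ ⊕ ℐ_n` with coordinates `u` with respect to the chosen generators. -/
def scale (u : Fin n → 𝓞 K) : Fin n → K := fun j => (g j).gen * algebraMap (𝓞 K) K (u j)

theorem scale_add (u u' : Fin n → 𝓞 K) : scale g (u + u') = scale g u + scale g u' := by
  ext j; simp [scale, mul_add]

theorem scale_smul (r : 𝓞 K) (u : Fin n → 𝓞 K) : scale g (r • u) = r • scale g u := by
  ext j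
  rw [scale, Pi.smul_apply, Pi.smul_apply, Algebra.smul_def r (scale g u j), smul_eq_mul, map_mul,
    scale]
  ring

theorem scale_mem (u : Fin n → 𝓞 K) (j : Fin n) : scale g u j ∈ I j := by
  rw [scale, mul_comm, ← Algebra.smul_def]
  exact (I j).1.smul_mem _ (g j).gen_mem

/-- The vectors `u` over `𝓞 K` whose scaling lies in `D (ℐ_1 ⊕ ⋯ ⊕ ℐ_n)`. -/
def relations : Submodule (𝓞 K) (Fin n → 𝓞 K) where
  carrier := {u | ∀ j, D⁻¹.mulVec (scale g u) j ∈ I j}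
  add_mem' {u u'} hu hu' j := by
    rw [scale_add, Matrix.mulVec_add]
    exact (I j).1.add_mem (hu j) (hu' j)
  zero_mem' j := by
    have : scale g 0 = 0 := by ext; simp [scale]
    rw [this, Matrix.mulVec_zero]
    exact (I j).1.zero_mem
  smul_mem' r u hu j := by
    rw [scale_smul, Matrix.mulVec_smul]
    exact (I j).1.smul_mem r (hu j)

variable {g D}

theorem mem_relations {u : Fin n → 𝓞 K} :
    u ∈ relations g D ↔ ∀ j, D⁻¹.mulVec (scale g u) j ∈ I j := Iff.rfl

theorem mem_relations_of_forall_mem (hI : ∀ j, I j ≠ 0) (hD : D ∈ idealMatrix I fun j => (I j)⁻¹)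
    (hdet : D.det ≠ 0) {y : 𝓞 K} (hy : algebraMap (𝓞 K) K y = D.det) {u : Fin n → 𝓞 K}
    (hu : ∀ j, u j ∈ Ideal.span {y}) : u ∈ relations g D := by
  choose r hr using fun j => Ideal.mem_span_singleton'.mp (hu j)
  have e : u = y • r := by ext j; rw [Pi.smul_apply, smul_eq_mul, mul_comm, hr]
  intro j
  have := mul_inv_mulVec_mem (a := 1) hI hD hdet hy (Ideal.mem_span_singleton_self y)
    (x := scale g r) (fun j => by rw [one_mul]; exact scale_mem g r j) j
  rw [one_mul] at this
  rwa [e, scale_smul, Matrix.mulVec_smul, Pi.smul_apply, Algebra.smul_def]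

theorem isTorsionBySet_cokernel (hI : ∀ j, I j ≠ 0) (hD : D ∈ idealMatrix I fun j => (I j)⁻¹)
    (hdet : D.det ≠ 0) {y : 𝓞 K} (hy : algebraMap (𝓞 K) K y = D.det) (hJ : J ≤ Ideal.span {y}) :
    Module.IsTorsionBySet (𝓞 K) ((Fin n → 𝓞 K) ⧸ relations g D) J := by
  rintro x ⟨a, ha⟩
  obtain ⟨u, rfl⟩ := Submodule.mkQ_surjective _ x
  rw [← map_smul, Submodule.mkQ_apply, Submodule.Quotient.mk_eq_zero]
  exact mem_relations_of_forall_mem hI hD hdet hy fun j => hJ (Ideal.mul_mem_right _ _ ha)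

theorem finite_cokernel (hI : ∀ j, I j ≠ 0) (hD : D ∈ idealMatrix I fun j => (I j)⁻¹)
    (hdet : D.det ≠ 0) {y : 𝓞 K} (hy : algebraMap (𝓞 K) K y = D.det) :
    Finite ((Fin n → 𝓞 K) ⧸ relations g D) := by
  have hy0 : y ≠ 0 := by
    rintro rfl; rw [map_zero] at hy; exact hdet hy.symm
  have : Finite (𝓞 K ⧸ Ideal.span {y}) := Ideal.finiteQuotientOfFreeOfNeBot _ (by simpa using hy0)
  refine Finite.of_surjective (α := Fin n → 𝓞 K ⧸ Ideal.span {y})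
    (fun w => Submodule.Quotient.mk fun j => (w j).out) fun x => ?_
  obtain ⟨u, rfl⟩ := Submodule.mkQ_surjective _ x
  refine ⟨fun j => Ideal.Quotient.mk _ (u j), ?_⟩
  rw [Submodule.mkQ_apply, Submodule.Quotient.eq]
  refine mem_relations_of_forall_mem hI hD hdet hy fun j => ?_
  rw [Pi.sub_apply, ← Ideal.Quotient.eq]
  exact Quotient.out_eq' _

/-- The order of the `p`-primary part of the cokernel of `D`. -/
theorem card_torsionBySet_cokernel (hI : ∀ j, I j ≠ 0) (hD : D ∈ idealMatrix I fun j => (I j)⁻¹)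
    (hdet : D.det ≠ 0) {y : 𝓞 K} (hy : algebraMap (𝓞 K) K y = D.det) (hJ : J ≤ Ideal.span {y})
    {p : Ideal (𝓞 K)} [hp : p.IsPrime] (hp0 : p ≠ ⊥) (hJp : J ≤ p) {f N : ℕ} (hfN : f ≤ N)
    (hf : y ∈ p ^ f) (hf' : y ∉ p ^ (f + 1)) {J' : Ideal (𝓞 K)} (hJ' : J = p ^ N * J')
    (hcop : p ^ N ⊔ J' = ⊤) :
    Nat.card (Submodule.torsionBySet (𝓞 K) ((Fin n → 𝓞 K) ⧸ relations g D) (p ^ N : Ideal (𝓞 K))) =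
      Nat.card (𝓞 K ⧸ p) ^ f := by
  have hpm : p.IsMaximal := hp.isMaximal hp0
  have hu : IsUnit D.det := isUnit_iff_ne_zero.mpr hdet
  obtain ⟨F, -, hF⟩ := exists_integral_conj g (𝔟 := ⊤) (E := D)
    (fun i j => by simpa using hD i j) hI
  set θ := ∏ l, (g l).unit with hθ
  have hθp : θ ∉ p := notMem_of_sub_one_mem hp.ne_top
    (prod_sub_one_mem _ fun l _ => hJp (g l).unit_sub_one_mem)
  have hFdet : F.det = θ ^ n * y := by
    apply RingOfIntegers.coe_injective
    rw [map_mul, hy, map_pow]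
    exact det_of_conj g hF
  have hscale : ∀ w, scale g (F.mulVec w) = D.mulVec (θ • scale g w) := by
    intro w
    ext i
    simp only [scale, Matrix.mulVec, dotProduct, map_sum, map_mul, hF, Finset.mul_sum,
      Pi.smul_apply, Algebra.smul_def]
    refine Finset.sum_congr rfl fun j _ => ?_
    have := (g i).gen_ne_zero
    field_simp
  refine card_torsionBySet_of_presentation hp0 F hfN ?_ ?_ (relations g D).mkQ
    (Submodule.mkQ_surjective _) (fun w => ?_) (fun u hu0 => ?_) hcop (fun a ha b hb x => ?_)
  · rw [hFdet]; exact Ideal.mul_mem_left _ _ hf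
  · rw [hFdet]
    intro h
    rcases Ideal.IsMaximal.mul_mem_pow p h with h1 | h1
    · exact hθp (hp.mem_of_pow_mem _ h1)
    · exact hf' h1
  · rw [Submodule.mkQ_apply, Submodule.Quotient.mk_eq_zero, mem_relations]
    intro j
    rw [hscale, Matrix.mulVec_mulVec, Matrix.nonsing_inv_mul _ hu, Matrix.one_mulVec]
    exact (I j).1.smul_mem θ (scale_mem g w j)
  · rw [Submodule.mkQ_apply, Submodule.Quotient.mk_eq_zero, mem_relations] at hu0
    have key : ∀ i, ∃ r : 𝓞 K, algebraMap (𝓞 K) K r =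
        algebraMap (𝓞 K) K θ * ((g i).gen⁻¹ * D⁻¹.mulVec (scale g u) i) := by
      intro i
      obtain ⟨r, hr⟩ := mul_mem_one (hI i) (hu0 i) (g i).inv_mem
      refine ⟨(∏ l ∈ Finset.univ.erase i, (g l).unit) * r, ?_⟩
      rw [hθ, ← Finset.mul_prod_erase _ _ (Finset.mem_univ i), map_mul, map_mul,
        show algebraMap (𝓞 K) K r = _ from hr, ← (g i).mul_eq]
      have := (g i).gen_ne_zero
      field_simp
    choose w hw using key
    refine ⟨θ ^ 2, fun h => hθp (hp.mem_of_pow_mem _ h), w, ?_⟩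
    have e1 : scale g w = θ • D⁻¹.mulVec (scale g u) := by
      ext i
      rw [scale, hw, Pi.smul_apply, Algebra.smul_def]
      have := (g i).gen_ne_zero
      field_simp
    have e2 : scale g (F.mulVec w) = scale g (θ ^ 2 • u) := by
      rw [hscale, e1, smul_smul, ← sq, Matrix.mulVec_smul, Matrix.mulVec_mulVec,
        Matrix.mul_nonsing_inv _ hu, Matrix.one_mulVec, scale_smul]
    ext i
    have e3 := congrFun e2 i
    rw [scale, scale] at e3
    have e4 := mul_left_cancel₀ (g i).gen_ne_zero e3
    rw [← RingOfIntegers.coe_injective e4]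
  · exact @isTorsionBySet_cokernel K _ _ n I J g D hI hD hdet y hy hJ x
      ⟨a * b, hJ' ▸ Ideal.mul_mem_mul ha hb⟩

end Cokernel
end HilbertSiegel

/-! ### The form on the cokernel -/

namespace HilbertSiegel

open IsDedekindDomain NumberField FractionalIdeal QuadLattice

section CokernelForm

variable {K : Type*} [Field K] [NumberField K] {n : ℕ} {I : Fin n → FractionalIdeal (𝓞 K)⁰ K}
  {J : Ideal (𝓞 K)} (g : ∀ j, ApproxGenerator (I j) J)

theorem mem_inverseDifferent_of_mem {x : K} (h : x ∈ (different K)⁻¹) : x ∈ inverseDifferent K := h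

/-- The bilinear form with Gram matrix `t S`, with respect to the chosen generators, with values
in `K` modulo the inverse different. -/
def scaledForm (t : K) (S : Matrix (Fin n) (Fin n) K) :
    (Fin n → 𝓞 K) →ₗ[𝓞 K] (Fin n → 𝓞 K) →ₗ[𝓞 K] K ⧸ inverseDifferent K :=
  LinearMap.mk₂ (𝓞 K)
    (fun u u' => Submodule.Quotient.mk (t * (scale g u ⬝ᵥ S.mulVec (scale g u'))))
    (fun u u' w => by
      rw [← Submodule.Quotient.mk_add, scale_add, add_dotProduct, mul_add])
    (fun r u w => by
      rw [← Submodule.Quotient.mk_smul, scale_smul, smul_dotProduct, mul_smul_comm])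
    (fun u w w' => by
      rw [← Submodule.Quotient.mk_add, scale_add, Matrix.mulVec_add, dotProduct_add, mul_add])
    (fun r u w => by
      rw [← Submodule.Quotient.mk_smul, scale_smul, Matrix.mulVec_smul, dotProduct_smul,
        mul_smul_comm])

theorem scaledForm_apply (t : K) (S : Matrix (Fin n) (Fin n) K) (u u' : Fin n → 𝓞 K) :
    scaledForm g t S u u' =
      Submodule.Quotient.mk (t * (scale g u ⬝ᵥ S.mulVec (scale g u'))) := rfl

theorem scaledForm_symm {t : K} {S : Matrix (Fin n) (Fin n) K} (hS : S.IsSymm)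
    (u u' : Fin n → 𝓞 K) : scaledForm g t S u u' = scaledForm g t S u' u := by
  rw [scaledForm_apply, scaledForm_apply, Matrix.dotProduct_mulVec, ← Matrix.mulVec_transpose, hS,
    dotProduct_comm]

theorem halfNorm_approxGenerator_inv_mem {k : ℕ} {L : QuadLattice K k}
    (η : ApproxGenerator L.halfNorm⁻¹ J) : η.inv ∈ L.halfNorm := by
  have := η.inv_mem
  rwa [inv_inv] at this

variable [IsTotallyReal K] {k : ℕ} {L : QuadLattice K k} {A B C D : Matrix (Fin n) (Fin n) K}

namespace QuadLattice.Gamma0Blocks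

variable {g}

theorem scaledForm_eq_zero (h : Gamma0Blocks L I A B C D) (hk : 0 < k) (hI : ∀ j, I j ≠ 0)
    (hD : D.det ≠ 0) {t : K} (ht : t ∈ L.halfNorm) (u : Fin n → 𝓞 K)
    {u' : Fin n → 𝓞 K} (hu' : u' ∈ relations g D) :
    scaledForm g t (B * D⁻¹) u u' = 0 := by
  have hu : IsUnit D.det := isUnit_iff_ne_zero.mpr hD
  rw [scaledForm_apply, Submodule.Quotient.mk_eq_zero]
  rw [← Matrix.mulVec_mulVec, dotProduct, Finset.mul_sum]
  refine Submodule.sum_mem _ fun a _ => ?_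
  rw [Matrix.mulVec, dotProduct, Finset.mul_sum, Finset.mul_sum]
  refine Submodule.sum_mem _ fun b _ => mem_inverseDifferent_of_mem ?_
  have h1 := FractionalIdeal.mul_mem_mul ht (FractionalIdeal.mul_mem_mul (scale_mem g u a)
    (FractionalIdeal.mul_mem_mul (h.upperRight_mem a b) (hu' b)))
  have e : L.halfNorm * (I a * ((L.halfNorm * different K)⁻¹ * ((I a)⁻¹ * (I b)⁻¹) * I b)) =
      (different K)⁻¹ := by
    have h1 := hI a
    have h2 := hI b
    have h3 := L.halfNorm_ne_zero hk
    have h4 := different_ne_zero (K := K)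
    generalize L.halfNorm = N at *
    generalize different K = δ at *
    field_simp
  rwa [e] at h1

end QuadLattice.Gamma0Blocks

/-- The form on the cokernel of `D` with Gram matrix `t B D⁻¹`. -/
def cokernelForm (h : Gamma0Blocks L I A B C D) (hk : 0 < k) (hI : ∀ j, I j ≠ 0) (hD : D.det ≠ 0)
    {t : K} (ht : t ∈ L.halfNorm) :
    ((Fin n → 𝓞 K) ⧸ relations g D) →ₗ[𝓞 K] ((Fin n → 𝓞 K) ⧸ relations g D) →ₗ[𝓞 K]
      K ⧸ inverseDifferent K :=
  (scaledForm g t (B * D⁻¹)).liftQ₂ _ _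
    (fun u hu => LinearMap.ext fun u' => by
      rw [scaledForm_symm g (h.isSymm hD)]
      exact h.scaledForm_eq_zero hk hI hD ht u' hu)
    (fun _u' hu' => LinearMap.ext fun u => h.scaledForm_eq_zero hk hI hD ht u hu')

/-- The form on the cokernel of `D` is perfect: its radical is controlled by the identity
`D⁻¹ = ᵗA - ᵗC (B D⁻¹)`. -/
theorem isPerfectForm_cokernelForm (h : Gamma0Blocks L I A B C D) (hk : 0 < k) (hI : ∀ j, I j ≠ 0)
    (hD : D.det ≠ 0) {y : 𝓞 K} (hy : algebraMap (𝓞 K) K y = D.det) (hJ : J ≤ Ideal.span {y})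
    (η : ApproxGenerator L.halfNorm⁻¹ J) :
    IsPerfectForm (traceChar K)
      (cokernelForm g h hk hI hD (halfNorm_approxGenerator_inv_mem η)) where
  primitive := traceChar_primitive
  symm x x' := by
    obtain ⟨u, rfl⟩ := Submodule.mkQ_surjective _ x
    obtain ⟨u', rfl⟩ := Submodule.mkQ_surjective _ x'
    exact scaledForm_symm g (h.isSymm hD) u u'
  nondegenerate x hx := by
    obtain ⟨u, rfl⟩ := Submodule.mkQ_surjective _ x
    rw [Submodule.mkQ_apply, Submodule.Quotient.mk_eq_zero]
    set z := (B * D⁻¹).mulVec (scale g u) with hz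
    have hz1 : ∀ j, η.inv * ((g j).gen * z j) ∈ (different K)⁻¹ := by
      intro j
      have h1 := hx (Submodule.Quotient.mk (Pi.single j 1))
      change scaledForm g _ _ u (Pi.single j 1) = 0 at h1
      rw [scaledForm_symm g (h.isSymm hD), scaledForm_apply, Submodule.Quotient.mk_eq_zero] at h1
      have e : scale g (Pi.single j 1) = Pi.single j (g j).gen := by
        ext l
        by_cases hl : l = j
        · subst hl; simp [scale]
        · simp [scale, hl]
      rw [e, single_dotProduct] at h1
      exact h1
    set θ := η.unit * ∏ l, (g l).unit with hθ
    have hθ1 : θ - 1 ∈ Ideal.span {y} := by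
      refine hJ ?_
      rw [show θ - 1 = (∏ l, (g l).unit) * (η.unit - 1) + (∏ l, (g l).unit - 1) by rw [hθ]; ring]
      exact add_mem (Ideal.mul_mem_left _ _ η.unit_sub_one_mem)
        (prod_sub_one_mem _ fun l _ => (g l).unit_sub_one_mem)
    have hCz : ∀ i, algebraMap (𝓞 K) K θ * C.transpose.mulVec z i ∈ I i := by
      intro i
      rw [Matrix.mulVec, dotProduct, Finset.mul_sum]
      refine Submodule.sum_mem (I i).1 fun l _ => ?_
      have h1 := FractionalIdeal.mul_mem_mul (h.lowerLeft_mem l i) (FractionalIdeal.mul_mem_mul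
        η.gen_mem (FractionalIdeal.mul_mem_mul (g l).inv_mem (hz1 l)))
      have e1 : L.level * (L.halfNorm * different K) * (I l * I i) *
          (L.halfNorm⁻¹ * ((I l)⁻¹ * (different K)⁻¹)) = L.level * I i := by
        calc _ = L.level * I i * ((L.halfNorm * L.halfNorm⁻¹) *
              (different K * (different K)⁻¹) * (I l * (I l)⁻¹)) := by ring
          _ = _ := by
            rw [mul_inv_cancel₀ (hI l), mul_inv_cancel₀ (L.halfNorm_ne_zero hk),
              mul_inv_cancel₀ different_ne_zero, mul_one, mul_one, mul_one]
      rw [e1] at h1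
      have h2 : L.level * I i ≤ I i := by
        conv_rhs => rw [← one_mul (I i)]
        exact mul_le_mul_left (L.level_le_one hk) _
      have e2 : algebraMap (𝓞 K) K θ * (C.transpose i l * z l) =
          (∏ l' ∈ Finset.univ.erase l, (g l').unit) •
            (C l i * (η.gen * ((g l).inv * (η.inv * ((g l).gen * z l))))) := by
        rw [hθ, ← Finset.mul_prod_erase _ _ (Finset.mem_univ l), Algebra.smul_def, map_mul, map_mul,
          ← η.mul_eq, ← (g l).mul_eq, Matrix.transpose_apply]
        ring
      rw [e2]
      exact (I i).1.smul_mem _ (h2 h1)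
    rw [mem_relations]
    intro i
    have hA : ∀ i, A.transpose.mulVec (scale g u) i ∈ I i := by
      intro i
      rw [Matrix.mulVec, dotProduct]
      refine Submodule.sum_mem (I i).1 fun l _ => ?_
      have h1 := FractionalIdeal.mul_mem_mul (h.upperLeft_mem l i) (scale_mem g u l)
      rwa [show (I l)⁻¹ * I i * I l = I i by have := hI l; field_simp] at h1
    have h1 : algebraMap (𝓞 K) K θ * D⁻¹.mulVec (scale g u) i ∈ I i := by
      rw [h.inv_eq hD, Matrix.sub_mulVec, ← Matrix.mulVec_mulVec, Pi.sub_apply, mul_sub]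
      refine Submodule.sub_mem (I i).1 ?_ (hCz i)
      rw [← Algebra.smul_def]
      exact (I i).1.smul_mem _ (hA i)
    have h2 := mul_inv_mulVec_mem (a := 1) hI h.lowerRight_mem hD hy hθ1 (x := scale g u)
      (fun j => by rw [one_mul]; exact scale_mem g u j) i
    rw [one_mul] at h2
    have h3 := Submodule.sub_mem (I i).1 h1 h2
    rwa [← sub_mul, map_sub, map_one, sub_sub_cancel, one_mul] at h3

end CokernelForm
end HilbertSiegel

/-! ### Representatives and coordinates -/

namespace HilbertSiegel

open IsDedekindDomain NumberField FractionalIdeal QuadLattice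

section RepresentativeSystem

variable {K : Type*} [Field K] {V X E : Type*} [AddCommGroup V] [Module (𝓞 K) V]
  [Fintype X] [AddCommMonoid E] {M M' : Submodule (𝓞 K) V} {F : V → X}

theorem exists_isRepresentativeSystem (hF : ∀ U ∈ M, ∀ U' ∈ M, U - U' ∈ M' ↔ F U = F U')
    (hsurj : ∀ x, ∃ U ∈ M, F U = x) : ∃ S : Finset V, IsRepresentativeSystem M M' S := by
  classical
  choose r hr hFr using hsurj
  refine ⟨Finset.univ.image r, fun U hU => ?_, fun U hU => ?_⟩
  · obtain ⟨x, -, rfl⟩ := Finset.mem_image.mp hU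
    exact hr x
  · refine ⟨r (F U), ⟨Finset.mem_image_of_mem _ (Finset.mem_univ _), ?_⟩, ?_⟩
    · rw [hF U hU _ (hr _), hFr]
    · rintro V ⟨hV, hUV⟩
      obtain ⟨x, -, rfl⟩ := Finset.mem_image.mp hV
      rw [hF U hU _ (hr _), hFr] at hUV
      rw [hUV]

/-- If `F` is a complete invariant of the classes modulo `M'` with values in `X`, a sum over
representatives is a sum over `X`, independently of the representatives. -/
theorem IsRepresentativeSystem.sum_eq (hF : ∀ U ∈ M, ∀ U' ∈ M, U - U' ∈ M' ↔ F U = F U')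
    (hsurj : ∀ x, ∃ U ∈ M, F U = x) {S : Finset V} (hS : IsRepresentativeSystem M M' S)
    {f : V → E} {G : X → E} (hfG : ∀ U ∈ M, f U = G (F U)) : ∑ U ∈ S, f U = ∑ x, G x := by
  refine Finset.sum_nbij F (fun _ _ => Finset.mem_univ _) (fun U hU U' hU' h => ?_)
    (fun x _ => ?_) fun U hU => hfG U (hS.1 U hU)
  · obtain ⟨W, -, hW⟩ := hS.2 U (hS.1 U hU)
    rw [hW U' ⟨hU', (hF U (hS.1 U hU) U' (hS.1 U' hU')).mpr h⟩]
    exact hW U ⟨hU, (hF U (hS.1 U hU) U (hS.1 U hU)).mpr rfl⟩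
  · obtain ⟨U, hU, rfl⟩ := hsurj x
    obtain ⟨W, ⟨hW, hUW⟩, -⟩ := hS.2 U hU
    exact ⟨W, hW, ((hF U hU W (hS.1 W hW)).mp hUW).symm⟩

end RepresentativeSystem

section Coordinates

variable {K : Type*} [Field K] [NumberField K] {k n : ℕ} {L : QuadLattice K k}
  {I : Fin n → FractionalIdeal (𝓞 K)⁰ K} {D : Matrix (Fin n) (Fin n) K} {J : Ideal (𝓞 K)}

/-- Entries may be multiplied by factors that are `1` modulo `det D` without leaving the coset
modulo `D (𝔞ℐ_1 ⊕ ⋯ ⊕ 𝔞ℐ_n)`. -/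
theorem inv_mulVec_mul_mem_iff {a : FractionalIdeal (𝓞 K)⁰ K} (hI : ∀ j, I j ≠ 0)
    (hD : D ∈ idealMatrix I fun j => (I j)⁻¹) (hdet : D.det ≠ 0) {y : 𝓞 K}
    (hy : algebraMap (𝓞 K) K y = D.det) {θ : Fin n → 𝓞 K} (hθ : ∀ j, θ j - 1 ∈ Ideal.span {y})
    {x : Fin n → K} (hx : ∀ j, x j ∈ a * I j) (j : Fin n) :
    D⁻¹.mulVec (fun l => algebraMap (𝓞 K) K (θ l) * x l) j ∈ a * I j ↔
      D⁻¹.mulVec x j ∈ a * I j := by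
  choose r hr using fun l => Ideal.mem_span_singleton'.mp (hθ l)
  have h1 := mul_inv_mulVec_mem hI hD hdet hy (Ideal.mem_span_singleton_self y) (a := a)
    (x := fun l => r l • x l) (fun l => (a * I l).1.smul_mem _ (hx l)) j
  have e : D⁻¹.mulVec (fun l => algebraMap (𝓞 K) K (θ l) * x l) j =
      D⁻¹.mulVec x j + algebraMap (𝓞 K) K y * D⁻¹.mulVec (fun l => r l • x l) j := by
    rw [← smul_eq_mul (algebraMap (𝓞 K) K y), ← Pi.smul_apply, ← Matrix.mulVec_smul,
      ← Pi.add_apply, ← Matrix.mulVec_add]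
    congr 2
    ext l
    simp only [Pi.add_apply, Pi.smul_apply, smul_eq_mul]
    rw [Algebra.smul_def, ← mul_assoc, ← map_mul,
      mul_comm y, hr, map_sub, map_one]
    ring
  rw [e]
  exact (a * I j).1.add_mem_iff_left h1

variable (α : ∀ i, ApproxGenerator (L.A i) J) (g : ∀ j, ApproxGenerator (I j) J)

theorem exists_coordinates (hI : ∀ j, I j ≠ 0) {U : Matrix (Fin (2 * k)) (Fin n) K}
    (hU : U ∈ L.latticeMatrix I) :
    ∃ u : Fin (2 * k) → Fin n → 𝓞 K,
      ∀ i j, algebraMap (𝓞 K) K (u i j) = (α i).inv * (g j).inv * U i j := by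
  have key : ∀ i j, ∃ r : 𝓞 K, algebraMap (𝓞 K) K r = (α i).inv * (g j).inv * U i j := by
    intro i j
    have h1 := FractionalIdeal.mul_mem_mul (α i).inv_mem (g j).inv_mem
    rw [← mul_inv] at h1
    obtain ⟨r, hr⟩ := mul_mem_one (mul_ne_zero (L.A_ne_zero i) (hI j)) (hU i j) h1
    exact ⟨r, by rw [show algebraMap (𝓞 K) K r = _ from hr]; ring⟩
  choose u hu using key
  exact ⟨u, hu⟩

/-- The coordinates of an entrywise multiple of `U`; they determine the class of `U` modulo
`ℒ' ᵗD`. -/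
def coordinates (hI : ∀ j, I j ≠ 0) (U : L.latticeMatrix I) : Fin (2 * k) → Fin n → 𝓞 K :=
  (exists_coordinates α g hI U.2).choose

variable {α g}

theorem coordinates_spec (hI : ∀ j, I j ≠ 0) (U : L.latticeMatrix I) (i : Fin (2 * k))
    (j : Fin n) : algebraMap (𝓞 K) K (coordinates α g hI U i j) =
      (α i).inv * (g j).inv * U.1 i j :=
  (exists_coordinates α g hI U.2).choose_spec i j

/-- Membership in `ℒ' ᵗD` is decided row by row in coordinates. -/
theorem mem_latticeMatrixMul_iff_relations (hI : ∀ j, I j ≠ 0)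
    (hD : D ∈ idealMatrix I fun j => (I j)⁻¹) (hdet : D.det ≠ 0) {y : 𝓞 K}
    (hy : algebraMap (𝓞 K) K y = D.det) (hJ : J ≤ Ideal.span {y})
    {U : Matrix (Fin (2 * k)) (Fin n) K} (hU : U ∈ L.latticeMatrix I)
    {u : Fin (2 * k) → Fin n → 𝓞 K}
    (hu : ∀ i j, algebraMap (𝓞 K) K (u i j) = (α i).inv * (g j).inv * U i j) :
    U ∈ L.latticeMatrixMul I D ↔ ∀ i, u i ∈ relations g D := by
  have e1 : ∀ i, scale g (u i) =
      (α i).inv • fun j => algebraMap (𝓞 K) K (g j).unit * U i j := fun i => by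
    ext j
    rw [scale, hu, Pi.smul_apply, smul_eq_mul, ← (g j).mul_eq]
    ring
  have e2 : ∀ i, (α i).gen • scale g (u i) =
      fun j => algebraMap (𝓞 K) K ((α i).unit * (g j).unit) * U i j := fun i => by
    ext j
    rw [e1, map_mul, ← (α i).mul_eq]
    simp only [Pi.smul_apply, smul_eq_mul]
    ring
  rw [mem_latticeMatrixMul_iff hdet]
  refine forall_congr' fun i => ?_
  rw [mem_relations]
  refine forall_congr' fun j => ⟨fun h => ?_, fun h => ?_⟩
  · rw [e1, Matrix.mulVec_smul, Pi.smul_apply, smul_eq_mul]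
    have h1 := FractionalIdeal.mul_mem_mul (α i).inv_mem ((inv_mulVec_mul_mem_iff hI hD hdet hy
      (fun l => hJ (g l).unit_sub_one_mem) (fun l => hU i l) j).mpr h)
    rwa [inv_mul_cancel_left₀ (L.A_ne_zero i)] at h1
  · have h1 := FractionalIdeal.mul_mem_mul (α i).gen_mem h
    rw [← smul_eq_mul (α i).gen, ← Pi.smul_apply, ← Matrix.mulVec_smul, e2] at h1
    refine (inv_mulVec_mul_mem_iff hI hD hdet hy (fun l => hJ ?_) (fun l => hU i l) j).mp h1
    rw [show (α i).unit * (g l).unit - 1 =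
      (α i).unit * ((g l).unit - 1) + ((α i).unit - 1) by ring]
    exact add_mem (Ideal.mul_mem_left _ _ (g l).unit_sub_one_mem) (α i).unit_sub_one_mem

variable (α g)

open Classical in
/-- The class of a matrix `U` in `ℒ'` modulo `ℒ' ᵗD`, read off in coordinates; `0` outside `ℒ'`. -/
def cokernelClass (hI : ∀ j, I j ≠ 0) (D : Matrix (Fin n) (Fin n) K)
    (U : Matrix (Fin (2 * k)) (Fin n) K) : Fin (2 * k) → (Fin n → 𝓞 K) ⧸ relations g D :=
  if hU : U ∈ L.latticeMatrix I then
    fun i => Submodule.Quotient.mk (coordinates α g hI ⟨U, hU⟩ i) else 0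

variable {α g}

theorem cokernelClass_eq (hI : ∀ j, I j ≠ 0) {U : Matrix (Fin (2 * k)) (Fin n) K}
    (hU : U ∈ L.latticeMatrix I) {u : Fin (2 * k) → Fin n → 𝓞 K}
    (hu : ∀ i j, algebraMap (𝓞 K) K (u i j) = (α i).inv * (g j).inv * U i j) :
    cokernelClass α g hI D U = fun i => Submodule.Quotient.mk (u i) := by
  rw [cokernelClass, dif_pos hU]
  have : coordinates α g hI ⟨U, hU⟩ = u := by
    funext i j
    apply RingOfIntegers.coe_injective
    rw [coordinates_spec, hu]
  rw [this]

theorem cokernelClass_eq_iff (hI : ∀ j, I j ≠ 0)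
    (hD : D ∈ idealMatrix I fun j => (I j)⁻¹) (hdet : D.det ≠ 0) {y : 𝓞 K}
    (hy : algebraMap (𝓞 K) K y = D.det) (hJ : J ≤ Ideal.span {y})
    {U U' : Matrix (Fin (2 * k)) (Fin n) K} (hU : U ∈ L.latticeMatrix I)
    (hU' : U' ∈ L.latticeMatrix I) :
    U - U' ∈ L.latticeMatrixMul I D ↔ cokernelClass α g hI D U = cokernelClass α g hI D U' := by
  obtain ⟨u, hu⟩ := exists_coordinates α g hI hU
  obtain ⟨u', hu'⟩ := exists_coordinates α g hI hU'
  rw [cokernelClass_eq hI hU hu, cokernelClass_eq hI hU' hu', funext_iff,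
    mem_latticeMatrixMul_iff_relations hI hD hdet hy hJ (sub_mem hU hU') (u := u - u')]
  · exact forall_congr' fun i => (Submodule.Quotient.eq _).symm
  · intro i j
    rw [Pi.sub_apply, Pi.sub_apply, map_sub, hu, hu', Matrix.sub_apply]
    ring

theorem exists_cokernelClass_eq (hI : ∀ j, I j ≠ 0)
    (hD : D ∈ idealMatrix I fun j => (I j)⁻¹) (hdet : D.det ≠ 0) {y : 𝓞 K}
    (hy : algebraMap (𝓞 K) K y = D.det) (hJ : J ≤ Ideal.span {y})
    (x : Fin (2 * k) → (Fin n → 𝓞 K) ⧸ relations g D) :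
    ∃ U ∈ L.latticeMatrix I, cokernelClass α g hI D U = x := by
  choose u hu using fun i => Submodule.mkQ_surjective _ (x i)
  have hU : (Matrix.of fun i j => u i j • ((α i).gen * (g j).gen)) ∈ L.latticeMatrix I := fun i j =>
    (L.A i * I j).1.smul_mem _ (FractionalIdeal.mul_mem_mul (α i).gen_mem (g j).gen_mem)
  refine ⟨_, hU, ?_⟩
  rw [cokernelClass_eq hI hU (u := fun i j => (α i).unit * (g j).unit * u i j)]
  · ext i
    rw [← hu, Submodule.mkQ_apply, Submodule.Quotient.eq]
    refine mem_relations_of_forall_mem hI hD hdet hy fun j => hJ ?_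
    rw [Pi.sub_apply, show (α i).unit * (g j).unit * u i j - u i j =
      u i j * ((α i).unit * ((g j).unit - 1) + ((α i).unit - 1)) by ring]
    exact Ideal.mul_mem_left _ _ (add_mem (Ideal.mul_mem_left _ _ (g j).unit_sub_one_mem)
      (α i).unit_sub_one_mem)
  · intro i j
    rw [map_mul, map_mul, ← (α i).mul_eq, ← (g j).mul_eq, Matrix.of_apply, Algebra.smul_def]
    ring

end Coordinates
end HilbertSiegel

/-! ### Comparison of the exponentials and of the symbols -/

namespace HilbertSiegel

open IsDedekindDomain NumberField FractionalIdeal QuadLattice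

section Phase

variable {K : Type*} [Field K] [NumberField K] {k n : ℕ} {L : QuadLattice K k}

theorem trace_gram_mul (U : Matrix (Fin (2 * k)) (Fin n) K) {S : Matrix (Fin n) (Fin n) K}
    (hS : S.IsSymm) : (U.transpose * L.Q * U * S).trace =
      2 * ∑ i, ∑ j, L.halfGram i j * (U i ⬝ᵥ S.mulVec (U j)) := by
  have e : ∀ i j, (U * S * U.transpose) j i = U i ⬝ᵥ S.mulVec (U j) := fun i j => by
    rw [Matrix.mul_apply]
    simp only [Matrix.mul_apply, Matrix.transpose_apply, dotProduct, Matrix.mulVec]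
    refine Finset.sum_congr rfl fun a _ => ?_
    rw [mul_comm]
    congr 1
    refine Finset.sum_congr rfl fun b _ => ?_
    rw [hS.apply, mul_comm]
  have e' : ∀ i j, U i ⬝ᵥ S.mulVec (U j) = U j ⬝ᵥ S.mulVec (U i) := fun i j => by
    rw [Matrix.dotProduct_mulVec, ← Matrix.mulVec_transpose, hS, dotProduct_comm]
  have h1 : (U.transpose * L.Q * U * S).trace = ∑ i, ∑ j, L.Q i j * (U i ⬝ᵥ S.mulVec (U j)) := by
    rw [Matrix.mul_assoc, Matrix.mul_assoc, Matrix.trace_mul_comm, Matrix.mul_assoc, Matrix.trace]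
    refine Finset.sum_congr rfl fun i _ => ?_
    rw [Matrix.diag_apply, Matrix.mul_apply]
    exact Finset.sum_congr rfl fun j _ => by rw [e]
  have hQ : ∀ i j, L.Q i j = L.halfGram i j + L.halfGram j i := fun i j =>
    (congrFun (congrFun L.halfGram_add_transpose i) j).symm
  rw [h1]
  refine Eq.trans ?_ (two_mul _).symm
  simp only [hQ, add_mul, Finset.sum_add_distrib]
  congr 1
  rw [Finset.sum_comm]
  exact Finset.sum_congr rfl fun i _ => Finset.sum_congr rfl fun j _ => by rw [e']

theorem expTrace_gram_mul (U : Matrix (Fin (2 * k)) (Fin n) K) {S : Matrix (Fin n) (Fin n) K}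
    (hS : S.IsSymm) : expTrace (U.transpose * L.Q * U * S) =
      traceExp (∑ i, ∑ j, L.halfGram i j * (U i ⬝ᵥ S.mulVec (U j))) := by
  rw [expTrace, trace_gram_mul U hS, traceExp, ← Nat.cast_ofNat (R := K), ← nsmul_eq_mul, map_nsmul]
  congr 1
  push_cast [nsmul_eq_mul]
  ring

variable [IsTotallyReal K] {I : Fin n → FractionalIdeal (𝓞 K)⁰ K} {A B C D : Matrix (Fin n) (Fin n) K}
  {J : Ideal (𝓞 K)} {α : ∀ i, ApproxGenerator (L.A i) J} {g : ∀ j, ApproxGenerator (I j) J}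

/-- The exponential depends only on the class of `U`, and is given there by the form on the
cokernel of `D`. -/
theorem expTrace_eq_traceChar (h : Gamma0Blocks L I A B C D) (hk : 0 < k) (hI : ∀ j, I j ≠ 0)
    (hD : D.det ≠ 0) {y : 𝓞 K} (hy : algebraMap (𝓞 K) K y = D.det) (hJ : J ≤ Ideal.span {y})
    (η : ApproxGenerator L.halfNorm⁻¹ J) {T : Matrix (Fin (2 * k)) (Fin (2 * k)) (𝓞 K)}
    (hT : ∀ i j, algebraMap (𝓞 K) K (T i j) =
      η.gen * (L.halfGram i j * ((α i).gen * (α j).gen)))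
    {U : Matrix (Fin (2 * k)) (Fin n) K} (hU : U ∈ L.latticeMatrix I) :
    expTrace (U.transpose * L.Q * U * B * D⁻¹) =
      traceChar K (∑ i, ∑ j, T i j • cokernelForm g h hk hI hD
        (halfNorm_approxGenerator_inv_mem η) (cokernelClass α g hI D U i)
          (cokernelClass α g hI D U j)) := by
  obtain ⟨u, hu⟩ := exists_coordinates α g hI hU
  rw [cokernelClass_eq hI hU hu, Matrix.mul_assoc, expTrace_gram_mul U (h.isSymm hD)]
  set S := B * D⁻¹ with hS
  have e : ∑ i, ∑ j, T i j • cokernelForm g h hk hI hD (halfNorm_approxGenerator_inv_mem η)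
      (Submodule.Quotient.mk (u i)) (Submodule.Quotient.mk (u j)) =
      (Submodule.Quotient.mk (∑ i, ∑ j, algebraMap (𝓞 K) K (T i j) *
        (η.inv * (scale g (u i) ⬝ᵥ S.mulVec (scale g (u j))))) : K ⧸ inverseDifferent K) := by
    rw [← Submodule.mkQ_apply, map_sum]
    refine Finset.sum_congr rfl fun i _ => ?_
    rw [map_sum]
    refine Finset.sum_congr rfl fun j _ => ?_
    rw [← Algebra.smul_def, map_smul]
    rfl
  rw [e, traceChar_mk]
  refine traceExp_congr ?_
  rw [← neg_sub, ← Finset.sum_sub_distrib]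
  refine Submodule.neg_mem _ (Submodule.sum_mem _ fun i _ => ?_)
  rw [← Finset.sum_sub_distrib]
  refine Submodule.sum_mem _ fun j _ => ?_
  have e1 : ∀ (x x' : Fin n → K), x ⬝ᵥ S.mulVec x' = ∑ a, ∑ b, x a * x' b * S a b :=
    fun x x' => by
      simp only [dotProduct, Matrix.mulVec, Finset.mul_sum]
      exact Finset.sum_congr rfl fun a _ => Finset.sum_congr rfl fun b _ => by ring
  rw [e1, e1]
  simp only [Finset.mul_sum]
  rw [← Finset.sum_sub_distrib]
  refine Submodule.sum_mem _ fun a _ => ?_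
  rw [← Finset.sum_sub_distrib]
  refine Submodule.sum_mem _ fun b _ => mem_inverseDifferent_of_mem ?_
  set θ := η.unit * ((α i).unit * ((α j).unit * ((g a).unit * (g b).unit))) with hθ
  have hθ1 : θ - 1 ∈ Ideal.span {y} := by
    refine hJ ?_
    have h1 : ∀ {p q : 𝓞 K}, p - 1 ∈ J → q - 1 ∈ J → p * q - 1 ∈ J := fun {p q} hp hq => by
      rw [show p * q - 1 = p * (q - 1) + (p - 1) by ring]
      exact add_mem (Ideal.mul_mem_left _ _ hq) hp
    exact h1 η.unit_sub_one_mem (h1 (α i).unit_sub_one_mem (h1 (α j).unit_sub_one_mem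
      (h1 (g a).unit_sub_one_mem (g b).unit_sub_one_mem)))
  have e2 : algebraMap (𝓞 K) K (T i j) * (η.inv * (scale g (u i) a * scale g (u j) b * S a b)) -
      L.halfGram i j * (U i a * U j b * S a b) =
      (algebraMap (𝓞 K) K (θ - 1) * S a b) * (L.halfGram i j * (U i a * U j b)) := by
    rw [hT, scale, scale, hu, hu, map_sub, map_one, hθ, map_mul, map_mul, map_mul, map_mul,
      ← η.mul_eq, ← (α i).mul_eq, ← (α j).mul_eq, ← (g a).mul_eq, ← (g b).mul_eq]
    ring
  rw [e2]
  have h1 := h.mul_form_mem hI hD hy hθ1 a b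
  have h2 : L.halfGram i j * (U i a * U j b) ∈ L.halfNorm * (I a * I b) := by
    have h3 := FractionalIdeal.mul_mem_mul (FractionalIdeal.mem_spanSingleton_self (𝓞 K)⁰
      (L.halfGram i j)) (FractionalIdeal.mul_mem_mul (hU i a) (hU j b))
    rw [show L.A i * I a * (L.A j * I b) = L.A i * L.A j * (I a * I b) by ring, ← mul_assoc] at h3
    exact mul_le_mul_left (spanSingleton_mul_le_iff.mpr fun x hx x' hx' =>
      L.halfGram_mem hx hx') _ h3
  have h4 := FractionalIdeal.mul_mem_mul h1 h2
  have e3 : (L.halfNorm * different K)⁻¹ * ((I a)⁻¹ * (I b)⁻¹) * (L.halfNorm * (I a * I b)) =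
      (different K)⁻¹ := by
    rw [mul_inv]
    calc _ = (different K)⁻¹ * ((L.halfNorm * L.halfNorm⁻¹) * (I a * (I a)⁻¹) *
          (I b * (I b)⁻¹)) := by ring
      _ = _ := by
        rw [mul_inv_cancel₀ (hI a), mul_inv_cancel₀ (hI b),
          mul_inv_cancel₀ (L.halfNorm_ne_zero hk), mul_one, mul_one, mul_one]
  rwa [e3] at h4

end Phase

section Symbol

variable {K : Type*} [Field K] [NumberField K] {k : ℕ} {L : QuadLattice K k}

/-- A local generator times an approximate inverse is a unit at the prime. -/
theorem IsLocalGenerator.exists_mul_inv {v : HeightOneSpectrum (𝓞 K)}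
    {A : FractionalIdeal (𝓞 K)⁰ K} (hA : A ≠ 0) {a : K} (ha : IsLocalGenerator v A a)
    {J : Ideal (𝓞 K)} (hJ : J ≤ v.asIdeal) (g : ApproxGenerator A J) :
    ∃ r : 𝓞 K, r ∉ v.asIdeal ∧ algebraMap (𝓞 K) K r = a * g.inv := by
  obtain ⟨r, hr⟩ := mul_mem_one hA ha.1 g.inv_mem
  refine ⟨r, fun hrv => ha.2 ?_, hr⟩
  -- `a = (a g⁻¹) g - (u - 1) a` for the approximate inverse `g⁻¹`, and `u - 1` lies in the prime
  have h1 := FractionalIdeal.mul_mem_mul (mem_coeIdeal_of_mem (𝓞 K)⁰ hrv) g.gen_mem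
  have h2 := FractionalIdeal.mul_mem_mul (mem_coeIdeal_of_mem (𝓞 K)⁰ (hJ g.unit_sub_one_mem)) ha.1
  have h3 := Submodule.sub_mem (_ : FractionalIdeal (𝓞 K)⁰ K).1 h1 h2
  rwa [show algebraMap (𝓞 K) K r = _ from hr, map_sub, map_one, ← g.mul_eq,
    show a * g.inv * g.gen - (g.gen * g.inv - 1) * a = a by ring] at h3

theorem IsDiscriminantSign.eq_of_mul_sq {R : Type*} [CommRing R] {p : Ideal R} [hp : p.IsPrime]
    {n : ℕ} {s : R → ℤˣ} (hs : IsDiscriminantSign p n s) {x x' r r' : R} (hx : x ∉ p) (hx' : x' ∉ p)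
    (hr : r ∉ p) (hr' : r' ∉ p) (h : x * r ^ 2 = x' * r' ^ 2) : s x = s x' := by
  have key : ∀ {x r : R}, x ∉ p → r ∉ p → s (x * r ^ 2) = s x := fun {x r} hx hr => by
    rw [sq, hs.map_mul _ _ hx (hp.mul_notMem hr hr), hs.map_mul _ _ hr hr, Int.units_mul_self, mul_one]
  rw [← key hx hr, h, key hx' hr']

/-- The symbol of the discriminant of the local Gram matrix does not depend on the choice of the
local generators. -/
theorem CharacterChoice.symbol_det_eq [IsTotallyReal K] (c : CharacterChoice L) (hk : 0 < k)
    (v : HeightOneSpectrum (𝓞 K)) (hlevel : ¬ L.level ≤ (v.asIdeal : FractionalIdeal (𝓞 K)⁰ K))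
    {J : Ideal (𝓞 K)} (hJ : J ≤ v.asIdeal) (η : ApproxGenerator L.halfNorm⁻¹ J)
    (α : ∀ i, ApproxGenerator (L.A i) J) {T : Matrix (Fin (2 * k)) (Fin (2 * k)) (𝓞 K)}
    (hT : ∀ i j, algebraMap (𝓞 K) K (T i j) =
      η.gen * (L.halfGram i j * ((α i).gen * (α j).gen))) {m : ℕ}
    (hs : IsDiscriminantSign v.asIdeal m fun y => c.symbol v (algebraMap (𝓞 K) K y)) :
    c.symbol v (algebraMap (𝓞 K) K ((-1) ^ k * (T + T.transpose).det)) = c.chiStarPrime v := by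
  have hp := v.isPrime
  have hN := L.halfNorm_ne_zero hk
  have hdet := L.det_of_halfGram hT
  have hy := L.det_notMem_of_not_level_le hk hJ hlevel η α hdet
  obtain ⟨T', hT'⟩ := L.exists_integral_halfGram hN (c.eta_spec v).1 fun i => (c.alpha_spec v i).1
  have hdet' := L.det_of_halfGram hT'
  obtain ⟨r₀, hr₀, hr₀'⟩ := (c.eta_spec v).exists_mul_inv (inv_ne_zero hN) hJ η
  choose r hr hr' using fun i => (c.alpha_spec v i).exists_mul_inv (L.A_ne_zero i) hJ (α i)
  have hunit : η.unit ^ k * ∏ i, (α i).unit ∉ v.asIdeal := by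
    refine hp.mul_notMem (fun h => ?_) (notMem_of_sub_one_mem hp.ne_top
      (prod_sub_one_mem _ fun i _ => hJ (α i).unit_sub_one_mem))
    exact notMem_of_sub_one_mem hp.ne_top (hJ η.unit_sub_one_mem) (hp.mem_of_pow_mem _ h)
  have hr1 : r₀ ^ k * ∏ i, r i ∉ v.asIdeal := by
    refine hp.mul_notMem (fun h => hr₀ (hp.mem_of_pow_mem _ h)) fun h => ?_
    obtain ⟨i, -, hi⟩ := (Ideal.IsPrime.prod_mem_iff).mp h
    exact hr i hi
  have hrel : (T' + T'.transpose).det * (η.unit ^ k * ∏ i, (α i).unit) ^ 2 =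
      (T + T.transpose).det * (r₀ ^ k * ∏ i, r i) ^ 2 := by
    apply RingOfIntegers.coe_injective
    rw [map_mul, map_mul, hdet, hdet', map_pow, map_pow, map_mul, map_mul, map_pow, map_pow,
      map_prod, map_prod, hr₀', ← η.mul_eq, Finset.prod_congr rfl fun i _ => ((α i).mul_eq).symm,
      Finset.prod_congr rfl fun i _ => hr' i, Finset.prod_mul_distrib, Finset.prod_mul_distrib]
    ring
  have hy' : (T' + T'.transpose).det ∉ v.asIdeal := fun h => by
    have h1 := Ideal.mul_mem_right ((η.unit ^ k * ∏ i, (α i).unit) ^ 2) _ h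
    rw [hrel] at h1
    rcases hp.mem_or_mem h1 with h2 | h2
    · exact hy h2
    · exact hr1 (hp.mem_of_pow_mem _ h2)
  have hneg : ((-1) ^ k : 𝓞 K) ∉ v.asIdeal := fun h =>
    hp.ne_top (Ideal.eq_top_of_isUnit_mem _ h (isUnit_one.neg.pow k))
  have h1 := hs.eq_of_mul_sq (hp.mul_notMem hneg hy) (hp.mul_notMem hneg hy') hr1 hunit
    (by rw [mul_assoc, mul_assoc, hrel])
  rw [CharacterChoice.chiStarPrime]
  refine h1.trans ?_
  congr 1
  rw [map_mul, hdet', map_pow, map_neg, map_one]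
  ring

end Symbol
end HilbertSiegel

/-! ### Norms and factorizations -/

namespace HilbertSiegel

open IsDedekindDomain NumberField FractionalIdeal QuadLattice UniqueFactorizationMonoid

section Norm

variable {K : Type*} [Field K] [NumberField K]

theorem norm_eq_prod_real_embeddings [IsTotallyReal K] (x : K) :
    ((Algebra.norm ℚ x : ℚ) : ℝ) = ∏ ψ : K →+* ℝ, ψ x := by
  have h1 := Algebra.norm_eq_prod_embeddings ℚ ℂ x
  have h2 : ∏ σ : K →ₐ[ℚ] ℂ, σ x = ∏ ψ : K →+* ℝ, ((ψ x : ℝ) : ℂ) := by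
    refine (Finset.prod_nbij (fun ψ : K →+* ℝ => (Complex.ofRealHom.comp ψ).toRatAlgHom)
      (fun _ _ => Finset.mem_univ _) (fun ψ _ ψ' _ h => ?_) (fun σ _ => ?_) fun ψ _ => rfl).symm
    · ext z
      exact Complex.ofReal_injective (congrArg (fun σ : K →ₐ[ℚ] ℂ => σ z) h)
    · refine ⟨(IsTotallyReal.complexEmbedding_isReal σ.toRingHom).embedding,
        Finset.mem_coe.mpr (Finset.mem_univ _), ?_⟩
      ext z
      exact ComplexEmbedding.IsReal.coe_embedding_apply
        (IsTotallyReal.complexEmbedding_isReal σ.toRingHom) z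
  rw [h2, ← Complex.ofReal_prod] at h1
  apply Complex.ofReal_injective
  rw [← h1]
  simp

theorem sign_norm [IsTotallyReal K] (x : K) :
    ∏ ψ : K →+* ℝ, (SignType.sign (ψ x) : ℤ) = SignType.sign (Algebra.norm ℚ x) := by
  have h1 : ((SignType.sign ((Algebra.norm ℚ x : ℚ) : ℝ) : SignType) : ℤ) =
      SignType.sign (Algebra.norm ℚ x) := by
    rcases lt_trichotomy (Algebra.norm ℚ x) 0 with h | h | h
    · rw [sign_neg h, sign_neg (by exact_mod_cast h)]
    · rw [h]; simp
    · rw [sign_pos h, sign_pos (by exact_mod_cast h)]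
  rw [← h1, norm_eq_prod_real_embeddings, ← signHom_apply, map_prod]
  simp only [signHom_apply]
  exact (map_prod (SignType.castHom (α := ℤ)) _ _).symm

/-- The signs of the conjugates of `y` turn the norm of `y` into the norm of the ideal `(y)`. -/
theorem norm_pow_mul_sign_norm_pow [IsTotallyReal K] (y : 𝓞 K) (k : ℕ) :
    Algebra.norm ℚ (algebraMap (𝓞 K) K y) ^ k *
      ((∏ ψ : K →+* ℝ, (SignType.sign (ψ (algebraMap (𝓞 K) K y)) : ℤ) : ℤ) : ℚ) ^ k =
        (Ideal.absNorm (Ideal.span {y}) : ℚ) ^ k := by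
  rw [sign_norm, ← mul_pow, Ideal.absNorm_span_singleton,
    show Algebra.norm ℚ (algebraMap (𝓞 K) K y) = (Algebra.norm ℤ y : ℚ) from
      (Algebra.coe_norm_int y).symm]
  congr 1
  rw [Nat.cast_natAbs]
  rcases lt_trichotomy (Algebra.norm ℤ y) 0 with h | h | h
  · rw [sign_neg (by exact_mod_cast h), abs_of_neg h]; simp
  · rw [h]; simp
  · rw [sign_pos (by exact_mod_cast h), abs_of_pos h]; simp

end Norm

section Factors

variable {R : Type*} [CommRing R] [IsDedekindDomain R] {I p : Ideal R}

theorem le_pow_iff_le_count (hI : I ≠ ⊥) (hp : Prime p) (m : ℕ) :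
    I ≤ p ^ m ↔ m ≤ (normalizedFactors I).count p := by
  rw [← Ideal.dvd_iff_le, pow_dvd_iff_le_emultiplicity,
    emultiplicity_eq_count_normalizedFactors hp.irreducible hI, normalize_eq, Nat.cast_le]

theorem exists_eq_pow_count_mul (hI : I ≠ ⊥) (hp : Prime p) :
    ∃ I' : Ideal R, I = p ^ (normalizedFactors I).count p * I' ∧
      p ^ (normalizedFactors I).count p ⊔ I' = ⊤ := by
  obtain ⟨I', hI'⟩ := Ideal.dvd_iff_le.mpr ((le_pow_iff_le_count hI hp _).mpr le_rfl)
  refine ⟨I', hI', ?_⟩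
  have hmax : p.IsMaximal := (Ideal.isPrime_of_prime hp).isMaximal hp.ne_zero
  refine Ideal.pow_sup_eq_top ?_
  by_contra hne
  have h1 : I' ≤ p := by
    have h2 := hmax.eq_of_le hne le_sup_left
    rw [h2]; exact le_sup_right
  have h3 : I ≤ p ^ ((normalizedFactors I).count p + 1) := by
    conv_lhs => rw [hI']
    rw [pow_succ]
    exact Ideal.mul_mono le_rfl h1
  exact absurd ((le_pow_iff_le_count hI hp _).mp h3) (by simp)

theorem absNorm_eq_prod {R : Type*} [CommRing R] [IsDedekindDomain R] [Module.Free ℤ R]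
    [Module.Finite ℤ R] [CharZero R] {I : Ideal R} (hI : I ≠ ⊥) :
    Ideal.absNorm I = ∏ p ∈ (normalizedFactors I).toFinset,
      Nat.card (R ⧸ p) ^ (normalizedFactors I).count p := by
  conv_lhs => rw [← Ideal.prod_normalizedFactors_eq_self hI, Finset.prod_multiset_count, map_prod]
  refine Finset.prod_congr rfl fun p _ => ?_
  rw [map_pow, Ideal.absNorm_apply, Submodule.cardQuot_apply]

end Factors

section ChiStar

variable {K : Type*} [Field K] [NumberField K] {k : ℕ} {L : QuadLattice K k}

theorem count_coeIdeal_eq (v : HeightOneSpectrum (𝓞 K)) {I : Ideal (𝓞 K)} (hI : I ≠ ⊥) :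
    FractionalIdeal.count K v (I : FractionalIdeal (𝓞 K)⁰ K) =
      (normalizedFactors I).count v.asIdeal := by
  classical
  rw [FractionalIdeal.count_coe K v hI, Associates.factors_mk _ hI,
    Associates.count_some (Associates.irreducible_mk.mpr v.irreducible),
    ← Multiset.count_map_eq_count' _ _ Subtype.val_injective, Associates.map_subtype_coe_factors',
    factors_eq_normalizedFactors,
    ← Multiset.count_map_eq_count' _ _ (Associates.mk_injective (M := Ideal (𝓞 K)))]

theorem CharacterChoice.chiStar_coeIdeal (c : CharacterChoice L) {I : Ideal (𝓞 K)} (hI : I ≠ ⊥)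
    {t : Ideal (𝓞 K) → ℤˣ}
    (ht : ∀ v : HeightOneSpectrum (𝓞 K), v.asIdeal ∈ normalizedFactors I →
      t v.asIdeal = c.chiStarPrime v) :
    c.chiStar (I : FractionalIdeal (𝓞 K)⁰ K) =
      ∏ p ∈ (normalizedFactors I).toFinset, t p ^ (normalizedFactors I).count p := by
  classical
  have hmem : ∀ v : HeightOneSpectrum (𝓞 K), v.asIdeal ∈ normalizedFactors I ↔ v.asIdeal ∣ I :=
    fun v => by rw [mem_normalizedFactors_iff' hI]; simp [v.irreducible]
  rw [CharacterChoice.chiStar, finprod_eq_prod_of_mulSupport_subset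
    (s := (Ideal.finite_factors hI).toFinset)]
  · refine Finset.prod_nbij (fun v => v.asIdeal) (fun v hv => ?_) (fun v _ w _ h =>
      HeightOneSpectrum.ext h) (fun p hp => ?_) fun v hv => ?_
    · rw [Multiset.mem_toFinset, hmem]
      simpa using hv
    · have hp' := Multiset.mem_toFinset.mp hp
      have hpp := prime_of_normalized_factor p hp'
      refine ⟨⟨p, Ideal.isPrime_of_prime hpp, hpp.ne_zero⟩, ?_, rfl⟩
      simpa using (hmem ⟨p, Ideal.isPrime_of_prime hpp, hpp.ne_zero⟩).mp hp'
    · have hv' := (hmem v).mpr (by simpa using hv)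
      rw [count_coeIdeal_eq v hI, zpow_natCast, ht v hv']
  · intro v hv
    rw [Function.mem_mulSupport] at hv
    simp only [Set.Finite.coe_toFinset, Set.mem_ofPred_eq]
    rw [← hmem, ← Multiset.count_ne_zero]
    intro h0
    rw [count_coeIdeal_eq v hI, h0] at hv
    exact hv (by simp)

end ChiStar
end HilbertSiegel

/-! ### The value of the Gauss sum -/

namespace HilbertSiegel

open IsDedekindDomain NumberField FractionalIdeal QuadLattice UniqueFactorizationMonoid

section GaussSum

variable {K : Type*} [Field K] [NumberField K] [IsTotallyReal K] {k n : ℕ} {L : QuadLattice K k}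
  {I : Fin n → FractionalIdeal (𝓞 K)⁰ K} {A B C D : Matrix (Fin n) (Fin n) K}

/-- The quotient `ℒ' / ℒ' ᵗD` is finite, and the Gauss sum over it has the asserted value. -/
theorem QuadLattice.Gamma0Blocks.sum_expTrace (h : Gamma0Blocks L I A B C D) (hk : 0 < k)
    (hI : ∀ j, I j ≠ 0) (hD : D.det ≠ 0) (c : CharacterChoice L) :
    (∃ S : Finset (Matrix (Fin (2 * k)) (Fin n) K),
      IsRepresentativeSystem (L.latticeMatrix I) (L.latticeMatrixMul I D) S) ∧
    ∀ S : Finset (Matrix (Fin (2 * k)) (Fin n) K),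
      IsRepresentativeSystem (L.latticeMatrix I) (L.latticeMatrixMul I D) S →
        ∑ U ∈ S, expTrace (U.transpose * L.Q * U * B * D⁻¹) =
          ((Algebra.norm ℚ D.det : ℚ) : ℂ) ^ k * ((c.chi D.det : ℤ) : ℂ) := by
  obtain ⟨y, hy⟩ := h.exists_det hI
  have hy0 : y ≠ 0 := by
    rintro rfl; rw [map_zero] at hy; exact hD hy.symm
  set a : Ideal (𝓞 K) := Ideal.span {y} with ha
  have ha0 : a ≠ ⊥ := by simpa [ha] using hy0
  -- The exponent is chosen so that no prime power in the factorization of `J` contains `4`.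
  set M := (normalizedFactors (Ideal.span {(4 : 𝓞 K)})).card + 1 with hM
  set J := a ^ M with hJ
  have hJ0 : J ≠ ⊥ := pow_ne_zero _ ha0
  have hJa : J ≤ a := Ideal.pow_le_self (Nat.succ_ne_zero _)
  have hN := L.halfNorm_ne_zero hk
  obtain ⟨η⟩ := nonempty_approxGenerator (inv_ne_zero hN) hJ0
  have α : ∀ i, ApproxGenerator (L.A i) J := fun i =>
    (nonempty_approxGenerator (L.A_ne_zero i) hJ0).some
  have g : ∀ j, ApproxGenerator (I j) J := fun j => (nonempty_approxGenerator (hI j) hJ0).some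
  obtain ⟨T, hT⟩ := L.exists_integral_halfGram hN η.gen_mem fun i => (α i).gen_mem
  have hDmem := h.lowerRight_mem
  have hYfin : Finite ((Fin n → 𝓞 K) ⧸ relations g D) := finite_cokernel hI hDmem hD hy
  have : Fintype ((Fin n → 𝓞 K) ⧸ relations g D) := Fintype.ofFinite _
  have hF : ∀ U ∈ L.latticeMatrix I, ∀ U' ∈ L.latticeMatrix I, U - U' ∈ L.latticeMatrixMul I D ↔
      cokernelClass α g hI D U = cokernelClass α g hI D U' := fun U hU U' hU' =>
    cokernelClass_eq_iff hI hDmem hD hy hJa hU hU'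
  have hsurj := exists_cokernelClass_eq (α := α) (g := g) hI hDmem hD hy hJa
  refine ⟨exists_isRepresentativeSystem hF hsurj, fun S hS => ?_⟩
  have hsum : ∑ U ∈ S, expTrace (U.transpose * L.Q * U * B * D⁻¹) = quadSum (traceChar K)
      (cokernelForm g h hk hI hD (halfNorm_approxGenerator_inv_mem η)) T :=
    hS.sum_eq hF hsurj fun U hU => expTrace_eq_traceChar h hk hI hD hy hJa η hT hU
  rw [hsum]
  have hfac : factors J = M • normalizedFactors a := by
    rw [factors_eq_normalizedFactors, hJ, normalizedFactors_pow]
  have hmem : ∀ p, p ∈ factors J ↔ p ∈ normalizedFactors a := fun p => by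
    rw [hfac]; exact Multiset.mem_nsmul_of_ne_zero (Nat.succ_ne_zero _)
  have hprime : ∀ p ∈ factors J, Prime p := fun p hp => prime_of_factor p hp
  have hlevel : ∀ v : HeightOneSpectrum (𝓞 K), v.asIdeal ∈ factors J →
      ¬ L.level ≤ (v.asIdeal : FractionalIdeal (𝓞 K)⁰ K) := fun v hv hle => by
    have := v.isPrime
    refine h.det_notMem hk hI hy v.ne_bot hle ?_
    rw [← Ideal.span_singleton_le_iff_mem, ← Ideal.dvd_iff_le]
    exact dvd_of_mem_normalizedFactors ((hmem _).mp hv)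
  have hJp : ∀ p ∈ factors J, J ≤ p := fun p hp => Ideal.dvd_iff_le.mp (dvd_of_mem_factors hp)
  have hcount : ∀ p, (factors J).count p = M * (normalizedFactors a).count p := fun p => by
    rw [hfac, Multiset.count_nsmul]
  have hsign : ∀ v : HeightOneSpectrum (𝓞 K), v.asIdeal ∈ factors J →
      IsDiscriminantSign v.asIdeal ((factors J).count v.asIdeal)
        fun y => c.symbol v (algebraMap (𝓞 K) K y) := fun v hv => by
    refine c.isDiscriminantSign_symbol v (Multiset.count_ne_zero.mpr hv) fun _ h4 => ?_
    have h40 : Ideal.span {(4 : 𝓞 K)} ≠ ⊥ := by simp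
    rw [← Ideal.span_singleton_le_iff_mem, le_pow_iff_le_count h40 (hprime _ hv), hcount] at h4
    have h1 : 1 ≤ (normalizedFactors a).count v.asIdeal :=
      Multiset.one_le_count_iff_mem.mpr ((hmem _).mp hv)
    have h2 := Multiset.count_le_card v.asIdeal (normalizedFactors (Ideal.span {(4 : 𝓞 K)}))
    have h3 := Nat.mul_le_mul_left M h1
    omega
  classical
  let s : Ideal (𝓞 K) → 𝓞 K → ℤˣ := fun p x =>
    if hp : p.IsPrime ∧ p ≠ ⊥ then c.symbol ⟨p, hp.1, hp.2⟩ (algebraMap (𝓞 K) K x) else 1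
  have hs : ∀ v : HeightOneSpectrum (𝓞 K),
      s v.asIdeal = fun x => c.symbol v (algebraMap (𝓞 K) K x) := fun v => by
    funext x
    exact dif_pos ⟨v.isPrime, v.ne_bot⟩
  have hv : ∀ p ∈ factors J, ∃ v : HeightOneSpectrum (𝓞 K), v.asIdeal = p := fun p hp =>
    ⟨⟨p, Ideal.isPrime_of_prime (hprime p hp), (hprime p hp).ne_zero⟩, rfl⟩
  rw [quadSum_dedekind (isPerfectForm_cokernelForm g h hk hI hD hy hJa η) hJ0
    (isTorsionBySet_cokernel hI hDmem hD hy hJa)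
    (fun I hI => Ideal.finiteQuotientOfFreeOfNeBot I hI) s (fun p hp => ?_)
    (fun p => (normalizedFactors a).count p) (fun p hp => ?_) (Fintype.card_fin _) T
    (fun p hp => ?_)]
  · have hset : (factors J).toFinset = (normalizedFactors a).toFinset := by
      ext p
      rw [Multiset.mem_toFinset, Multiset.mem_toFinset, hmem]
    have hchi : c.chiStar (spanSingleton (𝓞 K)⁰ D.det) =
        ∏ p ∈ (normalizedFactors a).toFinset,
          s p ((-1) ^ k * (T + T.transpose).det) ^ (normalizedFactors a).count p := by
      rw [← hy, ← coeIdeal_span_singleton, ← ha]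
      refine c.chiStar_coeIdeal ha0 fun v hv => ?_
      have hv' := (hmem _).mpr hv
      rw [hs]
      exact c.symbol_det_eq hk v (hlevel v hv') (hJp _ hv') η α hT (hsign v hv')
    have hnorm := norm_pow_mul_sign_norm_pow y k
    rw [hset, ← absNorm_eq_prod ha0, CharacterChoice.chi, hchi, ← hy]
    rw [← ha] at hnorm
    generalize (∏ ψ : K →+* ℝ, (SignType.sign (ψ (algebraMap (𝓞 K) K y)) : ℤ)) = σ at hnorm ⊢
    have hnorm' := congrArg (fun q : ℚ => (q : ℂ)) hnorm
    push_cast at hnorm' ⊢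
    rw [← mul_assoc, hnorm', mul_comm]
  · obtain ⟨v, rfl⟩ := hv p hp
    rw [hs]
    exact hsign v hp
  · have hp1 := hprime p hp
    have := Ideal.isPrime_of_prime hp1
    obtain ⟨J', hJ', hcop⟩ := exists_eq_pow_count_mul hJ0 hp1
    rw [← factors_eq_normalizedFactors] at hJ' hcop
    refine card_torsionBySet_cokernel hI hDmem hD hy hJa hp1.ne_zero (hJp p hp) ?_ ?_ ?_ hJ' hcop
    · rw [hcount]
      exact Nat.le_mul_of_pos_left _ (Nat.succ_pos _)
    · rw [← Ideal.span_singleton_le_iff_mem, le_pow_iff_le_count ha0 hp1]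
    · rw [← Ideal.span_singleton_le_iff_mem, le_pow_iff_le_count ha0 hp1]
      simp
  · obtain ⟨v, rfl⟩ := hv p hp
    have hp1 := v.isPrime
    refine hp1.mul_notMem (fun h1 => hp1.ne_top
      (Ideal.eq_top_of_isUnit_mem _ h1 (isUnit_one.neg.pow k))) ?_
    exact L.det_notMem_of_not_level_le hk (hJp _ hp) (hlevel v hp) η α (L.det_of_halfGram hT)

theorem QuadLattice.Gamma0Blocks.count_det_eq_zero (h : Gamma0Blocks L I A B C D) (hk : 0 < k)
    (hI : ∀ j, I j ≠ 0) (hD : D.det ≠ 0) (v : HeightOneSpectrum (𝓞 K))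
    (hv : L.level ≤ (v.asIdeal : FractionalIdeal (𝓞 K)⁰ K)) :
    FractionalIdeal.count K v (spanSingleton (𝓞 K)⁰ D.det) = 0 := by
  obtain ⟨y, hy⟩ := h.exists_det hI
  have hy0 : Ideal.span {y} ≠ ⊥ := by
    rw [Ne, Ideal.span_singleton_eq_bot]
    rintro rfl; rw [map_zero] at hy; exact hD hy.symm
  have := v.isPrime
  rw [← hy, ← coeIdeal_span_singleton, count_coeIdeal_eq v hy0, Nat.cast_eq_zero,
    Multiset.count_eq_zero]
  intro hmem
  refine h.det_notMem hk hI hy v.ne_bot hv ?_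
  rw [← Ideal.span_singleton_le_iff_mem, ← Ideal.dvd_iff_le]
  exact dvd_of_mem_normalizedFactors hmem

end GaussSum
end HilbertSiegel

end

theorem proposition2p6 {K : Type*} [Field K] [NumberField K] [NumberField.IsTotallyReal K]
    {k n : ℕ} (hk : 0 < k) (hn : 0 < n)
    (L : HilbertSiegel.QuadLattice K k) (c : HilbertSiegel.CharacterChoice L)
    (I : Fin n → FractionalIdeal (𝓞 K)⁰ K) (hI : ∀ j, I j ≠ 0)
    (A B C D : Matrix (Fin n) (Fin n) K)
    (hγ : Matrix.fromBlocks A B C D ∈ L.Gamma0 I) (hD : D.det ≠ 0) :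
    L.latticeMatrixMul I D ≤ L.latticeMatrix I ∧
    (∃ y : 𝓞 K, (y : K) = D.det) ∧
    (∀ v : IsDedekindDomain.HeightOneSpectrum (𝓞 K),
      L.level ≤ (v.asIdeal : FractionalIdeal (𝓞 K)⁰ K) →
        FractionalIdeal.count K v (FractionalIdeal.spanSingleton (𝓞 K)⁰ D.det) = 0) ∧
    (∃ S : Finset (Matrix (Fin (2 * k)) (Fin n) K),
      HilbertSiegel.IsRepresentativeSystem (L.latticeMatrix I) (L.latticeMatrixMul I D) S) ∧
    ∀ S : Finset (Matrix (Fin (2 * k)) (Fin n) K),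
      HilbertSiegel.IsRepresentativeSystem (L.latticeMatrix I) (L.latticeMatrixMul I D) S →
        ∑ U ∈ S, HilbertSiegel.expTrace (U.transpose * L.Q * U * B * D⁻¹) =
          ((Algebra.norm ℚ D.det : ℚ) : ℂ) ^ k * ((c.chi D.det : ℤ) : ℂ) := by
  have h := HilbertSiegel.QuadLattice.gamma0Blocks hk hγ
  exact ⟨HilbertSiegel.QuadLattice.latticeMatrixMul_le hI h.lowerRight_mem, h.exists_det hI,
    h.count_det_eq_zero hk hI hD, h.sum_expTrace hk hI hD c⟩
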